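/- Conventions. Sentences of continuous logic are built from norms of $*$-polynomials (with complex coefficients, without constant term) by continuous functions $\mathbb R^k\to\mathbb R$ and by suprema and infima over the closed unit ball; $\varphi^B\in\mathbb R$ is the value of the sentence $\varphi$ in the C$^*$-algebra $B$. A C$^*$-algebra $A$ is pseudomatricial if $\varphi^A=0$ for every sentence $\varphi$ with $\varphi^{M_n(\mathbb C)}=0$ for all $n\ge 1$. For projections write $p\sim q$ if $p=v^*v$, $q=vv^*$ for some $v\in A$, and $p\precsim q$ if $p\sim r$ for some projection $r\le q$. A projection $m\neq 0$ is minimal if $0$ and $m$ are the only projections $\le m$. $K_0(A)$ is the Grothendieck group of the monoid of Murray–von Neumann classes of projections in matrices over $A$ (with $\oplus$), and $g\le h$ in $K_0(A)$ means $h-g=[p]_0$ for a projection $p$ in some $M_n(A)$. Statement. Let $A$ be a pseudomatricial C$^*$-algebra. Then $A$ has a unit, and: 1. The projections of $A$, up to $\sim$, are totally ordered by $\precsim$: for all projections $p,q,r\in A$, $p\precsim q$ or $q\precsim p$; if $p\precsim q$ and $q\precsim r$ then $p\precsim r$; and $p\precsim q$ and $q\precsim p$ hold together if and only if $p\sim q$.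 2. $K_0(A)$ with $\le$ is a totally ordered abelian group. It has successors and predecessors: $A$ contains a minimal projection, and for every minimal projection $m\in A$ and every $g\in K_0(A)$, $g+[m]_0$ is the least element greater than $g$ and $g-[m]_0$ is the greatest element less than $g$. 3. If $A$ is separable, then $K_0(A)$ is countable and is a dimension group, i.e. it is isomorphic as an ordered abelian group to the direct limit of a sequence of groups $\mathbb Z^{d_k}$, $d_k\ge 0$, with coordinatewise order, along positive homomorphisms. -/

import Mathlib

open scoped Matrix

/-! ### Continuous logic for C⋆-algebras -/

/-- `*`-polynomials in `n` variables, in the language with `0`, addition, multiplication,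
multiplication by complex scalars and the adjoint. -/
inductive CTerm (n : ℕ) : Type
  | var (i : Fin n) : CTerm n
  | zero : CTerm n
  | add (s t : CTerm n) : CTerm n
  | mul (s t : CTerm n) : CTerm n
  | smul (c : ℂ) (t : CTerm n) : CTerm n
  | adj (t : CTerm n) : CTerm n

/-- Formulae of continuous logic in `n` free variables: atomic formulae are norms of
`*`-polynomials, connectives are continuous functions `ℝᵏ → ℝ`, and quantifiers are suprema and
infima over the closed unit ball (binding variable `0` of a formula in `n + 1` variables). -/
inductive CFormula : ℕ → Type
  | norm {n : ℕ} (t : CTerm n) : CFormula n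
  | conn {n k : ℕ} (u : C(Fin k → ℝ, ℝ)) (φ : Fin k → CFormula n) : CFormula n
  | sup {n : ℕ} (φ : CFormula (n + 1)) : CFormula n
  | inf {n : ℕ} (φ : CFormula (n + 1)) : CFormula n

/-- Sentences: formulae without free variables. -/
abbrev CSentence : Type := CFormula 0

section Semantics

variable (A : Type*) [NonUnitalCStarAlgebra A]

/-- The value of a `*`-polynomial in a C⋆-algebra. -/
def CTerm.eval {n : ℕ} (v : Fin n → A) : CTerm n → A
  | .var i => v i
  | .zero => 0
  | .add s t => s.eval v + t.eval v
  | .mul s t => s.eval v * t.eval v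
  | .smul c t => c • t.eval v
  | .adj t => star (t.eval v)

/-- The value of a formula in a C⋆-algebra. In a sentence all variables range over the unit ball,
on which every formula is bounded, so the suprema and infima are genuine. -/
noncomputable def CFormula.eval : {n : ℕ} → CFormula n → (Fin n → A) → ℝ
  | _, .norm t, v => ‖t.eval A v‖
  | _, .conn u φ, v => u fun i => (φ i).eval v
  | _, .sup φ, v => ⨆ x : Metric.closedBall (0 : A) 1, φ.eval (Fin.cons (x : A) v)
  | _, .inf φ, v => ⨅ x : Metric.closedBall (0 : A) 1, φ.eval (Fin.cons (x : A) v)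

/-- The value `φ^A` of a sentence. -/
noncomputable def CSentence.value (φ : CSentence) : ℝ := CFormula.eval A φ Fin.elim0

end Semantics

section Pseudomatricial

open scoped Matrix.Norms.L2Operator

/-- The value of a sentence in the matrix algebra `M_n(ℂ)` with the operator norm. -/
noncomputable def CSentence.matrixValue (n : ℕ) (φ : CSentence) : ℝ :=
  CSentence.value (Matrix (Fin n) (Fin n) ℂ) φ

end Pseudomatricial

/-- `A` is pseudomatricial: every sentence that evaluates to `0` in all matrix algebras `M_n(ℂ)`,
`n ≥ 1`, evaluates to `0` in `A`. The algebra `A` is not assumed to have a unit. -/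
def IsPseudomatricial (A : Type*) [NonUnitalCStarAlgebra A] : Prop :=
  ∀ φ : CSentence, (∀ n : ℕ, 1 ≤ n → CSentence.matrixValue n φ = 0) → CSentence.value A φ = 0

/-! ### Projections in an algebra -/

section Projections

variable {A : Type*} [NonUnitalCStarAlgebra A]

/-- Murray–von Neumann equivalence of projections of `A`. -/
def MvNEquiv (p q : A) : Prop := ∃ v : A, star v * v = p ∧ v * star v = q

/-- Murray–von Neumann subequivalence `p ≾ q`: the projection `p` is equivalent to a projection
`r ≤ q` (for projections, `r ≤ q` means `q * r = r`). -/
def MvNLE (p q : A) : Prop := ∃ r : A, IsStarProjection r ∧ q * r = r ∧ MvNEquiv p r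

/-- Minimal projections: non-zero, and dominating no projections except `0` and itself. -/
def IsMinimalProjection (m : A) : Prop :=
  IsStarProjection m ∧ m ≠ 0 ∧ ∀ q : A, IsStarProjection q → m * q = q → q = 0 ∨ q = m

end Projections

/-! ### The group `K₀` -/

section KZero

variable {A : Type*} [NonUnitalCStarAlgebra A]

/-- Murray–von Neumann equivalence of projections in matrix algebras over `A` of possibly different
sizes, through a rectangular partial isometry. -/
def MatMvNEquiv {ι κ : Type*} [Fintype ι] [Fintype κ] (p : Matrix ι ι A) (q : Matrix κ κ A) :
    Prop :=
  ∃ v : Matrix κ ι A, vᴴ * v = p ∧ v * vᴴ = q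

section Lemmas

variable {ι κ μ ν : Type*} [Fintype ι] [Fintype κ] [Fintype μ] [Fintype ν]

theorem IsStarProjection.matMvN_refl {p : Matrix ι ι A} (hp : IsStarProjection p) :
    MatMvNEquiv p p := by
  have h1 : p * p = p := hp.isIdempotentElem
  have h2 : pᴴ = p := hp.isSelfAdjoint
  exact ⟨p, by rw [h2, h1], by rw [h2, h1]⟩

theorem MatMvNEquiv.symm {p : Matrix ι ι A} {q : Matrix κ κ A} (h : MatMvNEquiv p q) :
    MatMvNEquiv q p := by
  obtain ⟨v, h1, h2⟩ := h
  exact ⟨vᴴ, by rw [Matrix.conjTranspose_conjTranspose, h2],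
    by rw [Matrix.conjTranspose_conjTranspose, h1]⟩

theorem MatMvNEquiv.trans {p : Matrix ι ι A} {q : Matrix κ κ A} {r : Matrix μ μ A}
    (hp : IsStarProjection p) (hr : IsStarProjection r)
    (h : MatMvNEquiv p q) (h' : MatMvNEquiv q r) : MatMvNEquiv p r := by
  obtain ⟨v, h1, h2⟩ := h
  obtain ⟨w, h3, h4⟩ := h'
  have hp1 : p * p = p := hp.isIdempotentElem
  have hr1 : r * r = r := hr.isIdempotentElem
  refine ⟨w * v, ?_, ?_⟩
  · calc (w * v)ᴴ * (w * v) = vᴴ * (wᴴ * w) * v := by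
          rw [Matrix.conjTranspose_mul]; simp only [Matrix.mul_assoc]
      _ = (vᴴ * v) * (vᴴ * v) := by rw [h3, ← h2]; simp only [Matrix.mul_assoc]
      _ = p := by rw [h1, hp1]
  · calc (w * v) * (w * v)ᴴ = w * (v * vᴴ) * wᴴ := by
          rw [Matrix.conjTranspose_mul]; simp only [Matrix.mul_assoc]
      _ = (w * wᴴ) * (w * wᴴ) := by rw [h2, ← h3]; simp only [Matrix.mul_assoc]
      _ = r := by rw [h4, hr1]

theorem IsStarProjection.submatrix_equiv {p : Matrix ι ι A} (hp : IsStarProjection p)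
    (e : κ ≃ ι) : IsStarProjection (p.submatrix e e) := by
  have h1 : p * p = p := hp.isIdempotentElem
  have h2 : pᴴ = p := hp.isSelfAdjoint
  constructor
  · change p.submatrix e e * p.submatrix e e = p.submatrix e e
    rw [Matrix.submatrix_mul_equiv, h1]
  · change (p.submatrix e e)ᴴ = p.submatrix e e
    rw [Matrix.conjTranspose_submatrix, h2]

theorem IsStarProjection.matMvN_submatrix {p : Matrix ι ι A} (hp : IsStarProjection p)
    (e : κ ≃ ι) : MatMvNEquiv p (p.submatrix e e) := by
  have h1 : p * p = p := hp.isIdempotentElem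
  have h2 : pᴴ = p := hp.isSelfAdjoint
  refine ⟨p.submatrix e id, ?_, ?_⟩
  · rw [Matrix.conjTranspose_submatrix, h2, Matrix.submatrix_mul_equiv, h1,
      Matrix.submatrix_id_id]
  · rw [Matrix.conjTranspose_submatrix, h2]
    exact (Matrix.submatrix_mul p p e id e Function.bijective_id).symm.trans (by rw [h1])

theorem IsStarProjection.fromBlocks {p : Matrix ι ι A} {q : Matrix κ κ A}
    (hp : IsStarProjection p) (hq : IsStarProjection q) :
    IsStarProjection (Matrix.fromBlocks p 0 0 q) := by
  have h1 : p * p = p := hp.isIdempotentElem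
  have h2 : pᴴ = p := hp.isSelfAdjoint
  have h3 : q * q = q := hq.isIdempotentElem
  have h4 : qᴴ = q := hq.isSelfAdjoint
  constructor
  · change Matrix.fromBlocks p 0 0 q * Matrix.fromBlocks p 0 0 q = Matrix.fromBlocks p 0 0 q
    rw [Matrix.fromBlocks_multiply]
    simp [h1, h3]
  · change (Matrix.fromBlocks p 0 0 q)ᴴ = Matrix.fromBlocks p 0 0 q
    rw [Matrix.fromBlocks_conjTranspose]
    simp [h2, h4]

theorem MatMvNEquiv.fromBlocks {p : Matrix ι ι A} {q : Matrix κ κ A} {p' : Matrix μ μ A}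
    {q' : Matrix ν ν A} (h : MatMvNEquiv p p') (h' : MatMvNEquiv q q') :
    MatMvNEquiv (Matrix.fromBlocks p 0 0 q) (Matrix.fromBlocks p' 0 0 q') := by
  obtain ⟨v, h1, h2⟩ := h
  obtain ⟨w, h3, h4⟩ := h'
  refine ⟨Matrix.fromBlocks v 0 0 w, ?_, ?_⟩ <;>
  · rw [Matrix.fromBlocks_conjTranspose, Matrix.fromBlocks_multiply]
    simp [h1, h2, h3, h4]

end Lemmas

variable (A) in
/-- Projections in the matrix algebras `M_n(A)`, `n ∈ ℕ`. -/
structure MatProj where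
  /-- the size of the matrix -/
  size : ℕ
  /-- the matrix -/
  mat : Matrix (Fin size) (Fin size) A
  isProj : IsStarProjection mat

namespace MatProj

variable (A) in
/-- Murray–von Neumann equivalence on all projections in matrix algebras over `A`. -/
instance setoid : Setoid (MatProj A) where
  r p q := MatMvNEquiv p.mat q.mat
  iseqv :=
    ⟨fun p => p.isProj.matMvN_refl, fun h => h.symm,
      fun {p _ r} h h' => MatMvNEquiv.trans p.isProj r.isProj h h'⟩

/-- The block-diagonal sum `p ⊕ q = diag(p, q)`. -/
def dsum (p q : MatProj A) : MatProj A where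
  size := p.size + q.size
  mat := (Matrix.fromBlocks p.mat 0 0 q.mat).submatrix finSumFinEquiv.symm finSumFinEquiv.symm
  isProj := (p.isProj.fromBlocks q.isProj).submatrix_equiv _

/-- The projection of size `0`. -/
def zero : MatProj A where
  size := 0
  mat := 0
  isProj := ⟨mul_zero _, star_zero _⟩

/-- A projection of `A` as a `1 × 1` matrix. -/
def ofProj (p : A) (hp : IsStarProjection p) : MatProj A where
  size := 1
  mat := Matrix.of fun _ _ => p
  isProj := by
    have h1 : p * p = p := hp.isIdempotentElem
    have h2 : star p = p := hp.isSelfAdjoint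
    constructor
    · ext i j
      simp [Matrix.mul_apply, h1]
    · ext i j
      simp [Matrix.star_apply, h2]

theorem dsum_equiv_fromBlocks (p q : MatProj A) :
    MatMvNEquiv (p.dsum q).mat (Matrix.fromBlocks p.mat 0 0 q.mat) :=
  ((p.isProj.fromBlocks q.isProj).matMvN_submatrix _).symm

theorem dsum_congr {p p' q q' : MatProj A} (h : p ≈ p') (h' : q ≈ q') :
    p.dsum q ≈ p'.dsum q' := by
  have h1 : MatMvNEquiv p.mat p'.mat := h
  have h2 : MatMvNEquiv q.mat q'.mat := h'
  exact ((p.dsum_equiv_fromBlocks q).trans (p.dsum q).isProj (p'.isProj.fromBlocks q'.isProj)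
    (h1.fromBlocks h2)).trans (p.dsum q).isProj (p'.dsum q').isProj
    (p'.dsum_equiv_fromBlocks q').symm

theorem dsum_comm (p q : MatProj A) : p.dsum q ≈ q.dsum p := by
  have h := (p.isProj.fromBlocks q.isProj).matMvN_submatrix (Equiv.sumComm (Fin q.size) (Fin p.size))
  have e : (Matrix.fromBlocks p.mat 0 0 q.mat).submatrix
      (Equiv.sumComm (Fin q.size) (Fin p.size)) (Equiv.sumComm (Fin q.size) (Fin p.size)) =
      Matrix.fromBlocks q.mat 0 0 p.mat :=
    Matrix.fromBlocks_submatrix_sum_swap_sum_swap _ _ _ _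
  rw [e] at h
  exact ((p.dsum_equiv_fromBlocks q).trans (p.dsum q).isProj (q.isProj.fromBlocks p.isProj)
    h).trans (p.dsum q).isProj (q.dsum p).isProj (q.dsum_equiv_fromBlocks p).symm

theorem zero_dsum (p : MatProj A) : (zero : MatProj A).dsum p ≈ p := by
  have h := ((zero : MatProj A).isProj.fromBlocks p.isProj).matMvN_submatrix
    (Equiv.emptySum (Fin 0) (Fin p.size)).symm
  have e : (Matrix.fromBlocks (zero : MatProj A).mat 0 0 p.mat).submatrix
      (Equiv.emptySum (Fin 0) (Fin p.size)).symm (Equiv.emptySum (Fin 0) (Fin p.size)).symm =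
      p.mat := by
    ext i j; rfl
  have h' : MatMvNEquiv (Matrix.fromBlocks (zero : MatProj A).mat 0 0 p.mat) p.mat :=
    Eq.mp (congrArg (MatMvNEquiv _) e) h
  exact (zero.dsum_equiv_fromBlocks p).trans (zero.dsum p).isProj p.isProj h'

theorem dsum_assoc (p q r : MatProj A) : (p.dsum q).dsum r ≈ p.dsum (q.dsum r) := by
  have hL := (((p.dsum q).dsum_equiv_fromBlocks r).trans ((p.dsum q).dsum r).isProj
    ((p.isProj.fromBlocks q.isProj).fromBlocks r.isProj)
    ((p.dsum_equiv_fromBlocks q).fromBlocks r.isProj.matMvN_refl))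
  have hR := ((p.dsum_equiv_fromBlocks (q.dsum r)).trans (p.dsum (q.dsum r)).isProj
    (p.isProj.fromBlocks (q.isProj.fromBlocks r.isProj))
    (p.isProj.matMvN_refl.fromBlocks (q.dsum_equiv_fromBlocks r)))
  have h := ((p.isProj.fromBlocks q.isProj).fromBlocks r.isProj).matMvN_submatrix
    (Equiv.sumAssoc (Fin p.size) (Fin q.size) (Fin r.size)).symm
  have e : (Matrix.fromBlocks (Matrix.fromBlocks p.mat 0 0 q.mat) 0 0 r.mat).submatrix
      (Equiv.sumAssoc (Fin p.size) (Fin q.size) (Fin r.size)).symm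
      (Equiv.sumAssoc (Fin p.size) (Fin q.size) (Fin r.size)).symm =
      Matrix.fromBlocks p.mat 0 0 (Matrix.fromBlocks q.mat 0 0 r.mat) := by
    ext i j
    rcases i with i | i | i <;> rcases j with j | j | j <;> rfl
  rw [e] at h
  exact (hL.trans ((p.dsum q).dsum r).isProj
    (p.isProj.fromBlocks (q.isProj.fromBlocks r.isProj)) h).trans
    ((p.dsum q).dsum r).isProj (p.dsum (q.dsum r)).isProj hR.symm

end MatProj

variable (A) in
/-- The semigroup `V(A)` of Murray–von Neumann classes of projections in matrices over `A`. -/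
def ProjClass : Type _ := Quotient (MatProj.setoid A)

variable (A) in
instance ProjClass.instAdd : Add (ProjClass A) :=
  ⟨Quotient.map₂ MatProj.dsum fun _ _ h _ _ h' => MatProj.dsum_congr h h'⟩

variable (A) in
instance ProjClass.instZero : Zero (ProjClass A) :=
  ⟨Quotient.mk _ MatProj.zero⟩

/-- The class of a projection in `V(A)`. -/
def ProjClass.mk (p : MatProj A) : ProjClass A := Quotient.mk _ p

theorem ProjClass.zero_add' (x : ProjClass A) : 0 + x = x :=
  Quotient.inductionOn x fun p => Quotient.sound (MatProj.zero_dsum p)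

theorem ProjClass.add_comm' (x y : ProjClass A) : x + y = y + x :=
  Quotient.inductionOn₂ x y fun p q => Quotient.sound (MatProj.dsum_comm p q)

theorem ProjClass.add_assoc' (x y z : ProjClass A) : x + y + z = x + (y + z) :=
  Quotient.inductionOn₃ x y z fun p q r => Quotient.sound (MatProj.dsum_assoc p q r)

variable (A) in
/-- `V(A)` is a commutative monoid under the block-diagonal sum. -/
instance ProjClass.addCommMonoid : AddCommMonoid (ProjClass A) where
  add_assoc := ProjClass.add_assoc'
  zero_add := ProjClass.zero_add'
  add_zero x := (ProjClass.add_comm' x 0).trans (ProjClass.zero_add' x)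
  add_comm := ProjClass.add_comm'
  nsmul := nsmulRec

variable (A) in
/-- `K₀(A)` of an algebra with a unit: the Grothendieck group of `V(A)`. -/
def KZero : Type _ := Algebra.GrothendieckAddGroup (ProjClass A)

variable (A) in
noncomputable instance KZero.addCommGroup : AddCommGroup (KZero A) :=
  inferInstanceAs (AddCommGroup (Algebra.GrothendieckAddGroup (ProjClass A)))

/-- The class `[p]₀` of a projection in a matrix algebra over `A`. -/
noncomputable def KZero.mk (p : MatProj A) : KZero A :=
  Algebra.GrothendieckAddGroup.of (M := ProjClass A) (ProjClass.mk p)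

theorem KZero.mk_zero : KZero.mk (MatProj.zero : MatProj A) = 0 :=
  map_zero (Algebra.GrothendieckAddGroup.of (M := ProjClass A))

theorem KZero.mk_dsum (p q : MatProj A) : KZero.mk (p.dsum q) = KZero.mk p + KZero.mk q :=
  map_add (Algebra.GrothendieckAddGroup.of (M := ProjClass A)) (ProjClass.mk p) (ProjClass.mk q)

variable (A) in
/-- The order of `K₀(A)`, with positive cone `K₀(A)⁺ = {[p]₀}`: `g ≤ h` when `h - g = [p]₀` for a
projection `p` in some `M_n(A)`. For a general algebra it is only a preorder. -/
noncomputable instance KZero.preorder : Preorder (KZero A) where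
  le g h := ∃ p : MatProj A, h - g = KZero.mk p
  le_refl g := ⟨MatProj.zero, by rw [KZero.mk_zero, sub_self]⟩
  le_trans g h k := by
    rintro ⟨p, hp⟩ ⟨q, hq⟩
    exact ⟨p.dsum q, by rw [KZero.mk_dsum, ← hp, ← hq]; abel⟩

end KZero

/-! ### Dimension groups -/

/-- A (countable) dimension group: an abelian group with an order that is isomorphic, as an ordered
group, to the direct limit of a sequence of simplicial groups `ℤ^{d k}` (with the coordinatewise
order) and positive homomorphisms; an element of the limit is positive when it comes from a positive
element of some `ℤ^{d k}`. -/
def IsDimensionGroup (G : Type*) [AddCommGroup G] [Preorder G] : Prop :=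
  IsOrderedAddMonoid G ∧
  ∃ (d : ℕ → ℕ) (f : ∀ i j : ℕ, i ≤ j → (Fin (d i) → ℤ) →+ (Fin (d j) → ℤ)),
    DirectedSystem (fun i => Fin (d i) → ℤ) (fun i j h => f i j h) ∧
    (∀ (i j : ℕ) (h : i ≤ j) (x : Fin (d i) → ℤ), 0 ≤ x → 0 ≤ f i j h x) ∧
    ∃ e : AddCommGroup.DirectLimit (fun i => Fin (d i) → ℤ) f ≃+ G,
      ∀ g : G, 0 ≤ g ↔ ∃ (i : ℕ) (x : Fin (d i) → ℤ), 0 ≤ x ∧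
        e (AddCommGroup.DirectLimit.of (fun i => Fin (d i) → ℤ) f i x) = g

/-! The definition of pseudomatricial turns each statement "for all `x`, `y` there is `z` with `φ ≤
0`", true in every `M_N(ℂ)`, into the same statement in `A` up to any `ε > 0`. It applies to
matrices over `A`, since `M_ι(M_N(ℂ))` is again a full matrix algebra, provided that the constants
depend on `ι` only and not on `N`. Approximate projections and partial isometries lie near exact
ones, or can be corrected to exact ones, so the `ε` disappears again.

Two facts about complex matrices carry the order structure. Comparison: two positive matrices can be
diagonalised in one basis with both eigenvalue lists decreasing, so that of two projections one lies
below the other after a unitary conjugation (`matrix_comparison`). Finiteness: `x* x` and `x x*` are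
unitarily equivalent, so equivalent projections have equivalent complements (`matrix_compl_equiv`),
and this gives cancellation. Hence the monoid `V(A)` is cancellative and totally ordered by `x ≤ x +
z`, and `x + y = 0` forces `x = 0`. It therefore embeds in `K₀(A)` as the positive cone of a total
order.

Two more sentences yield a unit and a minimal projection `m`. A subprojection of `m` is `0` or `m`,
so `[m]` is an atom of `V(A)`. In a total order this makes it the least positive element, and
translation gives successors and predecessors.

If `A` is separable, there are countably many classes, because projections at distance less than `1`
are equivalent. Every countable totally ordered abelian group `G` is a dimension group: finitely
many positive elements are combinations, with coefficients in `ℕ`, of a linearly independent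
positive family, found by a subtractive Euclidean algorithm (`exists_linearIndependent_nonneg`).
Such families generate simplicial subgroups whose limit is `G`. -/

/-! ### Perturbation of projections and partial isometries -/

section CStarPerturbation

variable {B : Type*} [CStarAlgebra B]

theorem exists_inv_sqrt {c : B} (hc : IsSelfAdjoint c) (h : ‖c - 1‖ < 1) :
    ∃ s : B, IsSelfAdjoint s ∧ s * c * s = 1 ∧ (∀ b, Commute c b → Commute s b) ∧ IsUnit s := by
  have hpos : ∀ t ∈ spectrum ℝ c, 0 < t := by
    intro t ht
    have h1 : ‖t - 1‖ ≤ ‖cfc (fun x : ℝ => x - 1) c‖ := norm_apply_le_norm_cfc (fun x : ℝ => x - 1) c ht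
    rw [cfc_sub (fun x : ℝ => x) (fun _ => 1) c, cfc_id' ℝ c, cfc_const_one ℝ c] at h1
    have := (abs_lt.1 (lt_of_le_of_lt h1 h)).1
    linarith
  have hcont : ContinuousOn (fun t : ℝ => (Real.sqrt t)⁻¹) (spectrum ℝ c) :=
    (Real.continuous_sqrt.continuousOn).inv₀ fun t ht => (Real.sqrt_pos.2 (hpos t ht)).ne'
  have key : cfc (fun t : ℝ => (Real.sqrt t)⁻¹) c * c * cfc (fun t : ℝ => (Real.sqrt t)⁻¹) c = 1 := by
    nth_rw 2 [← cfc_id' ℝ c]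
    rw [← cfc_mul _ _ c hcont (continuousOn_id' _), ← cfc_mul (fun t : ℝ => (Real.sqrt t)⁻¹ * t) _ c (hcont.mul (continuousOn_id' _)) hcont]
    rw [← cfc_one ℝ c]
    refine cfc_congr fun t ht => ?_
    have h1 := Real.sqrt_pos.2 (hpos t ht)
    have h2 := Real.mul_self_sqrt (hpos t ht).le
    simp only [Pi.one_apply]
    field_simp
    nlinarith
  have hcomm : ∀ b, Commute c b → Commute (cfc (fun t : ℝ => (Real.sqrt t)⁻¹) c) b := by
    intro b hb
    exact hb.cfc_real _
  refine ⟨cfc (fun t : ℝ => (Real.sqrt t)⁻¹) c, cfc_predicate _ _, key, hcomm, ?_⟩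
  have h3 : cfc (fun t : ℝ => (Real.sqrt t)⁻¹) c * c = c * cfc (fun t : ℝ => (Real.sqrt t)⁻¹) c :=
    hcomm c (Commute.refl c)
  exact ⟨⟨_, c * cfc (fun t : ℝ => (Real.sqrt t)⁻¹) c, by rw [← mul_assoc, key],
    by rw [← h3, key]⟩, rfl⟩

/-- Polar decomposition in the corner of `p`. Adding `1 - p` to `v* v` gives an element near `1`
that commutes with `p`, so its inverse square root `s` can be formed in the whole algebra and still
preserves the corner. The invertibility of `s` lets one return from `v s` to `v`. -/
theorem IsStarProjection.exists_normalize {p v : B} (hp : IsStarProjection p) (hv : v * p = v)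
    (h : ‖star v * v - p‖ < 1) :
    ∃ s : B, IsSelfAdjoint s ∧ IsUnit s ∧ s * p = p * s ∧ star (v * s) * (v * s) = p := by
  have hp1 : p * p = p := hp.isIdempotentElem
  have hp2 : star p = p := hp.isSelfAdjoint
  have hv' : p * star v = star v := by
    have := congrArg star hv
    rwa [star_mul, hp2] at this
  set c : B := star v * v + (1 - p) with hc
  have hcs : IsSelfAdjoint c := by
    simp [hc, IsSelfAdjoint, hp2]
  have hc1 : ‖c - 1‖ < 1 := by
    have : c - 1 = star v * v - p := by rw [hc]; abel
    rwa [this]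
  obtain ⟨s, hs, hscs, hcomm, hu⟩ := exists_inv_sqrt hcs hc1
  have hcp : c * p = star v * v := by
    rw [hc, add_mul, sub_mul, one_mul, hp1, mul_assoc, hv]; simp
  have hpc : p * c = star v * v := by
    rw [hc, mul_add, mul_sub, mul_one, hp1, ← mul_assoc, hv']; simp
  have hsp : s * p = p * s := hcomm p (hcp.trans hpc.symm)
  refine ⟨s, hs, hu, hsp, ?_⟩
  calc star (v * s) * (v * s) = s * (star v * v) * s := by
        rw [star_mul, hs.star_eq]; simp only [mul_assoc]
    _ = s * c * (p * s) := by rw [← hcp]; simp only [mul_assoc]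
    _ = s * c * s * p := by rw [← hsp]; simp only [mul_assoc]
    _ = p := by rw [hscs, one_mul]

theorem IsStarProjection.exists_mvN_le {p q v : B} (hp : IsStarProjection p) (hv : v * p = v)
    (hq : q * v = v) (h : ‖star v * v - p‖ < 1) :
    ∃ w : B, star w * w = p ∧ q * w = w := by
  obtain ⟨s, -, -, -, h1⟩ := hp.exists_normalize hv h
  exact ⟨v * s, h1, by rw [← mul_assoc, hq]⟩

theorem IsStarProjection.mul_of_star_mul_self {p w : B} (hp : IsStarProjection p)
    (h : star w * w = p) : w * p = w := by
  have hp1 : p * p = p := hp.isIdempotentElem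
  have hp2 : star p = p := hp.isSelfAdjoint
  have : star (w * p - w) * (w * p - w) = 0 := by
    have : star (w * p - w) * (w * p - w) =
        p * (star w * w) * p - p * (star w * w) - (star w * w) * p + star w * w := by
      rw [star_sub, star_mul, hp2]; noncomm_ring
    rw [this, h, hp1, hp1]; abel
  exact sub_eq_zero.1 (CStarRing.star_mul_self_eq_zero_iff _ |>.1 this)

/-- The normalised `w = v s` satisfies `w* w = p` and `q w = w`. Equality `w w* = q` holds because
`q - w w*` annihilates `v v* + (1 - q)`, which is invertible by the second estimate. -/
theorem IsStarProjection.mvNEquiv_of_norm_lt {p q v : B} (hp : IsStarProjection p)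
    (hq : IsStarProjection q) (hvp : v * p = v) (hqv : q * v = v)
    (h1 : ‖star v * v - p‖ < 1) (h2 : ‖v * star v - q‖ < 1) : MvNEquiv p q := by
  obtain ⟨s, hs, hu, hsp, hw⟩ := hp.exists_normalize hvp h1
  have hq1 : q * q = q := hq.isIdempotentElem
  have hq2 : star q = q := hq.isSelfAdjoint
  refine ⟨v * s, hw, ?_⟩
  set w := v * s with hwdef
  have hwp : w * p = w := hp.mul_of_star_mul_self hw
  have hwwv : w * star w * v = v := by
    apply hu.mul_left_injective
    change w * star w * v * s = v * s
    rw [mul_assoc, ← hwdef, mul_assoc, hw, hwp]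
  have hvq : star v * q = star v := by
    have := congrArg star hqv
    rwa [star_mul, hq2] at this
  have hqw : q * w = w := by rw [hwdef, ← mul_assoc, hqv]
  have hwq : star w * q = star w := by
    have := congrArg star hqw
    rwa [star_mul, hq2] at this
  set c : B := v * star v + (1 - q) with hc
  have hc1 : ‖1 - c‖ < 1 := by
    have : 1 - c = -(v * star v - q) := by rw [hc]; abel
    rwa [this, norm_neg]
  have hcu : IsUnit c := by
    have := (Units.oneSub (1 - c) hc1).isUnit
    simpa using this
  have h0 : (q - w * star w) * c = 0 := by
    have e1 : (q - w * star w) * v = 0 := by rw [sub_mul, hqv, hwwv, sub_self]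
    have e2 : (q - w * star w) * (1 - q) = 0 := by
      rw [mul_sub, mul_one, sub_mul, hq1, mul_assoc w (star w) q, hwq, sub_self]
    rw [hc, mul_add, ← mul_assoc, e1, e2, zero_mul, add_zero]
  have := hcu.mul_left_injective (a₁ := q - w * star w) (a₂ := 0) (by simpa using h0)
  exact (sub_eq_zero.1 this).symm

theorem IsStarProjection.norm_le_one' {p : B} (hp : IsStarProjection p) : ‖p‖ ≤ 1 := by
  have h : ‖star p * p‖ = ‖p‖ * ‖p‖ := CStarRing.norm_star_mul_self
  rw [hp.isSelfAdjoint.star_eq, hp.isIdempotentElem.eq] at h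
  nlinarith [norm_nonneg p]

theorem IsStarProjection.eq_zero_of_norm_lt_one {p : B} (hp : IsStarProjection p)
    (h1 : ‖p‖ < 1) : p = 0 := by
  have h : ‖star p * p‖ = ‖p‖ * ‖p‖ := CStarRing.norm_star_mul_self
  rw [hp.isSelfAdjoint.star_eq, hp.isIdempotentElem.eq] at h
  have : ‖p‖ = 0 := by nlinarith [norm_nonneg p]
  simpa using this

theorem IsStarProjection.mvNEquiv_of_norm_sub_lt {p q : B} (hp : IsStarProjection p)
    (hq : IsStarProjection q) (h : ‖p - q‖ < 1) : MvNEquiv p q := by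
  have hp1 : p * p = p := hp.isIdempotentElem
  have hp2 : star p = p := hp.isSelfAdjoint
  have hq1 : q * q = q := hq.isIdempotentElem
  have hq2 : star q = q := hq.isSelfAdjoint
  have aux : ∀ r : B, IsStarProjection r → ∀ x : B, ‖r * x * r‖ ≤ ‖x‖ := by
    intro r hr x
    have h1 := hr.norm_le_one'
    calc ‖r * x * r‖ ≤ ‖r‖ * ‖x‖ * ‖r‖ := norm_mul₃_le
      _ ≤ 1 * ‖x‖ * 1 := by gcongr
      _ = ‖x‖ := by ring
  refine hp.mvNEquiv_of_norm_lt hq (v := q * p) (by rw [mul_assoc, hp1]) (by rw [← mul_assoc, hq1])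
    (lt_of_le_of_lt ?_ h) (lt_of_le_of_lt ?_ h)
  · have : star (q * p) * (q * p) - p = p * (q - p) * p := by
      rw [star_mul, hp2, hq2, mul_sub, sub_mul, hp1, hp1, mul_assoc p q, ← mul_assoc q q p, hq1,
        ← mul_assoc]
    rw [this, norm_sub_rev]
    exact aux p hp _
  · have : (q * p) * star (q * p) - q = q * (p - q) * q := by
      rw [star_mul, hp2, hq2, mul_sub, sub_mul, hq1, hq1, mul_assoc q p, ← mul_assoc p p q, hp1,
        ← mul_assoc]
    rw [this]
    exact aux q hq _

/-- The projection is the spectral projection of `a` for `[1/2, ∞)`; the bound `δ < 1/4` keeps `1/2`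
out of the spectrum. On the spectrum `|t| |t - 1| ≤ δ` and one factor is at least `1/2`, so the
other is at most `2δ`. -/
theorem exists_isStarProjection_near {a : B} (ha : IsSelfAdjoint a) {δ : ℝ}
    (h : ‖a * a - a‖ ≤ δ) (hδ : δ < 1 / 4) :
    ∃ p : B, IsStarProjection p ∧ ‖p - a‖ ≤ 2 * δ := by
  have hsp : ∀ t ∈ spectrum ℝ a, |t * t - t| ≤ δ := by
    intro t ht
    have h1 : ‖t * t - t‖ ≤ ‖cfc (fun x : ℝ => x * x - x) a‖ :=
      norm_apply_le_norm_cfc (fun x : ℝ => x * x - x) a ht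
    rw [cfc_sub (fun x : ℝ => x * x) (fun x : ℝ => x) a, cfc_mul (fun x : ℝ => x) (fun x => x) a,
      cfc_id' ℝ a] at h1
    exact h1.trans h
  have hne : ∀ t ∈ spectrum ℝ a, t ≠ 1 / 2 := by
    rintro t ht rfl
    have := hsp _ ht
    norm_num [abs_le] at this
    linarith
  set f : ℝ → ℝ := fun t => if t < 1 / 2 then 0 else 1 with hf
  have hcont : ContinuousOn f (spectrum ℝ a) := by
    intro t ht
    apply ContinuousAt.continuousWithinAt
    rcases lt_or_gt_of_ne (hne t ht) with h1 | h1
    · refine (continuousAt_const (y := (0 : ℝ))).congr ?_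
      filter_upwards [Iio_mem_nhds h1] with x hx
      exact (if_pos hx).symm
    · refine (continuousAt_const (y := (1 : ℝ))).congr ?_
      filter_upwards [Ioi_mem_nhds h1] with x hx
      exact (if_neg (not_lt.2 (le_of_lt hx))).symm
  have hδ0 : 0 ≤ δ := (norm_nonneg _).trans h
  refine ⟨cfc f a, ⟨?_, cfc_predicate _ _⟩, ?_⟩
  · change cfc f a * cfc f a = cfc f a
    rw [← cfc_mul f f a hcont hcont]
    refine cfc_congr fun t _ => ?_
    simp only [hf]; split_ifs <;> norm_num
  · have e : cfc f a - a = cfc (fun t => f t - t) a := by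
      rw [cfc_sub f (fun t => t) a hcont (continuousOn_id' _), cfc_id' ℝ a]
    rw [e]
    refine norm_cfc_le (by positivity) fun t ht => ?_
    have h1 := hsp t ht
    rw [Real.norm_eq_abs]
    have h2 : |t| * |t - 1| ≤ δ := by rw [← abs_mul, mul_sub, mul_one]; exact h1
    simp only [hf]
    split_ifs with h3
    · have h4 : 1 / 2 ≤ |t - 1| := by rw [abs_of_neg (by linarith)]; linarith
      rw [zero_sub, abs_neg]
      nlinarith [abs_nonneg t]
    · have h4 : 1 / 2 ≤ |t| := by rw [abs_of_nonneg (by linarith)]; linarith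
      rw [abs_sub_comm]
      nlinarith [abs_nonneg (t - 1)]

end CStarPerturbation

/-! ### Transfer from matrix algebras through sentences -/

section Transfer

theorem CTerm.exists_norm_eval_le (A : Type*) [NonUnitalCStarAlgebra A] {n : ℕ} (t : CTerm n) :
    ∃ C : ℝ, 0 ≤ C ∧ ∀ v : Fin n → A, (∀ i, ‖v i‖ ≤ 1) → ‖t.eval A v‖ ≤ C := by
  induction t with
  | var i => exact ⟨1, zero_le_one, fun v hv => hv i⟩
  | zero => exact ⟨0, le_rfl, fun v _ => by simp [CTerm.eval]⟩
  | add s t hs ht =>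
    obtain ⟨C, hC, h⟩ := hs
    obtain ⟨D, hD, h'⟩ := ht
    exact ⟨C + D, by positivity, fun v hv => (norm_add_le _ _).trans (add_le_add (h v hv) (h' v hv))⟩
  | mul s t hs ht =>
    obtain ⟨C, hC, h⟩ := hs
    obtain ⟨D, hD, h'⟩ := ht
    exact ⟨C * D, by positivity, fun v hv => (norm_mul_le _ _).trans
      (mul_le_mul (h v hv) (h' v hv) (norm_nonneg _) hC)⟩
  | smul c t ht =>
    obtain ⟨D, hD, h'⟩ := ht
    exact ⟨‖c‖ * D, by positivity, fun v hv => (norm_smul_le _ _).trans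
      (mul_le_mul_of_nonneg_left (h' v hv) (norm_nonneg _))⟩
  | adj t ht =>
    obtain ⟨D, hD, h'⟩ := ht
    exact ⟨D, hD, fun v hv => (norm_star _).le.trans (h' v hv)⟩

theorem norm_cons_le_one {A : Type*} [NonUnitalCStarAlgebra A] {n : ℕ} {v : Fin n → A}
    (hv : ∀ i, ‖v i‖ ≤ 1) {x : A} (hx : ‖x‖ ≤ 1) (i : Fin (n + 1)) :
    ‖(Fin.cons x v : Fin (n + 1) → A) i‖ ≤ 1 := by
  refine Fin.cases ?_ (fun j => ?_) i
  · simpa using hx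
  · simpa using hv j

/-- Continuous connectives stay bounded because their arguments range over a compact box. Without
this bound the real `⨆` and `⨅` could take their default value and would not compare with individual
values. -/
theorem CFormula.exists_abs_eval_le (A : Type*) [NonUnitalCStarAlgebra A] {n : ℕ}
    (φ : CFormula n) :
    ∃ C : ℝ, ∀ v : Fin n → A, (∀ i, ‖v i‖ ≤ 1) → |φ.eval A v| ≤ C := by
  induction φ with
  | norm t =>
    obtain ⟨C, -, h⟩ := t.exists_norm_eval_le A
    exact ⟨C, fun v hv => by simpa [CFormula.eval] using h v hv⟩
  | @conn n k u φ ih =>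
    choose C hC using ih
    have hcpt : IsCompact (Set.pi Set.univ fun i : Fin k => Set.Icc (-C i) (C i)) :=
      isCompact_univ_pi fun i => isCompact_Icc
    obtain ⟨D, hD⟩ := hcpt.exists_bound_of_continuousOn u.continuous.continuousOn
    exact ⟨D, fun v hv => hD _ fun i _ => abs_le.1 (hC i v hv)⟩
  | sup φ ih =>
    obtain ⟨C, hC⟩ := ih
    refine ⟨C, fun v hv => ?_⟩
    have h : ∀ x : Metric.closedBall (0 : A) 1, |φ.eval A (Fin.cons (x : A) v)| ≤ C := fun x =>
      hC _ (norm_cons_le_one hv (mem_closedBall_zero_iff.1 x.2))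
    have : Nonempty (Metric.closedBall (0 : A) 1) := ⟨⟨0, by simp⟩⟩
    refine abs_le.2 ⟨?_, ciSup_le fun x => (abs_le.1 (h x)).2⟩
    exact (abs_le.1 (h ⟨0, by simp⟩)).1.trans
      (le_ciSup (f := fun x : Metric.closedBall (0 : A) 1 => φ.eval A (Fin.cons (x : A) v))
        ⟨C, by rintro _ ⟨x, rfl⟩; exact (abs_le.1 (h x)).2⟩ ⟨0, by simp⟩)
  | inf φ ih =>
    obtain ⟨C, hC⟩ := ih
    refine ⟨C, fun v hv => ?_⟩
    have h : ∀ x : Metric.closedBall (0 : A) 1, |φ.eval A (Fin.cons (x : A) v)| ≤ C := fun x =>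
      hC _ (norm_cons_le_one hv (mem_closedBall_zero_iff.1 x.2))
    have : Nonempty (Metric.closedBall (0 : A) 1) := ⟨⟨0, by simp⟩⟩
    refine abs_le.2 ⟨le_ciInf fun x => (abs_le.1 (h x)).1, ?_⟩
    exact (ciInf_le (f := fun x : Metric.closedBall (0 : A) 1 => φ.eval A (Fin.cons (x : A) v))
        ⟨-C, by rintro _ ⟨x, rfl⟩; exact (abs_le.1 (h x)).1⟩ ⟨0, by simp⟩).trans
        (abs_le.1 (h ⟨0, by simp⟩)).2

namespace CFormula

variable {A : Type*} [NonUnitalCStarAlgebra A] {n : ℕ}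

theorem eval_sup_le {φ : CFormula (n + 1)} {v : Fin n → A} {c : ℝ}
    (h : ∀ x : A, ‖x‖ ≤ 1 → φ.eval A (Fin.cons x v) ≤ c) : (sup φ).eval A v ≤ c := by
  have : Nonempty (Metric.closedBall (0 : A) 1) := ⟨⟨0, by simp⟩⟩
  exact ciSup_le fun x => h x (mem_closedBall_zero_iff.1 x.2)

theorem le_eval_sup {φ : CFormula (n + 1)} {v : Fin n → A} (hv : ∀ i, ‖v i‖ ≤ 1) {x : A}
    (hx : ‖x‖ ≤ 1) : φ.eval A (Fin.cons x v) ≤ (sup φ).eval A v := by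
  obtain ⟨C, hC⟩ := φ.exists_abs_eval_le A
  exact le_ciSup (f := fun x : Metric.closedBall (0 : A) 1 => φ.eval A (Fin.cons (x : A) v))
    ⟨C, by rintro _ ⟨x, rfl⟩; exact (abs_le.1 (hC _ (norm_cons_le_one hv (mem_closedBall_zero_iff.1 x.2)))).2⟩
    ⟨x, by simpa using hx⟩

theorem eval_inf_le {φ : CFormula (n + 1)} {v : Fin n → A} (hv : ∀ i, ‖v i‖ ≤ 1) {x : A}
    (hx : ‖x‖ ≤ 1) : (inf φ).eval A v ≤ φ.eval A (Fin.cons x v) := by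
  obtain ⟨C, hC⟩ := φ.exists_abs_eval_le A
  exact ciInf_le (f := fun x : Metric.closedBall (0 : A) 1 => φ.eval A (Fin.cons (x : A) v))
    ⟨-C, by rintro _ ⟨x, rfl⟩; exact (abs_le.1 (hC _ (norm_cons_le_one hv (mem_closedBall_zero_iff.1 x.2)))).1⟩
    ⟨x, by simpa using hx⟩

theorem eval_inf_nonneg {φ : CFormula (n + 1)} {v : Fin n → A}
    (h : ∀ x : A, ‖x‖ ≤ 1 → 0 ≤ φ.eval A (Fin.cons x v)) : 0 ≤ (inf φ).eval A v := by
  exact Real.iInf_nonneg fun x => h x (mem_closedBall_zero_iff.1 x.2)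

theorem eval_sup_nonneg {φ : CFormula (n + 1)} {v : Fin n → A}
    (h : ∀ x : A, ‖x‖ ≤ 1 → 0 ≤ φ.eval A (Fin.cons x v)) : 0 ≤ (sup φ).eval A v := by
  exact Real.iSup_nonneg fun x => h x (mem_closedBall_zero_iff.1 x.2)

theorem exists_eval_lt {φ : CFormula (n + 1)} {v : Fin n → A} {c : ℝ}
    (h : (inf φ).eval A v < c) : ∃ x : A, ‖x‖ ≤ 1 ∧ φ.eval A (Fin.cons x v) < c := by
  have : Nonempty (Metric.closedBall (0 : A) 1) := ⟨⟨0, by simp⟩⟩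
  obtain ⟨x, hx⟩ := exists_lt_of_ciInf_lt h
  exact ⟨x, mem_closedBall_zero_iff.1 x.2, hx⟩

/-- The supremum over all the free variables. -/
def closeSup : {n : ℕ} → CFormula n → CFormula 0
  | 0, φ => φ
  | _ + 1, φ => closeSup (sup φ)

/-- The infimum over the first `m` variables. -/
def iterInf : {m : ℕ} → CFormula (n + m) → CFormula n
  | 0, φ => φ
  | _ + 1, φ => iterInf (inf φ)

theorem closeSup_eval_le {φ : CFormula n} {c : ℝ}
    (h : ∀ v : Fin n → A, (∀ i, ‖v i‖ ≤ 1) → φ.eval A v ≤ c) :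
    CSentence.value A (closeSup φ) ≤ c := by
  induction n with
  | zero => exact h _ (fun i => i.elim0)
  | succ n ih => exact ih fun v hv => eval_sup_le fun x hx => h _ (norm_cons_le_one hv hx)

theorem closeSup_eval_nonneg {φ : CFormula n}
    (h : ∀ v : Fin n → A, (∀ i, ‖v i‖ ≤ 1) → 0 ≤ φ.eval A v) :
    0 ≤ CSentence.value A (closeSup φ) := by
  induction n with
  | zero => exact h _ (fun i => i.elim0)
  | succ n ih => exact ih fun v hv => eval_sup_nonneg fun x hx => h _ (norm_cons_le_one hv hx)

theorem le_closeSup_eval {φ : CFormula n} {v : Fin n → A} (hv : ∀ i, ‖v i‖ ≤ 1) :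
    φ.eval A v ≤ CSentence.value A (closeSup φ) := by
  induction n with
  | zero => rw [Subsingleton.elim v Fin.elim0]; rfl
  | succ n ih =>
    have h1 := le_eval_sup (φ := φ) (v := Fin.tail v) (fun i => hv _) (hv 0)
    rw [Fin.cons_self_tail] at h1
    exact h1.trans (ih fun i => hv _)

/-- Prepend `m` variables, the last one bound first. -/
def prepend {A : Type*} {m n : ℕ} (v : Fin n → A) (y : Fin m → A) : Fin (n + m) → A :=
  fun i => if h : (i : ℕ) < m then y ⟨i, h⟩ else v ⟨i - m, by omega⟩

theorem prepend_cons {A : Type*} {m n : ℕ} (v : Fin n → A) (y : Fin m → A) (x : A) :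
    (Fin.cons x (prepend v y) : Fin (n + m + 1) → A) =
      prepend v (Fin.cons x y : Fin (m + 1) → A) := by
  funext i
  refine Fin.cases ?_ (fun j => ?_) i
  · simp [prepend]
  · simp only [Fin.cons_succ, prepend, Fin.val_succ, Nat.add_lt_add_iff_right, Nat.add_sub_add_right]
    split_ifs with h
    · rfl
    · rfl

theorem prepend_zero {A : Type*} {n : ℕ} (v : Fin n → A) (y : Fin 0 → A) : prepend v y = v := by
  funext i
  simp [prepend]

theorem norm_prepend_le_one {m : ℕ} {v : Fin n → A} {y : Fin m → A} (hv : ∀ i, ‖v i‖ ≤ 1)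
    (hy : ∀ i, ‖y i‖ ≤ 1) (i : Fin (n + m)) : ‖prepend v y i‖ ≤ 1 := by
  unfold prepend
  split_ifs
  exacts [hy _, hv _]

theorem iterInf_eval_le {m : ℕ} {φ : CFormula (n + m)} {v : Fin n → A} (hv : ∀ i, ‖v i‖ ≤ 1)
    {y : Fin m → A} (hy : ∀ i, ‖y i‖ ≤ 1) : (iterInf φ).eval A v ≤ φ.eval A (prepend v y) := by
  induction m with
  | zero => rw [prepend_zero]; rfl
  | succ m ih =>
    have h1 := eval_inf_le (φ := φ) (v := prepend v (Fin.tail y))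
      (norm_prepend_le_one hv fun i => hy _) (hy 0)
    rw [prepend_cons, Fin.cons_self_tail] at h1
    exact (ih fun i => hy _).trans h1

theorem iterInf_eval_nonneg {m : ℕ} {φ : CFormula (n + m)} {v : Fin n → A}
    (hv : ∀ i, ‖v i‖ ≤ 1) (h : ∀ w : Fin (n + m) → A, (∀ i, ‖w i‖ ≤ 1) → 0 ≤ φ.eval A w) :
    0 ≤ (iterInf φ).eval A v := by
  induction m with
  | zero => exact h v hv
  | succ m ih => exact ih fun w hw => eval_inf_nonneg fun x hx => h _ (norm_cons_le_one hw hx)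

theorem exists_eval_lt_of_iterInf {m : ℕ} {φ : CFormula (n + m)} {v : Fin n → A}
    {c : ℝ} (h : (iterInf φ).eval A v < c) :
    ∃ y : Fin m → A, (∀ i, ‖y i‖ ≤ 1) ∧ φ.eval A (prepend v y) < c := by
  induction m with
  | zero => exact ⟨Fin.elim0, fun i => i.elim0, by rw [prepend_zero]; exact h⟩
  | succ m ih =>
    obtain ⟨y, hy, h1⟩ := ih h
    obtain ⟨x, hx, h2⟩ := exists_eval_lt h1
    exact ⟨Fin.cons x y, norm_cons_le_one hy hx, by rw [← prepend_cons]; exact h2⟩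

/-- The positive part of a formula. -/
noncomputable def posPart (φ : CFormula n) : CFormula n :=
  conn (k := 1) ⟨fun t => max (t 0) 0, by fun_prop⟩ fun _ => φ

theorem posPart_eval (φ : CFormula n) (v : Fin n → A) :
    φ.posPart.eval A v = max (φ.eval A v) 0 := rfl

end CFormula

-- The sentence is `sup_v inf_y max(φ, 0)`. The positive part turns the inequality `φ ≤ 0` into a
-- value equal to `0`, the only kind that the definition transfers. The infimum need not be attained
-- in `A`, hence the `ε`.
open scoped Matrix.Norms.L2Operator in
theorem IsPseudomatricial.exists_eval_lt {A : Type*} [NonUnitalCStarAlgebra A]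
    (hA : IsPseudomatricial A) {n m : ℕ} (φ : CFormula (n + m))
    (h : ∀ N : ℕ, 1 ≤ N → ∀ v : Fin n → Matrix (Fin N) (Fin N) ℂ, (∀ i, ‖v i‖ ≤ 1) →
      ∃ y : Fin m → Matrix (Fin N) (Fin N) ℂ, (∀ i, ‖y i‖ ≤ 1) ∧
        φ.eval (Matrix (Fin N) (Fin N) ℂ) (CFormula.prepend v y) ≤ 0)
    {v : Fin n → A} (hv : ∀ i, ‖v i‖ ≤ 1) {ε : ℝ} (hε : 0 < ε) :
    ∃ y : Fin m → A, (∀ i, ‖y i‖ ≤ 1) ∧ φ.eval A (CFormula.prepend v y) < ε := by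
  have h0 := hA (CFormula.closeSup (CFormula.iterInf φ.posPart)) fun N hN => by
    refine le_antisymm (CFormula.closeSup_eval_le fun v hv => ?_)
      (CFormula.closeSup_eval_nonneg fun v hv => CFormula.iterInf_eval_nonneg hv fun w _ => ?_)
    · obtain ⟨y, hy, hle⟩ := h N hN v hv
      refine (CFormula.iterInf_eval_le hv hy).trans ?_
      rw [CFormula.posPart_eval, max_eq_right hle]
    · rw [CFormula.posPart_eval]; exact le_max_right _ _
  have h1 := CFormula.le_closeSup_eval (φ := CFormula.iterInf φ.posPart) hv
  obtain ⟨y, hy, h2⟩ := CFormula.exists_eval_lt_of_iterInf (lt_of_le_of_lt (h1.trans h0.le) hε)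
  rw [CFormula.posPart_eval] at h2
  exact ⟨y, hy, (le_max_left _ _).trans_lt h2⟩

end Transfer

/-! ### Formulae about matrices over the algebra, written in their entries -/

section MatrixTerms

/-- `*`-polynomials, with integer coefficients, in three square matrices. -/
inductive MTerm : Type
  | var (i : Fin 3) : MTerm
  | sub (s t : MTerm) : MTerm
  | mul (s t : MTerm) : MTerm
  | adj (t : MTerm) : MTerm

namespace MTerm

/-- The value of a `*`-polynomial at three matrices over an algebra. -/
def eval {ι : Type*} [Fintype ι] {A : Type*} [NonUnitalCStarAlgebra A] (x : Fin 3 → Matrix ι ι A) :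
    MTerm → Matrix ι ι A
  | var i => x i
  | sub s t => s.eval x - t.eval x
  | mul s t => s.eval x * t.eval x
  | adj t => (t.eval x)ᴴ

/-- The `*`-polynomials that compute the entries of an `MTerm`. -/
noncomputable def compile {ι : Type*} [Fintype ι] {n : ℕ} (x : Fin 3 → ι → ι → CTerm n) :
    MTerm → ι → ι → CTerm n
  | var i => x i
  | sub s t => fun a b => .add (s.compile x a b) (.smul (-1) (t.compile x a b))
  | mul s t => fun a b => (Finset.univ : Finset ι).toList.foldr
      (fun c r => .add (.mul (s.compile x a c) (t.compile x c b)) r) .zero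
  | adj t => fun a b => .adj (t.compile x b a)

theorem eval_compile {ι : Type*} [Fintype ι] {A : Type*} [NonUnitalCStarAlgebra A] {n : ℕ}
    (x : Fin 3 → ι → ι → CTerm n) (v : Fin n → A) (t : MTerm) (a b : ι) :
    (t.compile x a b).eval A v = t.eval (fun i => Matrix.of fun a b => (x i a b).eval A v) a b := by
  induction t generalizing a b with
  | var i => rfl
  | sub s t hs ht => simp [compile, eval, CTerm.eval, hs, ht, sub_eq_add_neg]
  | mul s t hs ht =>
    have : ∀ l : List ι, (l.foldr (fun c r => CTerm.add (.mul (s.compile x a c) (t.compile x c b)) r)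
        CTerm.zero).eval A v =
        (l.map fun c => (s.compile x a c).eval A v * (t.compile x c b).eval A v).sum := by
      intro l
      induction l with
      | nil => rfl
      | cons c l ih => simp [CTerm.eval, ih]
    simp only [compile, eval, this, Matrix.mul_apply, hs, ht]
    exact Finset.sum_map_toList _ _
  | adj t ht => simp [compile, eval, CTerm.eval, ht, Matrix.conjTranspose_apply]

end MTerm

/-- The sum of the norms of the entries of a matrix. -/
def entrySum {ι : Type*} [Fintype ι] {A : Type*} [Norm A] (x : Matrix ι ι A) : ℝ :=
  ∑ p : ι × ι, ‖x p.1 p.2‖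

/-- The formula `u (N(t₀), N(t₁), …)`, where `N` is the sum of the norms of the entries, in the
entries of two matrices (outer variables) and a third one (inner variables). -/
noncomputable def matrixFormula (ι : Type*) [Fintype ι] {r : ℕ} (t : Fin r → MTerm)
    (u : C(Fin r → ℝ, ℝ)) :
    CFormula (Fintype.card (Fin 2 × (ι × ι)) + Fintype.card (ι × ι)) :=
  .conn u fun i => .conn (k := Fintype.card (ι × ι)) ⟨fun s => ∑ j, s j, by fun_prop⟩
    fun j => .norm ((t i).compile
      -- `CFormula.prepend` puts the inner variables first, so the indices of the outer ones are
      -- shifted by `card (ι × ι)`.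
      ![fun a b => .var ⟨Fintype.equivFin (Fin 2 × (ι × ι)) (0, a, b) + Fintype.card (ι × ι), by omega⟩,
        fun a b => .var ⟨Fintype.equivFin (Fin 2 × (ι × ι)) (1, a, b) + Fintype.card (ι × ι), by omega⟩,
        fun a b => .var ⟨Fintype.equivFin _ (a, b), by omega⟩]
      ((Fintype.equivFin (ι × ι)).symm j).1 ((Fintype.equivFin (ι × ι)).symm j).2)

theorem matrixFormula_eval {ι : Type*} [Fintype ι] {r : ℕ} (t : Fin r → MTerm)
    (u : C(Fin r → ℝ, ℝ)) {D : Type*} [NonUnitalCStarAlgebra D]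
    (v : Fin (Fintype.card (Fin 2 × (ι × ι))) → D) (w : Fin (Fintype.card (ι × ι)) → D) :
    (matrixFormula ι t u).eval D (CFormula.prepend v w) = u (fun i => entrySum ((t i).eval
        ![Matrix.of fun a b => v (Fintype.equivFin _ (0, a, b)),
          Matrix.of fun a b => v (Fintype.equivFin _ (1, a, b)),
          Matrix.of fun a b => w (Fintype.equivFin _ (a, b))])) := by
  simp only [matrixFormula, CFormula.eval, MTerm.eval_compile, entrySum]
  congr 1
  funext i
  refine (Fintype.sum_equiv (Fintype.equivFin (ι × ι)).symm _
    (fun p => ‖(t i).eval (fun j => Matrix.of fun a b => CTerm.eval D (CFormula.prepend v w)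
      (![fun a b => .var ⟨Fintype.equivFin (Fin 2 × (ι × ι)) (0, a, b) + Fintype.card (ι × ι),
          by omega⟩,
        fun a b => .var ⟨Fintype.equivFin (Fin 2 × (ι × ι)) (1, a, b) + Fintype.card (ι × ι),
          by omega⟩,
        fun a b => .var ⟨Fintype.equivFin _ (a, b), by omega⟩] j a b)) p.1 p.2‖)
    fun j => rfl).trans ?_
  congr! 4
  rename_i p _ j
  fin_cases j <;> ext a b <;> simp [CTerm.eval, CFormula.prepend, -Fintype.card_prod]

-- Transfer for matrices: quantifiers range over the unit ball of `A`, so a matrix is encoded by its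
-- entries. Its C⋆-norm is replaced by the sum of the norms of the entries, which is a formula.
open scoped Matrix.Norms.L2Operator in
theorem IsPseudomatricial.exists_matrix {A : Type*} [NonUnitalCStarAlgebra A]
    (hA : IsPseudomatricial A) {ι : Type*} [Fintype ι] {r : ℕ} (t : Fin r → MTerm)
    (u : C(Fin r → ℝ, ℝ))
    (h : ∀ N : ℕ, 1 ≤ N → ∀ x y : Matrix ι ι (Matrix (Fin N) (Fin N) ℂ),
      (∀ a b, ‖x a b‖ ≤ 1) → (∀ a b, ‖y a b‖ ≤ 1) →
      ∃ z : Matrix ι ι (Matrix (Fin N) (Fin N) ℂ), (∀ a b, ‖z a b‖ ≤ 1) ∧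
        u (fun i => entrySum ((t i).eval ![x, y, z])) ≤ 0)
    {x y : Matrix ι ι A} (hx : ∀ a b, ‖x a b‖ ≤ 1) (hy : ∀ a b, ‖y a b‖ ≤ 1) {ε : ℝ} (hε : 0 < ε) :
    ∃ z : Matrix ι ι A, (∀ a b, ‖z a b‖ ≤ 1) ∧
      u (fun i => entrySum ((t i).eval ![x, y, z])) < ε := by
  obtain ⟨w, hw, hlt⟩ := hA.exists_eval_lt (matrixFormula ι t u) (fun N hN v hv => by
      obtain ⟨z, hz, hle⟩ := h N hN (Matrix.of fun a b => v (Fintype.equivFin _ (0, a, b)))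
        (Matrix.of fun a b => v (Fintype.equivFin _ (1, a, b))) (fun _ _ => hv _) (fun _ _ => hv _)
      refine ⟨fun j => z ((Fintype.equivFin (ι × ι)).symm j).1 ((Fintype.equivFin (ι × ι)).symm j).2,
        fun _ => hz _ _, ?_⟩
      rw [matrixFormula_eval]
      simp only [Equiv.symm_apply_apply]
      exact hle)
    (v := fun j => ![x, y] ((Fintype.equivFin (Fin 2 × (ι × ι))).symm j).1
      ((Fintype.equivFin (Fin 2 × (ι × ι))).symm j).2.1
      ((Fintype.equivFin (Fin 2 × (ι × ι))).symm j).2.2) (fun j => by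
        rcases h : (Fintype.equivFin (Fin 2 × (ι × ι))).symm j with ⟨k, a, b⟩
        fin_cases k
        exacts [hx a b, hy a b]) hε
  rw [matrixFormula_eval] at hlt
  exact ⟨Matrix.of fun a b => w (Fintype.equivFin _ (a, b)), fun _ _ => hw _, by
    simp only [Equiv.symm_apply_apply] at hlt
    exact hlt⟩

end MatrixTerms

/-! ### Operator norms against entry sums -/

section CStarMatrixNorm

attribute [local instance] CStarAlgebra.spectralOrder CStarAlgebra.spectralOrderedRing

variable {ι : Type*} [Fintype ι]

theorem entrySum_nonneg {A : Type*} [NonUnitalCStarAlgebra A] (x : Matrix ι ι A) :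
    0 ≤ entrySum x :=
  Finset.sum_nonneg fun _ _ => norm_nonneg _

theorem CStarMatrix.norm_le_sum_entries {A : Type*} [NonUnitalCStarAlgebra A]
    (M : CStarMatrix ι ι A) : ‖M‖ ≤ ∑ j, ∑ i, ‖M i j‖ := by
  rw [CStarMatrix.norm_def]
  refine (CStarMatrix.toCLM M).opNorm_le_bound (by positivity) fun v => ?_
  simp only [CStarMatrix.toCLM_apply_eq_sum, Finset.sum_mul]
  apply (WithCStarModule.pi_norm_le_sum_norm _).trans
  gcongr with i _
  apply (norm_sum_le _ _).trans
  gcongr with j _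
  apply (norm_mul_le _ _).trans
  rw [mul_comm]
  gcongr
  exact WithCStarModule.norm_apply_le_norm v j

theorem norm_ofMatrix_le_entrySum {A : Type*} [NonUnitalCStarAlgebra A] (x : Matrix ι ι A) :
    ‖CStarMatrix.ofMatrix x‖ ≤ entrySum x := by
  refine (CStarMatrix.norm_le_sum_entries _).trans_eq ?_
  rw [entrySum, Fintype.sum_prod_type, Finset.sum_comm]
  rfl

theorem entrySum_le_card_mul {A : Type*} [NonUnitalCStarAlgebra A] {x : Matrix ι ι A} {c : ℝ}
    (h : ∀ i j, ‖x i j‖ ≤ c) : entrySum x ≤ Fintype.card (ι × ι) * c := by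
  refine (Finset.sum_le_card_nsmul _ _ c fun p _ => h _ _).trans ?_
  rw [nsmul_eq_mul]; rfl

open scoped Matrix.Norms.L2Operator

variable {κ : Type*} [Fintype κ] [DecidableEq κ] [DecidableEq ι]

/-- Cutting a complex matrix into blocks is a star homomorphism. -/
noncomputable def blockHom (ι κ : Type*) [Fintype ι] [Fintype κ] [DecidableEq κ] [DecidableEq ι] :
    Matrix (ι × κ) (ι × κ) ℂ →⋆ₙₐ[ℂ] CStarMatrix ι ι (Matrix κ κ ℂ) where
  toFun z := CStarMatrix.ofMatrix ((Matrix.comp ι ι κ κ ℂ).symm z)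
  map_smul' _ _ := rfl
  map_zero' := rfl
  map_add' _ _ := rfl
  map_mul' x y := (Matrix.compRingEquiv ι κ ℂ).symm.map_mul x y
  map_star' _ := rfl

theorem norm_block_le (z : Matrix (ι × κ) (ι × κ) ℂ) (i j : ι) :
    ‖(Matrix.comp ι ι κ κ ℂ).symm z i j‖ ≤ ‖z‖ :=
  (CStarMatrix.norm_entry_le_norm (M := blockHom ι κ z)).trans
    (NonUnitalStarAlgHom.norm_apply_le (blockHom ι κ) z)

/-- An injective star homomorphism is isometric, so the operator norm on `M_{ι×κ}(ℂ)` is the C⋆-norm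
of `M_ι(M_κ(ℂ))`. No constant depending on `κ` enters, which the uniformity in `N` requires. -/
theorem norm_le_entrySum_block (z : Matrix (ι × κ) (ι × κ) ℂ) :
    ‖z‖ ≤ entrySum ((Matrix.comp ι ι κ κ ℂ).symm z) := by
  have hinj : Function.Injective (blockHom ι κ) := (Matrix.comp ι ι κ κ ℂ).symm.injective
  have h : ‖blockHom ι κ z‖ = ‖z‖ := NonUnitalStarAlgHom.norm_map (blockHom ι κ) hinj z
  exact h.symm.le.trans (norm_ofMatrix_le_entrySum ((Matrix.comp ι ι κ κ ℂ).symm z))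

end CStarMatrixNorm

/-! ### Unitary equivalence and comparison of complex matrices -/

section ComplexMatrices

open scoped Matrix.Norms.L2Operator

variable {n : Type*} [Fintype n] [DecidableEq n]

theorem Matrix.IsHermitian.exists_diagonalization {a : Matrix n n ℂ} (ha : a.IsHermitian) :
    ∃ U ∈ Matrix.unitaryGroup n ℂ,
      a = U * Matrix.diagonal (fun i => (ha.eigenvalues i : ℂ)) * star U := by
  refine ⟨ha.eigenvectorUnitary, ha.eigenvectorUnitary.2, ?_⟩
  conv_lhs => rw [ha.spectral_theorem, Unitary.conjStarAlgAut_apply]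
  rfl

/-- `x* x` and `x x*` have the same characteristic polynomial, hence the same ordered eigenvalues;
the unitary carries one eigenbasis to the other. -/
theorem Matrix.exists_unitary_conj (x : Matrix n n ℂ) :
    ∃ U ∈ Matrix.unitaryGroup n ℂ, U * (star x * x) = x * star x * U := by
  have h1 : (star x * x).IsHermitian := Matrix.isHermitian_conjTranspose_mul_self x
  have h2 : (x * star x).IsHermitian := Matrix.isHermitian_mul_conjTranspose_self x
  obtain ⟨U, hU, e1⟩ := h1.exists_diagonalization
  obtain ⟨V, hV, e2⟩ := h2.exists_diagonalization
  have he : h1.eigenvalues = h2.eigenvalues :=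
    (Matrix.IsHermitian.eigenvalues_eq_eigenvalues_iff h1 h2).2 (Matrix.charpoly_mul_comm _ _)
  refine ⟨V * star U, mul_mem hV (Unitary.star_mem hU), ?_⟩
  have hU' : star U * U = 1 := (Matrix.mem_unitaryGroup_iff').1 hU
  have hV' : star V * V = 1 := (Matrix.mem_unitaryGroup_iff').1 hV
  rw [e1, e2, he]
  simp only [← mul_assoc]
  rw [mul_assoc V (star U) U, hU', mul_one]
  rw [mul_assoc _ (star V) V, hV', mul_one]

theorem norm_mul_norm_le_of_forall {n : Type*} [Fintype n] {v w : n → ℂ} {c : ℝ} (hc : 0 ≤ c)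
    (h : ∀ i j, ‖v i‖ * ‖w j‖ ≤ c) : ‖v‖ * ‖w‖ ≤ c := by
  have h1 : ∀ i, ‖v i‖ * ‖w‖ ≤ c := fun i => by
    rw [← norm_smul]
    exact (pi_norm_le_iff_of_nonneg hc).2 fun j => by
      rw [Pi.smul_apply, norm_smul]; exact h i j
  rw [mul_comm, ← norm_norm w, ← norm_smul]
  exact (pi_norm_le_iff_of_nonneg hc).2 fun i => by
    rw [Pi.smul_apply, norm_smul, norm_norm, mul_comm]; exact h1 i

theorem norm_unitary_conj {V : Matrix n n ℂ} (hV : V ∈ Matrix.unitaryGroup n ℂ) (z : Matrix n n ℂ) :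
    ‖V * z * star V‖ = ‖z‖ := by
  rw [CStarRing.norm_mul_mem_unitary _ (Unitary.star_mem hV), CStarRing.norm_mem_unitary_mul _ hV]

-- A quantitative form of "of two projections, the one of smaller rank lies below the other after
-- conjugation". A product of norms expresses the disjunction. Since quantifiers cannot be
-- restricted to projections, the defects `a - a²` and `b - b²` bound the product; they vanish
-- exactly when `a` and `b` are projections.
open scoped ComplexOrder in
theorem Matrix.PosSemidef.exists_unitary_comparison {a b : Matrix n n ℂ} (ha : a.PosSemidef)
    (hb : b.PosSemidef) {K : ℝ} (hK : 0 ≤ K) (haK : ‖a‖ ≤ K) (hbK : ‖b‖ ≤ K) :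
    ∃ U ∈ Matrix.unitaryGroup n ℂ,
      ‖U * a * star U - U * a * star U * b‖ * ‖b - b * (U * a * star U)‖ ≤
        K * (K + 1) * (‖a - a * a‖ + ‖b - b * b‖) := by
  obtain ⟨W, hW, e1⟩ := ha.isHermitian.exists_diagonalization
  obtain ⟨V, hV, e2⟩ := hb.isHermitian.exists_diagonalization
  have hW' : star W * W = 1 := (Matrix.mem_unitaryGroup_iff').1 hW
  have hV' : star V * V = 1 := (Matrix.mem_unitaryGroup_iff').1 hV
  set α := ha.isHermitian.eigenvalues with hα
  set β := hb.isHermitian.eigenvalues with hβ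
  -- Both eigenvalue lists decrease along the same enumeration of the index type, so `α` and `β` are
  -- similarly ordered.
  have htot : ∀ i j, (α i ≤ α j ∧ β i ≤ β j) ∨ (α j ≤ α i ∧ β j ≤ β i) := by
    intro i j
    rcases le_total ((Fintype.equivOfCardEq (Fintype.card_fin _)).symm i)
      ((Fintype.equivOfCardEq (Fintype.card_fin _)).symm j) with h | h
    · exact Or.inr ⟨ha.isHermitian.eigenvalues₀_antitone h, hb.isHermitian.eigenvalues₀_antitone h⟩
    · exact Or.inl ⟨ha.isHermitian.eigenvalues₀_antitone h, hb.isHermitian.eigenvalues₀_antitone h⟩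
  have hα0 : ∀ i, 0 ≤ α i := ha.eigenvalues_nonneg
  have hβ0 : ∀ i, 0 ≤ β i := hb.eigenvalues_nonneg
  set Da : Matrix n n ℂ := Matrix.diagonal fun i => (α i : ℂ) with hDa
  set Db : Matrix n n ℂ := Matrix.diagonal fun i => (β i : ℂ) with hDb
  have conj_mul : ∀ (Z : Matrix n n ℂ), star Z * Z = 1 → ∀ x y : Matrix n n ℂ,
      (Z * x * star Z) * (Z * y * star Z) = Z * (x * y) * star Z := by
    intro Z hZ x y
    calc (Z * x * star Z) * (Z * y * star Z) = Z * x * (star Z * Z) * y * star Z := by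
          simp only [mul_assoc]
      _ = Z * (x * y) * star Z := by rw [hZ, mul_one]; simp only [mul_assoc]
  have conj_sub : ∀ (Z x y : Matrix n n ℂ),
      (Z * x * star Z) - (Z * y * star Z) = Z * (x - y) * star Z := by
    intro Z x y; rw [mul_sub, sub_mul]
  have ea : V * star W * a * star (V * star W) = V * Da * star V := by
    rw [e1, star_mul, star_star]
    calc V * star W * (W * Da * star W) * (W * star V)
        = V * (star W * W) * Da * (star W * W) * star V := by simp only [mul_assoc]
      _ = V * Da * star V := by rw [hW', mul_one, mul_one]
  have nW : ∀ z, ‖W * z * star W‖ = ‖z‖ := norm_unitary_conj hW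
  have nV : ∀ z, ‖V * z * star V‖ = ‖z‖ := norm_unitary_conj hV
  refine ⟨V * star W, mul_mem hV (Unitary.star_mem hW), ?_⟩
  have hna : ‖a - a * a‖ = ‖(fun i => ((α i - α i * α i : ℝ) : ℂ) : n → ℂ)‖ := by
    rw [e1, conj_mul W hW', conj_sub, nW, hDa, Matrix.diagonal_mul_diagonal, Matrix.diagonal_sub,
      Matrix.l2_opNorm_diagonal]
    push_cast; rfl
  have hnb : ‖b - b * b‖ = ‖(fun i => ((β i - β i * β i : ℝ) : ℂ) : n → ℂ)‖ := by
    rw [e2, conj_mul V hV', conj_sub, nV, hDb, Matrix.diagonal_mul_diagonal, Matrix.diagonal_sub,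
      Matrix.l2_opNorm_diagonal]
    push_cast; rfl
  have hαK : ∀ i, α i ≤ K := by
    intro i
    have h : ‖a‖ = ‖(fun i => (α i : ℂ) : n → ℂ)‖ := by
      rw [e1, nW, hDa, Matrix.l2_opNorm_diagonal]
    have h2 := norm_le_pi_norm (fun i => (α i : ℂ) : n → ℂ) i
    rw [Complex.norm_real, Real.norm_eq_abs] at h2
    exact (le_abs_self _).trans (h2.trans (h ▸ haK))
  have hβK : ∀ i, β i ≤ K := by
    intro i
    have h : ‖b‖ = ‖(fun i => (β i : ℂ) : n → ℂ)‖ := by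
      rw [e2, nV, hDb, Matrix.l2_opNorm_diagonal]
    have h2 := norm_le_pi_norm (fun i => (β i : ℂ) : n → ℂ) i
    rw [Complex.norm_real, Real.norm_eq_abs] at h2
    exact (le_abs_self _).trans (h2.trans (h ▸ hbK))
  have e3 : V * Da * star V - V * Da * star V * b =
      V * Matrix.diagonal (fun i => ((α i - α i * β i : ℝ) : ℂ)) * star V := by
    rw [e2, conj_mul V hV', conj_sub, hDa, hDb, Matrix.diagonal_mul_diagonal, Matrix.diagonal_sub]
    push_cast; rfl
  have e4 : b - b * (V * Da * star V) =
      V * Matrix.diagonal (fun i => ((β i - β i * α i : ℝ) : ℂ)) * star V := by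
    rw [e2, conj_mul V hV', conj_sub, hDa, hDb, Matrix.diagonal_mul_diagonal, Matrix.diagonal_sub]
    push_cast; rfl
  rw [ea, e3, e4, nV, nV, Matrix.l2_opNorm_diagonal, Matrix.l2_opNorm_diagonal]
  have bound : ∀ s t : ℝ, 0 ≤ s → s ≤ K → 0 ≤ t → t ≤ K → |1 - s| * |t| ≤ K * (K + 1) := by
    intro s t hs hsK ht htK
    have h1 : |1 - s| ≤ K + 1 := abs_le.2 ⟨by linarith, by linarith⟩
    rw [abs_of_nonneg ht, mul_comm]
    exact mul_le_mul htK h1 (abs_nonneg _) hK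
  have hc : 0 ≤ K * (K + 1) := by positivity
  refine norm_mul_norm_le_of_forall (by positivity) fun i j => ?_
  simp only [Complex.norm_real, Real.norm_eq_abs]
  have hi := norm_le_pi_norm (fun i => ((β i - β i * β i : ℝ) : ℂ) : n → ℂ) i
  have hj := norm_le_pi_norm (fun i => ((α i - α i * α i : ℝ) : ℂ) : n → ℂ) j
  rw [← hnb, Complex.norm_real, Real.norm_eq_abs] at hi
  rw [← hna, Complex.norm_real, Real.norm_eq_abs] at hj
  have f1 : |α i - α i * β i| = |α i| * |1 - β i| := by rw [← abs_mul]; congr 1; ring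
  have f2 : |β j - β j * α j| = |β j| * |1 - α j| := by rw [← abs_mul]; congr 1; ring
  have f3 : |β i - β i * β i| = |β i| * |1 - β i| := by rw [← abs_mul]; congr 1; ring
  have f4 : |α j - α j * α j| = |α j| * |1 - α j| := by rw [← abs_mul]; congr 1; ring
  rw [f1, f2]
  rw [f3] at hi
  rw [f4] at hj
  -- The quantity is `α i |1 - β i| · β j |1 - α j|`. If `α i ≤ α j`, replacing `α i` by `α j`
  -- produces the defect `α j |1 - α j|`; if `β j ≤ β i`, replacing `β j` produces the defect `β i
  -- |1 - β i|`.
  rcases htot i j with ⟨h1, -⟩ | ⟨-, h1⟩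
  · have : |α i| ≤ |α j| := by rwa [abs_of_nonneg (hα0 _), abs_of_nonneg (hα0 _)]
    calc |α i| * |1 - β i| * (|β j| * |1 - α j|) ≤ |α j| * |1 - β i| * (|β j| * |1 - α j|) := by
          gcongr
      _ = (|1 - β i| * |β j|) * (|α j| * |1 - α j|) := by ring
      _ ≤ K * (K + 1) * ‖a - a * a‖ :=
          mul_le_mul (bound _ _ (hβ0 _) (hβK _) (hβ0 _) (hβK _)) hj (by positivity) hc
      _ ≤ _ := mul_le_mul_of_nonneg_left (le_add_of_nonneg_right (norm_nonneg _)) hc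
  · have : |β j| ≤ |β i| := by rwa [abs_of_nonneg (hβ0 _), abs_of_nonneg (hβ0 _)]
    calc |α i| * |1 - β i| * (|β j| * |1 - α j|) ≤ |α i| * |1 - β i| * (|β i| * |1 - α j|) := by
          gcongr
      _ = (|1 - α j| * |α i|) * (|β i| * |1 - β i|) := by ring
      _ ≤ K * (K + 1) * ‖b - b * b‖ :=
          mul_le_mul (bound _ _ (hα0 _) (hαK _) (hα0 _) (hαK _)) hi (by positivity) hc
      _ ≤ _ := mul_le_mul_of_nonneg_left (le_add_of_nonneg_left (norm_nonneg _)) hc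

end ComplexMatrices

/-! ### Comparison and finiteness in `M_ι(M_N(ℂ))` -/

section BlockMatrices

open scoped Matrix.Norms.L2Operator

variable {ι κ : Type*} [Fintype ι] [Fintype κ] [DecidableEq κ] [DecidableEq ι]

/-- A matrix variable times its adjoint. -/
def MTerm.gram (i : Fin 3) : MTerm := .mul (.var i) (.adj (.var i))

/-- `u a u*`, for the third variable `u`. -/
def MTerm.conj (a : MTerm) : MTerm := .mul (.mul (.var 2) a) (.adj (.var 2))

/-- The terms that express that the third variable conjugates the gram matrix of the first variable
to a matrix comparable with the gram matrix of the second one. -/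
def comparisonTerms : Fin 5 → MTerm :=
  ![.sub (.mul (.mul (.adj (.var 2)) (.var 2)) (MTerm.gram 0)) (MTerm.gram 0),
    .sub (MTerm.gram 0).conj (.mul (MTerm.gram 0).conj (MTerm.gram 1)),
    .sub (MTerm.gram 1) (.mul (MTerm.gram 1) (MTerm.gram 0).conj),
    .sub (MTerm.gram 0) (.mul (MTerm.gram 0) (MTerm.gram 0)),
    .sub (MTerm.gram 1) (.mul (MTerm.gram 1) (MTerm.gram 1))]

/-- The terms that express that the third variable is a unitary, on the range and support of the
second variable, which conjugates `x* x` to `x x*`. -/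
def finitenessTerms : Fin 3 → MTerm :=
  ![.sub (.mul (.mul (.adj (.var 2)) (.var 2)) (.var 1)) (.var 1),
    .sub (.mul (.var 1) (.mul (.var 2) (.adj (.var 2)))) (.var 1),
    .sub (.mul (.var 2) (.mul (.adj (.var 0)) (.var 0))) (.mul (MTerm.gram 0) (.var 2))]

theorem norm_le_one_of_mem_unitary {n : Type*} [Fintype n] [DecidableEq n] {U : Matrix n n ℂ}
    (hU : U ∈ Matrix.unitaryGroup n ℂ) : ‖U‖ ≤ 1 := by
  have h : ‖star U * U‖ = ‖U‖ * ‖U‖ := CStarRing.norm_star_mul_self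
  rw [(Matrix.mem_unitaryGroup_iff').1 hU] at h
  have h1 : ‖(1 : Matrix n n ℂ)‖ ≤ 1 := (IsStarProjection.one _).norm_le_one'
  nlinarith [norm_nonneg U]

-- Gram matrices `x x*` serve to quantify over positive matrices only; for a projection `p` one has
-- `p p* = p`. The constant `C` is chosen before `κ`, so one formula serves all `M_N(ℂ)` at once.
open scoped ComplexOrder in
theorem exists_comparisonTerms_le (ι : Type*) [Fintype ι] [DecidableEq ι] :
    ∃ C : ℝ, 0 ≤ C ∧ ∀ (κ : Type) [Fintype κ] [DecidableEq κ],
      ∀ x y : Matrix ι ι (Matrix κ κ ℂ), (∀ a b, ‖x a b‖ ≤ 1) → (∀ a b, ‖y a b‖ ≤ 1) →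
      ∃ z : Matrix ι ι (Matrix κ κ ℂ), (∀ a b, ‖z a b‖ ≤ 1) ∧
        (comparisonTerms 0).eval ![x, y, z] = 0 ∧
        entrySum ((comparisonTerms 1).eval ![x, y, z]) *
          entrySum ((comparisonTerms 2).eval ![x, y, z]) ≤
        C * (entrySum ((comparisonTerms 3).eval ![x, y, z]) +
          entrySum ((comparisonTerms 4).eval ![x, y, z])) := by
  set c : ℝ := ((Fintype.card (ι × ι) : ℕ) : ℝ) with hc
  have hc0 : 0 ≤ c := Nat.cast_nonneg _
  -- The first `c * c` comes from bounding two entry sums by norms; the rest is `K (K + 1)` with `K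
  -- = c * c`, the bound for the norms of the Gram matrices.
  refine ⟨c * c * (c * c * (c * c + 1)), by positivity, fun κ _ _ x y hx hy => ?_⟩
  let Ψ := (Matrix.compRingEquiv ι κ ℂ).symm
  obtain ⟨x, rfl⟩ := Ψ.surjective x
  obtain ⟨y, rfl⟩ := Ψ.surjective y
  have hstar : ∀ w, (Ψ w)ᴴ = Ψ (star w) := fun _ => rfl
  have hxn : ‖x‖ ≤ c := (norm_le_entrySum_block x).trans
    ((entrySum_le_card_mul hx).trans_eq (mul_one _))
  have hyn : ‖y‖ ≤ c := (norm_le_entrySum_block y).trans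
    ((entrySum_le_card_mul hy).trans_eq (mul_one _))
  have hxx : ‖x * star x‖ ≤ c * c := by
    rw [CStarRing.norm_self_mul_star]; exact mul_le_mul hxn hxn (norm_nonneg _) hc0
  have hyy : ‖y * star y‖ ≤ c * c := by
    rw [CStarRing.norm_self_mul_star]; exact mul_le_mul hyn hyn (norm_nonneg _) hc0
  have hx0 : (x * star x).PosSemidef := Matrix.posSemidef_self_mul_conjTranspose x
  have hy0 : (y * star y).PosSemidef := Matrix.posSemidef_self_mul_conjTranspose y
  obtain ⟨U, hU, hle⟩ := hx0.exists_unitary_comparison hy0 (by positivity) hxx hyy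
  refine ⟨Ψ U, fun a b => (norm_block_le U a b).trans (norm_le_one_of_mem_unitary hU), ?_, ?_⟩
  · have h1 : star U * U = 1 := (Matrix.mem_unitaryGroup_iff').1 hU
    simp [comparisonTerms, MTerm.gram, MTerm.eval, hstar, ← map_mul, h1]
  · have key : ∀ t : MTerm, ∀ w, t.eval ![Ψ x, Ψ y, Ψ U] = Ψ w →
        entrySum (t.eval ![Ψ x, Ψ y, Ψ U]) ≤ c * ‖w‖ ∧
          ‖w‖ ≤ entrySum (t.eval ![Ψ x, Ψ y, Ψ U]) := fun t w h => by
      rw [h]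
      exact ⟨entrySum_le_card_mul (norm_block_le w), norm_le_entrySum_block w⟩
    have h1 := (key (comparisonTerms 1) (U * (x * star x) * star U -
      U * (x * star x) * star U * (y * star y)) (by
        simp [comparisonTerms, MTerm.gram, MTerm.conj, MTerm.eval, hstar])).1
    have h2 := (key (comparisonTerms 2) (y * star y -
      y * star y * (U * (x * star x) * star U)) (by
        simp [comparisonTerms, MTerm.gram, MTerm.conj, MTerm.eval, hstar])).1
    have h3 := (key (comparisonTerms 3) (x * star x - x * star x * (x * star x)) (by
        simp [comparisonTerms, MTerm.gram, MTerm.eval, hstar])).2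
    have h4 := (key (comparisonTerms 4) (y * star y - y * star y * (y * star y)) (by
        simp [comparisonTerms, MTerm.gram, MTerm.eval, hstar])).2
    have hs2 : 0 ≤ entrySum ((comparisonTerms 2).eval ![Ψ x, Ψ y, Ψ U]) := entrySum_nonneg _
    generalize entrySum ((comparisonTerms 1).eval ![Ψ x, Ψ y, Ψ U]) = s1 at *
    generalize entrySum ((comparisonTerms 2).eval ![Ψ x, Ψ y, Ψ U]) = s2 at *
    generalize entrySum ((comparisonTerms 3).eval ![Ψ x, Ψ y, Ψ U]) = s3 at *
    generalize entrySum ((comparisonTerms 4).eval ![Ψ x, Ψ y, Ψ U]) = s4 at *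
    refine (mul_le_mul h1 h2 hs2 (mul_nonneg hc0 (norm_nonneg _))).trans ?_
    rw [mul_mul_mul_comm, mul_assoc (c * c)]
    have h5 := hle.trans (mul_le_mul_of_nonneg_left (add_le_add h3 h4)
      (show 0 ≤ c * c * (c * c + 1) by positivity))
    exact mul_le_mul_of_nonneg_left h5 (mul_nonneg hc0 hc0)

/-- The language has no symbol for the unit, so unitarity of `z` is stated by its action on an
arbitrary `y`; over `A` one takes `y = 1`. -/
theorem exists_finitenessTerms_eq_zero (x y : Matrix ι ι (Matrix κ κ ℂ)) :
    ∃ z : Matrix ι ι (Matrix κ κ ℂ), (∀ a b, ‖z a b‖ ≤ 1) ∧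
      ∀ i, (finitenessTerms i).eval ![x, y, z] = 0 := by
  let Ψ := (Matrix.compRingEquiv ι κ ℂ).symm
  obtain ⟨x, rfl⟩ := Ψ.surjective x
  obtain ⟨y, rfl⟩ := Ψ.surjective y
  have hstar : ∀ w, (Ψ w)ᴴ = Ψ (star w) := fun _ => rfl
  obtain ⟨U, hU, hUx⟩ := Matrix.exists_unitary_conj x
  refine ⟨Ψ U, fun a b => (norm_block_le U a b).trans (norm_le_one_of_mem_unitary hU), ?_⟩
  have h1 : star U * U = 1 := (Matrix.mem_unitaryGroup_iff').1 hU
  have h2 : U * star U = 1 := (Matrix.mem_unitaryGroup_iff).1 hU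
  intro i
  fin_cases i
  · simp [finitenessTerms, MTerm.eval, hstar, ← map_mul, h1]
  · simp [finitenessTerms, MTerm.eval, hstar, ← map_mul, h2]
  · simp [finitenessTerms, MTerm.eval, MTerm.gram, hstar, ← map_mul, hUx]

end BlockMatrices

/-! ### From approximate relations to exact equivalences -/

section AbstractComparison

variable {B : Type*} [CStarAlgebra B]

/-- The element `u` is nearly isometric on `p` and `u p u*` lies nearly below `q`, so `q u p` is
close to `u p` and can be normalised to a partial isometry from `p` into `q`. -/
theorem IsStarProjection.exists_mvN_le_of_conj {p q u : B} (hp : IsStarProjection p)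
    (hq : IsStarProjection q) {K δ : ℝ} (hK : 0 ≤ K) (hu : ‖u‖ ≤ K)
    (h1 : ‖star u * u * p - p‖ ≤ δ) (h2 : ‖u * p * star u - u * p * star u * q‖ ≤ δ)
    (hδ : K * (2 * K * δ + K * δ) + δ < 1) : ∃ w : B, star w * w = p ∧ q * w = w := by
  have hp1 : p * p = p := hp.isIdempotentElem
  have hp2 : star p = p := hp.isSelfAdjoint
  have hq1 : q * q = q := hq.isIdempotentElem
  have hq2 : star q = q := hq.isSelfAdjoint
  set d := star u * u * p - p with hd
  set e := u * p * star u - u * p * star u * q with he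
  have hp1' := hp.norm_le_one'
  have hq1' := hq.norm_le_one'
  refine hp.exists_mvN_le (v := q * u * p) (by rw [mul_assoc, hp1])
    (by rw [← mul_assoc, ← mul_assoc, hq1]) ?_
  have hes : star e = u * p * star u - q * (u * p * star u) := by
    have hsa : star (u * p * star u) = u * p * star u := by
      rw [star_mul, star_mul, star_star, hp2, mul_assoc]
    rw [he, star_sub, star_mul (u * p * star u) q, hsa, hq2]
  have hup : u * p = u * p * star u * (u * p) - u * p * d := by
    rw [hd]
    have : u * p * (star u * u * p - p) = u * p * star u * (u * p) - u * (p * p) := by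
      noncomm_ring
    rw [this, hp1]; abel
  have e1 : q * u * p - u * p = u * p * d - star e * (u * p) - q * (u * p) * d := by
    have h3 : q * (u * p) = q * (u * p * star u) * (u * p) - q * (u * p) * d := by
      conv_lhs => rw [hup]
      noncomm_ring
    have h4 : u * p * d - star e * (u * p) - q * (u * p) * d =
        (q * (u * p * star u) * (u * p) - q * (u * p) * d) -
          (u * p * star u * (u * p) - u * p * d) := by rw [hes]; noncomm_ring
    rw [h4, ← h3, ← hup, mul_assoc q u p]
  have e2 : star (q * u * p) * (q * u * p) - p = p * star u * (q * u * p - u * p) + p * d := by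
    have : star (q * u * p) * (q * u * p) = p * star u * (q * u * p) := by
      rw [star_mul, star_mul, hp2, hq2]
      calc p * (star u * q) * (q * u * p) = p * star u * (q * q) * u * p := by
            simp only [mul_assoc]
        _ = _ := by rw [hq1]; simp only [mul_assoc]
    rw [this, hd, mul_sub p, hp1]
    noncomm_ring
  have b0 : ‖u * p‖ ≤ K := (norm_mul_le _ _).trans (by nlinarith [norm_nonneg u])
  have hδ0 : 0 ≤ δ := (norm_nonneg _).trans h1
  have b1 : ‖q * u * p - u * p‖ ≤ K * δ + δ * K + 1 * K * δ := by
    rw [e1]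
    refine (norm_sub_le _ _).trans (add_le_add ((norm_sub_le _ _).trans (add_le_add ?_ ?_)) ?_)
    · exact (norm_mul_le _ _).trans (by gcongr)
    · refine (norm_mul_le _ _).trans ?_
      rw [norm_star]; gcongr
    · exact norm_mul₃_le.trans (by gcongr)
  rw [e2]
  refine lt_of_le_of_lt (norm_add_le _ _) (lt_of_le_of_lt (add_le_add (b := 1 * K *
    (K * δ + δ * K + 1 * K * δ)) (d := 1 * δ) ?_ ?_) (by linarith))
  · refine norm_mul₃_le.trans ?_
    rw [norm_star]; gcongr
  · exact (norm_mul_le _ _).trans (by gcongr)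

/-- Here `v = p u* q` satisfies `v* v = q (u p u*) q`, which is close to `q`. No approximate
unitarity of `u` is needed in this direction. -/
theorem IsStarProjection.exists_mvN_le_of_conj' {p q u : B} (hp : IsStarProjection p)
    (hq : IsStarProjection q) (h : ‖q - q * (u * p * star u)‖ < 1) :
    ∃ w : B, star w * w = q ∧ p * w = w := by
  have hp1 : p * p = p := hp.isIdempotentElem
  have hp2 : star p = p := hp.isSelfAdjoint
  have hq1 : q * q = q := hq.isIdempotentElem
  have hq2 : star q = q := hq.isSelfAdjoint
  refine hq.exists_mvN_le (v := p * star u * q) (by rw [mul_assoc, hq1])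
    (by rw [← mul_assoc, ← mul_assoc, hp1]) ?_
  have : star (p * star u * q) * (p * star u * q) - q = -((q - q * (u * p * star u)) * q) := by
    rw [star_mul, star_mul, star_star, hp2, hq2]
    calc q * (u * p) * (p * star u * q) - q = q * u * (p * p) * star u * q - q * q := by
          rw [hq1]; noncomm_ring
      _ = _ := by rw [hp1]; noncomm_ring
  rw [this, norm_neg]
  refine lt_of_le_of_lt (norm_mul_le _ _) ?_
  nlinarith [hq.norm_le_one', norm_nonneg (q - q * (u * p * star u))]

/-- An approximate unitary that nearly intertwines `p` and `q` also nearly intertwines their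
complements; its corner `(1 - q) u (1 - p)` is close to a partial isometry. -/
theorem IsStarProjection.compl_mvNEquiv {p q u : B} (hp : IsStarProjection p)
    (hq : IsStarProjection q) {K δ : ℝ} (hK : 0 ≤ K) (hu : ‖u‖ ≤ K) (h1 : ‖star u * u - 1‖ ≤ δ)
    (h2 : ‖u * star u - 1‖ ≤ δ) (h3 : ‖u * p - q * u‖ ≤ δ)
    (hδ : δ + 2 * K * δ + δ * δ < 1) : MvNEquiv (1 - p) (1 - q) := by
  have hp' : IsStarProjection (1 - p) := hp.one_sub
  have hq' : IsStarProjection (1 - q) := hq.one_sub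
  have hp1 : p * p = p := hp.isIdempotentElem
  have hq1 : q * q = q := hq.isIdempotentElem
  set g := u * p - q * u with hg
  have hδ0 : 0 ≤ δ := (norm_nonneg _).trans h1
  have aux : ∀ r : B, IsStarProjection r → ∀ x : B, ‖r * x * r‖ ≤ ‖x‖ := by
    intro r hr x
    have h1 := hr.norm_le_one'
    calc ‖r * x * r‖ ≤ ‖r‖ * ‖x‖ * ‖r‖ := norm_mul₃_le
      _ ≤ 1 * ‖x‖ * 1 := by gcongr
      _ = ‖x‖ := by ring
  have e1 : (1 - q) * u * (1 - p) = (u + g) * (1 - p) := by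
    have : (u + g) * (1 - p) = (1 - q) * u * (1 - p) + u * (p - p * p) := by
      rw [hg]; noncomm_ring
    rw [this, hp1, sub_self, mul_zero, add_zero]
  have e2 : (1 - q) * u * (1 - p) = (1 - q) * (u - g) := by
    have : (1 - q) * (u - g) = (1 - q) * u * (1 - p) + (q - q * q) * u := by
      rw [hg]; noncomm_ring
    rw [this, hq1, sub_self, zero_mul, add_zero]
  refine hp'.mvNEquiv_of_norm_lt hq' (v := (1 - q) * u * (1 - p))
    (by rw [mul_assoc, hp'.isIdempotentElem.eq])
    (by rw [← mul_assoc, ← mul_assoc, hq'.isIdempotentElem.eq]) ?_ ?_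
  · have : star ((1 - q) * u * (1 - p)) * ((1 - q) * u * (1 - p)) - (1 - p) =
        (1 - p) * ((star u * u - 1) + (star u * g + star g * u) + star g * g) * (1 - p) := by
      rw [e1, star_mul, hp'.isSelfAdjoint.star_eq, star_add]
      conv_lhs => rhs; rw [← hp'.isIdempotentElem.eq]
      noncomm_ring
    rw [this]
    refine lt_of_le_of_lt (aux _ hp' _) (lt_of_le_of_lt ?_ hδ)
    refine (norm_add₃_le).trans (add_le_add (add_le_add h1 ?_) ?_)
    · refine (norm_add_le _ _).trans ?_
      have a1 : ‖star u * g‖ ≤ K * δ := (norm_mul_le _ _).trans (by rw [norm_star]; gcongr)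
      have a2 : ‖star g * u‖ ≤ δ * K := (norm_mul_le _ _).trans (by rw [norm_star]; gcongr)
      linarith
    · exact (norm_mul_le _ _).trans (by rw [norm_star]; gcongr)
  · have : (1 - q) * u * (1 - p) * star ((1 - q) * u * (1 - p)) - (1 - q) =
        (1 - q) * ((u * star u - 1) - (u * star g + g * star u) + g * star g) * (1 - q) := by
      rw [e2, star_mul, hq'.isSelfAdjoint.star_eq, star_sub]
      conv_lhs => rhs; rw [← hq'.isIdempotentElem.eq]
      noncomm_ring
    rw [this]
    refine lt_of_le_of_lt (aux _ hq' _) (lt_of_le_of_lt ?_ hδ)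
    refine (norm_add_le _ _).trans (add_le_add ((norm_sub_le _ _).trans (add_le_add h2 ?_)) ?_)
    · refine (norm_add_le _ _).trans ?_
      have a1 : ‖u * star g‖ ≤ K * δ := (norm_mul_le _ _).trans (by rw [norm_star]; gcongr)
      have a2 : ‖g * star u‖ ≤ δ * K := (norm_mul_le _ _).trans (by rw [norm_star]; gcongr)
      linarith
    · exact (norm_mul_le _ _).trans (by rw [norm_star]; gcongr)

end AbstractComparison

/-! ### Comparison and finiteness over a pseudomatricial algebra -/

section PseudomatricialMatrices

open scoped Matrix.Norms.L2Operator

attribute [local instance] CStarAlgebra.spectralOrder CStarAlgebra.spectralOrderedRing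

variable {A : Type*} [CStarAlgebra A] {ι : Type*} [Fintype ι] [DecidableEq ι]

theorem IsPseudomatricial.matrix_comparison (hA : IsPseudomatricial A) {p q : CStarMatrix ι ι A}
    (hp : IsStarProjection p) (hq : IsStarProjection q) :
    (∃ w : CStarMatrix ι ι A, star w * w = p ∧ q * w = w) ∨
      (∃ w : CStarMatrix ι ι A, star w * w = q ∧ p * w = w) := by
  obtain ⟨C, hC, hM⟩ := exists_comparisonTerms_le ι
  have hp1 : p * p = p := hp.isIdempotentElem
  have hp2 : star p = p := hp.isSelfAdjoint
  have hq1 : q * q = q := hq.isIdempotentElem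
  have hq2 : star q = q := hq.isSelfAdjoint
  set K : ℝ := ((Fintype.card (ι × ι) : ℕ) : ℝ) with hK
  have hK0 : 0 ≤ K := Nat.cast_nonneg _
  obtain ⟨u, hu, hlt⟩ := hA.exists_matrix (ι := ι) comparisonTerms
    ⟨fun s => s 0 + max 0 (s 1 * s 2 - C * (s 3 + s 4)), by fun_prop⟩
    (fun N _ x y hx hy => by
      obtain ⟨z, hz, h0, hle⟩ := hM (Fin N) x y hx hy
      refine ⟨z, hz, ?_⟩
      simp only [ContinuousMap.coe_mk]
      rw [h0, max_eq_left (by linarith)]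
      simp [entrySum])
    (x := p) (y := q)
    (fun a b => CStarMatrix.norm_entry_le_norm.trans hp.norm_le_one')
    (fun a b => CStarMatrix.norm_entry_le_norm.trans hq.norm_le_one')
    (ε := 1 / (3 * K * K + 2)) (by positivity)
  -- With this `ε` the error in `exists_mvN_le_of_conj` is `(3K² + 1) / (3K² + 2) < 1`.
  set ε : ℝ := 1 / (3 * K * K + 2) with hε
  have hεK : K * (2 * K * ε + K * ε) + ε < 1 := by
    have : K * (2 * K * ε + K * ε) + ε = (3 * K * K + 1) / (3 * K * K + 2) := by
      rw [hε]; field_simp; ring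
    rw [this, div_lt_one (by positivity)]; linarith
  have hε1 : 0 < ε := by positivity
  let u' : CStarMatrix ι ι A := CStarMatrix.ofMatrix u
  have hu' : ‖u'‖ ≤ K := (norm_ofMatrix_le_entrySum u).trans
    ((entrySum_le_card_mul hu).trans_eq (mul_one _))
  have f : ∀ i, ‖CStarMatrix.ofMatrix ((comparisonTerms i).eval ![p, q, u])‖ ≤
      entrySum ((comparisonTerms i).eval ![p, q, u]) := fun i => norm_ofMatrix_le_entrySum _
  have f0 : ‖star u' * u' * (p * star p) - (p * star p)‖ ≤ _ := f 0
  have f1 : ‖u' * (p * star p) * star u' - u' * (p * star p) * star u' * (q * star q)‖ ≤ _ := f 1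
  have f2 : ‖q * star q - q * star q * (u' * (p * star p) * star u')‖ ≤ _ := f 2
  have f3 : (comparisonTerms 3).eval ![p, q, u] = 0 := by
    have : p * star p - p * star p * (p * star p) = 0 := by rw [hp2, hp1, hp1, sub_self]
    exact this
  have f4 : (comparisonTerms 4).eval ![p, q, u] = 0 := by
    have : q * star q - q * star q * (q * star q) = 0 := by rw [hq2, hq1, hq1, sub_self]
    exact this
  rw [hp2, hp1] at f0 f1 f2
  rw [hq2, hq1] at f1 f2
  simp only [ContinuousMap.coe_mk] at hlt
  rw [f3, f4] at hlt
  have hz : entrySum (0 : Matrix ι ι A) = 0 := by simp [entrySum]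
  rw [hz] at hlt
  have g0 := entrySum_nonneg ((comparisonTerms 0).eval ![p, q, u])
  have g1 := entrySum_nonneg ((comparisonTerms 1).eval ![p, q, u])
  have m1 := le_max_left (0 : ℝ) (entrySum ((comparisonTerms 1).eval ![p, q, u]) *
    entrySum ((comparisonTerms 2).eval ![p, q, u]) - C * (0 + 0))
  have m2 := le_max_right (0 : ℝ) (entrySum ((comparisonTerms 1).eval ![p, q, u]) *
    entrySum ((comparisonTerms 2).eval ![p, q, u]) - C * (0 + 0))
  -- The defects of `p` and `q` vanish, so the entry sums of terms `1` and `2` have product below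
  -- `ε`. Either the sum of term `2` is below `1`, which is enough for `q ≾ p`, or the sum of term
  -- `1` is below `ε`, which gives `p ≾ q`.
  rcases lt_or_ge (entrySum ((comparisonTerms 2).eval ![p, q, u])) 1 with h | h
  · exact Or.inr (hp.exists_mvN_le_of_conj' hq (f2.trans_lt h))
  · refine Or.inl (hp.exists_mvN_le_of_conj hq hK0 hu' (f0.trans (by linarith)) (f1.trans ?_) hεK)
    nlinarith

/-- Finiteness: the transferred relations, applied to a partial isometry `v` from `p` to `q` and `y
= 1`, give an approximate unitary `u` with `u p` close to `q u`. -/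
theorem IsPseudomatricial.matrix_compl_equiv (hA : IsPseudomatricial A) {p q : CStarMatrix ι ι A}
    (hp : IsStarProjection p) (hq : IsStarProjection q) (h : MvNEquiv p q) :
    MvNEquiv (1 - p) (1 - q) := by
  obtain ⟨v, hv, hv'⟩ := h
  set K : ℝ := ((Fintype.card (ι × ι) : ℕ) : ℝ) with hK
  have hK0 : 0 ≤ K := Nat.cast_nonneg _
  have hvn : ‖v‖ ≤ 1 := by
    have h : ‖star v * v‖ = ‖v‖ * ‖v‖ := CStarRing.norm_star_mul_self
    rw [hv] at h
    nlinarith [norm_nonneg v, hp.norm_le_one']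
  obtain ⟨u, hu, hlt⟩ := hA.exists_matrix (ι := ι) finitenessTerms
    ⟨fun s => s 0 + s 1 + s 2, by fun_prop⟩
    (fun N _ x y hx hy => by
      obtain ⟨z, hz, h0⟩ := exists_finitenessTerms_eq_zero x y
      refine ⟨z, hz, ?_⟩
      simp only [ContinuousMap.coe_mk, h0]
      simp [entrySum])
    (x := v) (y := (1 : CStarMatrix ι ι A))
    (fun a b => CStarMatrix.norm_entry_le_norm.trans hvn)
    (fun a b => CStarMatrix.norm_entry_le_norm.trans (IsStarProjection.one _).norm_le_one')
    (ε := 1 / (2 * K + 3)) (by positivity)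
  set ε : ℝ := 1 / (2 * K + 3) with hε
  have hε1 : 0 < ε := by positivity
  have hεK : ε + 2 * K * ε + ε * ε < 1 := by
    have h1 : ε * (2 * K + 3) = 1 := by rw [hε]; field_simp
    have h2 : ε ≤ 1 := by nlinarith [mul_nonneg hε1.le hK0]
    nlinarith
  let u' : CStarMatrix ι ι A := CStarMatrix.ofMatrix u
  have hu' : ‖u'‖ ≤ K := (norm_ofMatrix_le_entrySum u).trans
    ((entrySum_le_card_mul hu).trans_eq (mul_one _))
  have f : ∀ i, ‖CStarMatrix.ofMatrix ((finitenessTerms i).eval ![v, 1, u])‖ ≤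
      entrySum ((finitenessTerms i).eval ![v, 1, u]) := fun i => norm_ofMatrix_le_entrySum _
  have f0 : ‖star u' * u' * 1 - 1‖ ≤ _ := f 0
  have f1 : ‖1 * (u' * star u') - 1‖ ≤ _ := f 1
  have f2 : ‖u' * (star v * v) - v * star v * u'‖ ≤ _ := f 2
  rw [mul_one] at f0
  rw [one_mul] at f1
  rw [hv, hv'] at f2
  have g0 := entrySum_nonneg ((finitenessTerms 0).eval ![v, 1, u])
  have g1 := entrySum_nonneg ((finitenessTerms 1).eval ![v, 1, u])
  have g2 := entrySum_nonneg ((finitenessTerms 2).eval ![v, 1, u])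
  have hlt' : entrySum ((finitenessTerms 0).eval ![v, 1, u]) +
    entrySum ((finitenessTerms 1).eval ![v, 1, u]) +
    entrySum ((finitenessTerms 2).eval ![v, 1, u]) < ε := hlt
  exact hp.compl_mvNEquiv hq hK0 hu' (f0.trans (by linarith)) (f1.trans (by linarith))
    (f2.trans (by linarith)) hεK

end PseudomatricialMatrices

/-! ### Existence of a unit -/

section Unit

/-- The formula `‖e x - x‖ + ‖x e - x‖`, where `e` is the second variable. -/
noncomputable def unitFormula : CFormula 2 :=
  .conn (k := 2) ⟨fun s => s 0 + s 1, by fun_prop⟩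
    ![.norm (.add (.mul (.var 1) (.var 0)) (.smul (-1) (.var 0))),
      .norm (.add (.mul (.var 0) (.var 1)) (.smul (-1) (.var 0)))]

/-- The sentence `inf_e sup_x (‖e x - x‖ + ‖x e - x‖)`. -/
noncomputable def unitSentence : CSentence := .inf (.sup unitFormula)

theorem unitFormula_eval {A : Type*} [NonUnitalCStarAlgebra A] (v : Fin 2 → A) :
    unitFormula.eval A v = ‖v 1 * v 0 - v 0‖ + ‖v 0 * v 1 - v 0‖ := by
  simp [unitFormula, CFormula.eval, CTerm.eval, sub_eq_add_neg]

theorem norm_fin_zero_le {A : Type*} [NonUnitalCStarAlgebra A] (v : Fin 0 → A) (i : Fin 0) :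
    ‖v i‖ ≤ 1 := i.elim0

open scoped Matrix.Norms.L2Operator in
theorem IsPseudomatricial.exists_approx_unit {A : Type*} [NonUnitalCStarAlgebra A]
    (hA : IsPseudomatricial A) {ε : ℝ} (hε : 0 < ε) :
    ∃ e : A, ‖e‖ ≤ 1 ∧ ∀ x : A, ‖x‖ ≤ 1 → ‖e * x - x‖ + ‖x * e - x‖ < ε := by
  have h0 := hA unitSentence fun N hN => by
    refine le_antisymm ?_ ?_
    · refine (CFormula.eval_inf_le (norm_fin_zero_le _) (x := 1)
        (IsStarProjection.one _).norm_le_one').trans ?_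
      refine CFormula.eval_sup_le fun x hx => ?_
      rw [unitFormula_eval]
      simp
    · refine CFormula.eval_inf_nonneg fun e he => CFormula.eval_sup_nonneg fun x hx => ?_
      rw [unitFormula_eval]
      positivity
  obtain ⟨e, he, hlt⟩ := CFormula.exists_eval_lt (h0.trans_lt hε)
  refine ⟨e, he, fun x hx => lt_of_le_of_lt ?_ hlt⟩
  have h1 := CFormula.le_eval_sup (φ := unitFormula)
    (norm_cons_le_one (norm_fin_zero_le Fin.elim0) he) hx
  rw [unitFormula_eval] at h1
  exact h1

/-- The approximate units `e n` work uniformly on the unit ball, so `e n * e m` is close to both `e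
n` and `e m`. The sequence is therefore Cauchy and its limit is a unit. -/
theorem IsPseudomatricial.exists_unit {A : Type*} [NonUnitalCStarAlgebra A]
    (hA : IsPseudomatricial A) : ∃ e : A, ∀ x : A, e * x = x ∧ x * e = x := by
  have hpos : ∀ n : ℕ, (0 : ℝ) < 1 / ((n : ℝ) + 1) := fun n => by positivity
  choose e he h using fun n : ℕ => hA.exists_approx_unit (hpos n)
  have hlim := tendsto_one_div_add_atTop_nhds_zero_nat (𝕜 := ℝ)
  have hcauchy : CauchySeq e := by
    refine cauchySeq_of_le_tendsto_0 (fun n : ℕ => 1 / ((n : ℝ) + 1) + 1 / ((n : ℝ) + 1))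
      (fun n m N hn hm => ?_) (by simpa using hlim.add hlim)
    have h1 := h n (e m) (he m)
    have h2 := h m (e n) (he n)
    have h3 : e n - e m = (e n * e m - e m) - (e n * e m - e n) := by abel
    rw [dist_eq_norm, h3]
    have h4 := Nat.one_div_le_one_div (α := ℝ) hn
    have h5 := Nat.one_div_le_one_div (α := ℝ) hm
    refine (norm_sub_le _ _).trans (add_le_add ?_ ?_)
    · linarith [norm_nonneg (e m * e n - e m)]
    · linarith [norm_nonneg (e m * e n - e n)]
  obtain ⟨f, hf⟩ := cauchySeq_tendsto_of_complete hcauchy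
  have hball : ∀ x : A, ‖x‖ ≤ 1 → f * x = x ∧ x * f = x := by
    intro x hx
    constructor
    · refine tendsto_nhds_unique (hf.mul_const x) ?_
      rw [tendsto_iff_norm_sub_tendsto_zero]
      exact squeeze_zero (fun _ => norm_nonneg _)
        (fun n => by linarith [h n x hx, norm_nonneg (x * e n - x)]) hlim
    · refine tendsto_nhds_unique (hf.const_mul x) ?_
      rw [tendsto_iff_norm_sub_tendsto_zero]
      exact squeeze_zero (fun _ => norm_nonneg _)
        (fun n => by linarith [h n x hx, norm_nonneg (e n * x - x)]) hlim
  refine ⟨f, fun x => ?_⟩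
  have hc : (0 : ℝ) < ‖x‖ + 1 := by positivity
  have hc' : ((‖x‖ + 1 : ℝ) : ℂ) ≠ 0 := by exact_mod_cast hc.ne'
  obtain ⟨h1, h2⟩ := hball ((((‖x‖ + 1 : ℝ) : ℂ)⁻¹) • x) (by
    rw [norm_smul, norm_inv, Complex.norm_real, Real.norm_of_nonneg hc.le, inv_mul_le_iff₀ hc]
    linarith)
  rw [mul_smul_comm] at h1
  rw [smul_mul_assoc] at h2
  exact ⟨smul_right_injective A (inv_ne_zero hc') h1, smul_right_injective A (inv_ne_zero hc') h2⟩

/-- A C⋆-algebra with a unit is a unital C⋆-algebra. -/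
@[reducible]
noncomputable def CStarAlgebra.ofUnit {A : Type*} [inst : NonUnitalCStarAlgebra A] (e : A)
    (he : ∀ x : A, e * x = x ∧ x * e = x) : CStarAlgebra A :=
  letI r : Ring A := { inst.toNonUnitalNormedRing.toNonUnitalRing with
    one := e
    one_mul := fun x => (he x).1
    mul_one := fun x => (he x).2 }
  letI nr : NormedRing A := { inst.toNonUnitalNormedRing, r with }
  letI al : NormedAlgebra ℂ A :=
    { Algebra.ofModule (fun c x y => smul_mul_assoc c x y) (fun c x y => mul_smul_comm c x y) with
      norm_smul_le := fun c x => norm_smul_le c x }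
  { nr, al, inst with }

end Unit

/-! ### Existence of a minimal projection -/

section Minimal

/-- The formula `|‖m‖ - 1| + ‖m* - m‖ + ‖m m - m‖`. -/
noncomputable def rankOneFormula : CFormula 1 :=
  .conn (k := 3) ⟨fun s => |s 0 - 1| + s 1 + s 2, by fun_prop⟩
    ![.norm (.var 0), .norm (.add (.adj (.var 0)) (.smul (-1) (.var 0))),
      .norm (.add (.mul (.var 0) (.var 0)) (.smul (-1) (.var 0)))]

/-- The term `m x x* m`, where `m` is the second variable. -/
def compressionTerm : CTerm 2 :=
  .mul (.mul (.var 1) (.mul (.var 0) (.adj (.var 0)))) (.var 1)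

/-- The formula `max (min (‖y‖, ‖m - y‖) - 2 ‖y - y y‖, 0)`, where `y = m x x* m`. -/
noncomputable def minimalFormula : CFormula 2 :=
  .conn (k := 3) ⟨fun s => max (min (s 0) (s 1) - 2 * s 2) 0, by fun_prop⟩
    ![.norm compressionTerm, .norm (.add (.var 1) (.smul (-1) compressionTerm)),
      .norm (.add compressionTerm (.smul (-1) (.mul compressionTerm compressionTerm)))]

/-- A sentence that vanishes when there is a minimal projection. -/
noncomputable def minimalSentence : CSentence :=
  .inf (.conn (k := 2) ⟨fun s => s 0 + s 1, by fun_prop⟩ ![rankOneFormula, .sup minimalFormula])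

variable {A : Type*} [NonUnitalCStarAlgebra A]

theorem rankOneFormula_eval (v : Fin 1 → A) : rankOneFormula.eval A v =
    |‖v 0‖ - 1| + ‖star (v 0) - v 0‖ + ‖v 0 * v 0 - v 0‖ := by
  simp [rankOneFormula, CFormula.eval, CTerm.eval, sub_eq_add_neg]

theorem minimalFormula_eval (v : Fin 2 → A) : minimalFormula.eval A v =
    max (min ‖v 1 * (v 0 * star (v 0)) * v 1‖ ‖v 1 - v 1 * (v 0 * star (v 0)) * v 1‖ -
      2 * ‖v 1 * (v 0 * star (v 0)) * v 1 -
        v 1 * (v 0 * star (v 0)) * v 1 * (v 1 * (v 0 * star (v 0)) * v 1)‖) 0 := by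
  simp [minimalFormula, compressionTerm, CFormula.eval, CTerm.eval, sub_eq_add_neg]

theorem minimal_conn_eval (v : Fin 1 → A) :
    (CFormula.conn (k := 2) ⟨fun s => s 0 + s 1, by fun_prop⟩
      ![rankOneFormula, .sup minimalFormula]).eval A v =
    rankOneFormula.eval A v + (CFormula.sup minimalFormula).eval A v := by
  simp [CFormula.eval]

-- For a projection `m` of rank one, `m x x* m` is a multiple `t m` with `0 ≤ t ≤ 1`. The three
-- norms in the formula are then `t`, `1 - t` and `t (1 - t)`.
open scoped Matrix.Norms.L2Operator in
theorem minimalSentence_matrixValue {N : ℕ} (hN : 1 ≤ N) :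
    CSentence.matrixValue N minimalSentence = 0 := by
  obtain ⟨N, rfl⟩ : ∃ k, N = k + 1 := ⟨N - 1, by omega⟩
  refine le_antisymm ?_ ?_
  · set m : Matrix (Fin (N + 1)) (Fin (N + 1)) ℂ := Matrix.single 0 0 1 with hm
    have hm1 : m * m = m := by rw [hm, Matrix.single_mul_single_same, one_mul]
    have hm2 : star m = m := by
      rw [hm, Matrix.star_eq_conjTranspose, Matrix.conjTranspose_single, star_one]
    have hmp : IsStarProjection m := ⟨hm1, hm2⟩
    have hm0 : ‖m‖ = 1 := by
      refine le_antisymm hmp.norm_le_one' (not_lt.1 fun h => ?_)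
      have h1 := congrFun (congrFun (hmp.eq_zero_of_norm_lt_one h) 0) 0
      simp [hm] at h1
    have hcomp : ∀ z, m * z * m = z 0 0 • m := fun z => by
      rw [hm, Matrix.single_mul_mul_single]; simp
    refine (CFormula.eval_inf_le (norm_fin_zero_le _) (x := m) hm0.le).trans ?_
    rw [minimal_conn_eval, rankOneFormula_eval]
    simp only [Fin.cons_zero, hm0, hm2, hm1, sub_self, abs_zero, norm_zero, add_zero, zero_add]
    refine CFormula.eval_sup_le fun x hx => ?_
    rw [minimalFormula_eval]
    have e0 : (Fin.cons x (Fin.cons m Fin.elim0 : Fin 1 → Matrix (Fin (N + 1)) (Fin (N + 1)) ℂ) :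
      Fin 2 → _) 0 = x := rfl
    have e1 : (Fin.cons x (Fin.cons m Fin.elim0 : Fin 1 → Matrix (Fin (N + 1)) (Fin (N + 1)) ℂ) :
      Fin 2 → _) 1 = m := rfl
    rw [e0, e1, max_eq_right]
    obtain ⟨t, ht0, ht⟩ : ∃ t : ℝ, 0 ≤ t ∧ (x * star x) 0 0 = (t : ℂ) := by
      refine ⟨∑ j, Complex.normSq (x 0 j), Finset.sum_nonneg fun j _ => Complex.normSq_nonneg _, ?_⟩
      rw [Matrix.mul_apply, Complex.ofReal_sum]
      exact Finset.sum_congr rfl fun j _ => Complex.mul_conj _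
    have hy : m * (x * star x) * m = (t : ℂ) • m := by rw [hcomp, ht]
    have hny : ‖m * (x * star x) * m‖ = t := by
      rw [hy, norm_smul, hm0, mul_one, Complex.norm_real, Real.norm_of_nonneg ht0]
    have ht1 : t ≤ 1 := by
      rw [← hny]
      refine norm_mul₃_le.trans ?_
      rw [hm0, one_mul, mul_one, CStarRing.norm_self_mul_star]
      nlinarith [norm_nonneg x]
    have hny' : ‖m - m * (x * star x) * m‖ = 1 - t := by
      have : m - m * (x * star x) * m = ((1 - t : ℝ) : ℂ) • m := by
        rw [hy]; push_cast; rw [sub_smul, one_smul]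
      rw [this, norm_smul, hm0, mul_one, Complex.norm_real, Real.norm_of_nonneg (by linarith)]
    have hny'' : ‖m * (x * star x) * m - m * (x * star x) * m * (m * (x * star x) * m)‖ =
        t * (1 - t) := by
      have : m * (x * star x) * m - m * (x * star x) * m * (m * (x * star x) * m) =
          ((t * (1 - t) : ℝ) : ℂ) • m := by
        rw [hy, smul_mul_smul_comm, hm1, ← sub_smul]; push_cast; congr 1; ring
      rw [this, norm_smul, hm0, mul_one, Complex.norm_real,
        Real.norm_of_nonneg (mul_nonneg ht0 (by linarith))]
    rw [hny, hny', hny'']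
    -- `min (t, 1 - t) ≤ 2 t (1 - t)`, since the larger of `t` and `1 - t` is at least `1/2`.
    rcases le_total t (1 / 2) with h | h
    · rw [min_eq_left (by linarith)]; nlinarith
    · rw [min_eq_right (by linarith)]; nlinarith
  · refine CFormula.eval_inf_nonneg fun e he => ?_
    rw [minimal_conn_eval, rankOneFormula_eval]
    refine add_nonneg (by positivity) (CFormula.eval_sup_nonneg fun x hx => ?_)
    rw [minimalFormula_eval]
    exact le_max_right _ _

end Minimal

theorem IsStarProjection.sub_of_mul_eq {A : Type*} [NonUnitalCStarAlgebra A] {p q : A}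
    (hp : IsStarProjection p) (hq : IsStarProjection q) (h : p * q = q) :
    IsStarProjection (p - q) ∧ q * p = q := by
  have h' : q * p = q := by
    have := congrArg star h
    rwa [star_mul, hp.isSelfAdjoint.star_eq, hq.isSelfAdjoint.star_eq] at this
  refine ⟨⟨?_, ?_⟩, h'⟩
  · change (p - q) * (p - q) = p - q
    rw [mul_sub, sub_mul, sub_mul, h, h', hp.isIdempotentElem.eq, hq.isIdempotentElem.eq]
    abel
  · rw [isSelfAdjoint_iff, star_sub, hp.isSelfAdjoint.star_eq, hq.isSelfAdjoint.star_eq]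

/-- A near-optimal `m` is close to a projection `p`. For a projection `q ≤ p` the element `m q m` is
close to `q`, hence nearly idempotent, so the formula makes `q` or `p - q` have norm below `1`; a
projection of norm below `1` is `0`. -/
theorem IsPseudomatricial.exists_isMinimalProjection {A : Type*} [CStarAlgebra A]
    (hA : IsPseudomatricial A) : ∃ m : A, IsMinimalProjection m := by
  have h0 := hA minimalSentence fun N hN => minimalSentence_matrixValue hN
  obtain ⟨m, hm, hlt⟩ := CFormula.exists_eval_lt (h0.trans_lt (show (0 : ℝ) < 1 / 1000 by norm_num))
  rw [minimal_conn_eval, rankOneFormula_eval] at hlt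
  simp only [Fin.cons_zero] at hlt
  set v : Fin 1 → A := Fin.cons m Fin.elim0 with hv
  have hvm : ∀ i, ‖v i‖ ≤ 1 := norm_cons_le_one (norm_fin_zero_le _) hm
  have hmin : ∀ x : A, ‖x‖ ≤ 1 → min ‖m * (x * star x) * m‖ ‖m - m * (x * star x) * m‖ -
      2 * ‖m * (x * star x) * m - m * (x * star x) * m * (m * (x * star x) * m)‖ < 1 / 1000 := by
    intro x hx
    have h1 := CFormula.le_eval_sup (φ := minimalFormula) hvm hx
    rw [minimalFormula_eval] at h1
    have h2 := (le_max_left _ _).trans h1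
    refine lt_of_le_of_lt h2 ?_
    linarith [abs_nonneg (‖m‖ - 1), norm_nonneg (star m - m), norm_nonneg (m * m - m)]
  have hs : 0 ≤ (CFormula.sup minimalFormula).eval A v := CFormula.eval_sup_nonneg fun x hx => by
    rw [minimalFormula_eval]; exact le_max_right _ _
  have b1 : |‖m‖ - 1| < 1 / 1000 := by
    linarith [norm_nonneg (star m - m), norm_nonneg (m * m - m)]
  have b2 : ‖star m - m‖ < 1 / 1000 := by
    linarith [abs_nonneg (‖m‖ - 1), norm_nonneg (m * m - m)]
  have b3 : ‖m * m - m‖ < 1 / 1000 := by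
    linarith [abs_nonneg (‖m‖ - 1), norm_nonneg (star m - m)]
  set a : A := (1 / 2 : ℂ) • (m + star m) with ha
  have has : IsSelfAdjoint a := by
    rw [ha, isSelfAdjoint_iff, star_smul, star_add, star_star, add_comm]
    simp
  have ham : ‖a - m‖ ≤ 1 / 2000 := by
    have : a - m = (1 / 2 : ℂ) • (star m - m) := by
      rw [ha]; module
    rw [this, norm_smul]
    norm_num
    linarith
  have han : ‖a‖ ≤ 2 := by
    have : a = (a - m) + m := by abel
    rw [this]; exact (norm_add_le _ _).trans (by linarith)
  have haa : ‖a * a - a‖ ≤ 1 / 100 := by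
    have : a * a - a = (a * (a - m) + (a - m) * m) + (m * m - m) - (a - m) := by noncomm_ring
    rw [this]
    have c1 : ‖a * (a - m)‖ ≤ 2 * (1 / 2000) := (norm_mul_le _ _).trans (by gcongr)
    have c2 : ‖(a - m) * m‖ ≤ 1 / 2000 * 1 := (norm_mul_le _ _).trans (by gcongr)
    have c3 := norm_sub_le ((a * (a - m) + (a - m) * m) + (m * m - m)) (a - m)
    have c4 := norm_add₃_le (a := a * (a - m)) (b := (a - m) * m) (c := m * m - m)
    linarith
  obtain ⟨p, hp, hpa⟩ := exists_isStarProjection_near has haa (by norm_num)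
  have hp1 := hp.norm_le_one'
  have hpm : ‖m - p‖ ≤ 1 / 40 := by
    have : m - p = -(p - a) - (a - m) := by abel
    rw [this]
    refine (norm_sub_le _ _).trans ?_
    rw [norm_neg]; linarith
  refine ⟨p, hp, ?_, fun q hq hpq => ?_⟩
  · rintro rfl
    rw [sub_zero] at hpm
    have := (abs_lt.1 b1).1
    linarith
  · obtain ⟨hpq', hqp⟩ := hp.sub_of_mul_eq hq hpq
    have hq1 := hq.norm_le_one'
    -- The variable `x` is taken to be `q` itself, for which `x x* = q`.
    have h1 := hmin q hq1
    rw [hq.isSelfAdjoint.star_eq, hq.isIdempotentElem.eq] at h1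
    have hyq : ‖m * q * m - q‖ ≤ 1 / 20 := by
      have : m * q * m - q = (m - p) * q * m + q * (m - p) := by
        have : (m - p) * q * m + q * (m - p) = m * q * m - p * q * m + q * m - q * p := by
          noncomm_ring
        rw [this, hpq, hqp]; abel
      rw [this]
      have c1 : ‖(m - p) * q * m‖ ≤ 1 / 40 * 1 * 1 := norm_mul₃_le.trans (by gcongr)
      have c2 : ‖q * (m - p)‖ ≤ 1 * (1 / 40) := (norm_mul_le _ _).trans (by gcongr)
      linarith [norm_add_le ((m - p) * q * m) (q * (m - p))]
    set y := m * q * m with hy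
    have hy1 : ‖y‖ ≤ 1 * 1 * 1 := norm_mul₃_le.trans (by gcongr)
    have hyy : ‖y - y * y‖ ≤ 3 / 20 := by
      have : y - y * y = (y - q) - (y * (y - q) + (y - q) * q) := by
        have : (y - q) - (y * (y - q) + (y - q) * q) = y - q - y * y + q * q := by noncomm_ring
        rw [this, hq.isIdempotentElem.eq]; abel
      rw [this]
      have c1 : ‖y * (y - q)‖ ≤ (1 * 1 * 1) * (1 / 20) := (norm_mul_le _ _).trans (by gcongr)
      have c2 : ‖(y - q) * q‖ ≤ 1 / 20 * 1 := (norm_mul_le _ _).trans (by gcongr)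
      linarith [norm_sub_le (y - q) (y * (y - q) + (y - q) * q),
        norm_add_le (y * (y - q)) ((y - q) * q)]
    rcases min_choice ‖y‖ ‖m - y‖ with h | h
    · left
      refine hq.eq_zero_of_norm_lt_one ?_
      have : q = y - (y - q) := by abel
      rw [this]
      linarith [norm_sub_le y (y - q)]
    · right
      refine (sub_eq_zero.1 (hpq'.eq_zero_of_norm_lt_one ?_)).symm
      have : p - q = (m - y) - (m - p) + (y - q) := by abel
      rw [this]
      linarith [norm_add_le ((m - y) - (m - p)) (y - q), norm_sub_le (m - y) (m - p)]

/-! ### The monoid `V(A)` -/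

section ProjClassOf

variable {A : Type*} [NonUnitalCStarAlgebra A] {ι κ : Type*} [Fintype ι] [Fintype κ]

/-- The class in `V(A)` of a projection in a matrix algebra with an arbitrary finite index type. -/
noncomputable def projClassOf (p : Matrix ι ι A) (hp : IsStarProjection p) : ProjClass A :=
  ProjClass.mk ⟨Fintype.card ι, p.submatrix (Fintype.equivFin ι).symm (Fintype.equivFin ι).symm,
    hp.submatrix_equiv _⟩

theorem projClassOf_eq_mk {p : Matrix ι ι A} (hp : IsStarProjection p) (q : MatProj A) :
    projClassOf p hp = ProjClass.mk q ↔ MatMvNEquiv p q.mat := by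
  have h := hp.matMvN_submatrix (Fintype.equivFin ι).symm
  have hp' := hp.submatrix_equiv (Fintype.equivFin ι).symm
  constructor
  · intro h1
    have h2 : MatMvNEquiv _ q.mat := Quotient.exact h1
    exact h.trans hp q.isProj h2
  · intro h1
    exact Quotient.sound (h.symm.trans hp' q.isProj h1)

theorem projClassOf_eq_iff {p : Matrix ι ι A} {q : Matrix κ κ A} (hp : IsStarProjection p)
    (hq : IsStarProjection q) : projClassOf p hp = projClassOf q hq ↔ MatMvNEquiv p q := by
  have h := hq.matMvN_submatrix (Fintype.equivFin κ).symm
  have hq' := hq.submatrix_equiv (Fintype.equivFin κ).symm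
  refine (projClassOf_eq_mk hp _).trans ⟨fun h1 => ?_, fun h1 => ?_⟩
  · exact h1.trans hp hq h.symm
  · exact h1.trans hp hq' h

theorem ProjClass.exists_projClassOf (x : ProjClass A) :
    ∃ (n : ℕ) (p : Matrix (Fin n) (Fin n) A) (hp : IsStarProjection p), projClassOf p hp = x := by
  induction x using Quotient.inductionOn with
  | h q => exact ⟨q.size, q.mat, q.isProj, (projClassOf_eq_mk _ q).2 q.isProj.matMvN_refl⟩

theorem projClassOf_fromBlocks {p : Matrix ι ι A} {q : Matrix κ κ A} (hp : IsStarProjection p)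
    (hq : IsStarProjection q) :
    projClassOf (Matrix.fromBlocks p 0 0 q) (hp.fromBlocks hq) =
      projClassOf p hp + projClassOf q hq := by
  have hp' := hp.submatrix_equiv (Fintype.equivFin ι).symm
  have hq' := hq.submatrix_equiv (Fintype.equivFin κ).symm
  refine (projClassOf_eq_mk (hp.fromBlocks hq) (MatProj.dsum ⟨_, _, hp'⟩ ⟨_, _, hq'⟩)).2 ?_
  exact ((hp.matMvN_submatrix _).fromBlocks (hq.matMvN_submatrix _)).trans (hp.fromBlocks hq)
    (MatProj.isProj _) (MatProj.dsum_equiv_fromBlocks ⟨_, _, hp'⟩ ⟨_, _, hq'⟩).symm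

theorem Matrix.isStarProjection_zero : IsStarProjection (0 : Matrix ι ι A) :=
  ⟨mul_zero _, star_zero _⟩

theorem projClassOf_zero : projClassOf (0 : Matrix ι ι A) Matrix.isStarProjection_zero = 0 :=
  (projClassOf_eq_mk _ MatProj.zero).2 ⟨0, by rw [Matrix.conjTranspose_zero]; exact Matrix.zero_mul _,
    by rw [Matrix.conjTranspose_zero]; exact Matrix.mul_zero _⟩

theorem projClassOf_eq_zero {p : Matrix ι ι A} (hp : IsStarProjection p)
    (h : projClassOf p hp = 0) : p = 0 := by
  obtain ⟨v, hv, -⟩ := (projClassOf_eq_mk hp MatProj.zero).1 h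
  have : v = 0 := funext fun i => Fin.elim0 i
  rw [← hv, this, Matrix.mul_zero]

theorem projClassOf_congr {p q : Matrix ι ι A} (hp : IsStarProjection p) (hq : IsStarProjection q)
    (h : p = q) : projClassOf p hp = projClassOf q hq := by subst h; rfl

theorem projClassOf_fromBlocks_zero {p : Matrix ι ι A} (hp : IsStarProjection p) :
    projClassOf (Matrix.fromBlocks p 0 0 (0 : Matrix κ κ A))
      (hp.fromBlocks Matrix.isStarProjection_zero) = projClassOf p hp := by
  rw [projClassOf_fromBlocks hp Matrix.isStarProjection_zero, projClassOf_zero, add_zero]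

theorem projClassOf_zero_fromBlocks {q : Matrix κ κ A} (hq : IsStarProjection q) :
    projClassOf (Matrix.fromBlocks (0 : Matrix ι ι A) 0 0 q)
      (Matrix.isStarProjection_zero.fromBlocks hq) = projClassOf q hq := by
  rw [projClassOf_fromBlocks Matrix.isStarProjection_zero hq, projClassOf_zero, zero_add]

theorem projClassOf_add {p q : Matrix ι ι A} (hp : IsStarProjection p) (hq : IsStarProjection q)
    (hpq : IsStarProjection (p + q)) (h : p * q = 0) :
    projClassOf (p + q) hpq = projClassOf p hp + projClassOf q hq := by
  have hp1 : p * p = p := hp.isIdempotentElem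
  have hp2 : pᴴ = p := hp.isSelfAdjoint
  have hq1 : q * q = q := hq.isIdempotentElem
  have hq2 : qᴴ = q := hq.isSelfAdjoint
  have h' : q * p = 0 := by
    have := congrArg Matrix.conjTranspose h
    rwa [Matrix.conjTranspose_mul, hp2, hq2, Matrix.conjTranspose_zero] at this
  rw [← projClassOf_fromBlocks, eq_comm, projClassOf_eq_iff]
  -- For the row `v = (p q)`, orthogonality gives `v* v = diag(p, q)`, while `v v* = p + q`.
  refine ⟨Matrix.fromCols p q, ?_, ?_⟩
  · ext i j
    rcases i with i | i <;> rcases j with j | j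
    · change (pᴴ * p) i j = p i j
      rw [hp2, hp1]
    · change (pᴴ * q) i j = 0
      rw [hp2, h]; rfl
    · change (qᴴ * p) i j = 0
      rw [hq2, h']; rfl
    · change (qᴴ * q) i j = q i j
      rw [hq2, hq1]
  · ext i j
    rw [Matrix.mul_apply, Fintype.sum_sum_type]
    change (p * pᴴ) i j + (q * qᴴ) i j = p i j + q i j
    rw [hp2, hp1, hq2, hq1]

theorem ProjClass.eq_zero_of_add_eq_zero {x y : ProjClass A} (h : x + y = 0) : x = 0 := by
  obtain ⟨n, p, hp, rfl⟩ := x.exists_projClassOf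
  obtain ⟨m, q, hq, rfl⟩ := y.exists_projClassOf
  rw [← projClassOf_fromBlocks] at h
  have h1 := projClassOf_eq_zero _ h
  have h2 : p = 0 := by
    ext i j
    exact congrFun (congrFun h1 (Sum.inl i)) (Sum.inl j)
  rw [projClassOf_congr hp Matrix.isStarProjection_zero h2, projClassOf_zero]

/-- A `1 × 1` matrix. -/
def oneByOne {A : Type*} (a : A) : Matrix (Fin 1) (Fin 1) A := Matrix.of fun _ _ => a

theorem oneByOne_mul (a b : A) : oneByOne a * oneByOne b = oneByOne (a * b) := by
  ext i j; simp [oneByOne, Matrix.mul_apply]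

theorem oneByOne_conjTranspose (a : A) : (oneByOne a)ᴴ = oneByOne (star a) := by
  ext i j; simp [oneByOne]

theorem oneByOne_injective {A : Type*} : Function.Injective (oneByOne : A → _) := fun _ _ h =>
  congrFun (congrFun h 0) 0

theorem oneByOne_apply_zero {A : Type*} (v : Matrix (Fin 1) (Fin 1) A) : oneByOne (v 0 0) = v := by
  ext i j; rw [Subsingleton.elim i 0, Subsingleton.elim j 0]; rfl

theorem isStarProjection_oneByOne {p : A} :
    IsStarProjection (oneByOne p) ↔ IsStarProjection p := by
  constructor
  · intro h
    have h1 : oneByOne p * oneByOne p = oneByOne p := h.isIdempotentElem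
    have h2 : (oneByOne p)ᴴ = oneByOne p := h.isSelfAdjoint
    rw [oneByOne_mul] at h1
    rw [oneByOne_conjTranspose] at h2
    exact ⟨oneByOne_injective h1, oneByOne_injective h2⟩
  · intro h
    have h1 : p * p = p := h.isIdempotentElem
    have h2 : star p = p := h.isSelfAdjoint
    exact ⟨by rw [IsIdempotentElem, oneByOne_mul, h1],
      (oneByOne_conjTranspose p).trans (congrArg _ h2)⟩

theorem matMvNEquiv_oneByOne {p q : A} :
    MatMvNEquiv (oneByOne p) (oneByOne q) ↔ MvNEquiv p q := by
  constructor
  · rintro ⟨v, h1, h2⟩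
    rw [← oneByOne_apply_zero v, oneByOne_conjTranspose, oneByOne_mul] at h1 h2
    exact ⟨v 0 0, oneByOne_injective h1, oneByOne_injective h2⟩
  · rintro ⟨v, h1, h2⟩
    exact ⟨oneByOne v, by rw [oneByOne_conjTranspose, oneByOne_mul, h1],
      by rw [oneByOne_conjTranspose, oneByOne_mul, h2]⟩

theorem projClassOf_oneByOne {p : A} (hp : IsStarProjection p) :
    projClassOf (oneByOne p) (isStarProjection_oneByOne.2 hp) =
      ProjClass.mk (MatProj.ofProj p hp) :=
  (projClassOf_eq_mk _ (MatProj.ofProj p hp)).2 (isStarProjection_oneByOne.2 hp).matMvN_refl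

theorem mvNEquiv_iff_projClass {p q : A} (hp : IsStarProjection p) (hq : IsStarProjection q) :
    ProjClass.mk (MatProj.ofProj p hp) = ProjClass.mk (MatProj.ofProj q hq) ↔ MvNEquiv p q := by
  rw [← projClassOf_oneByOne, ← projClassOf_oneByOne, projClassOf_eq_iff, matMvNEquiv_oneByOne]

theorem MvNLE.exists_projClass_add {p q : A} (hp : IsStarProjection p) (hq : IsStarProjection q)
    (h : MvNLE p q) : ∃ z, ProjClass.mk (MatProj.ofProj p hp) + z =
      ProjClass.mk (MatProj.ofProj q hq) := by
  obtain ⟨r, hr, hqr, hpr⟩ := h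
  obtain ⟨hs, hrq⟩ := hq.sub_of_mul_eq hr hqr
  rw [(mvNEquiv_iff_projClass hp hr).2 hpr, ← projClassOf_oneByOne, ← projClassOf_oneByOne hq]
  refine ⟨projClassOf (oneByOne (q - r)) (isStarProjection_oneByOne.2 hs), ?_⟩
  have e : oneByOne r + oneByOne (q - r) = oneByOne q := by
    ext i j; simp [oneByOne]
  rw [← projClassOf_add (hpq := by rw [e]; exact isStarProjection_oneByOne.2 hq)]
  · exact projClassOf_congr _ _ e
  · rw [oneByOne_mul, mul_sub, hrq, hr.isIdempotentElem.eq, sub_self]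
    ext i j; rfl

theorem MvNLE.trans {p q r : A} (hp : IsStarProjection p) (hr : IsStarProjection r)
    (h : MvNLE p q) (h' : MvNLE q r) : MvNLE p r := by
  obtain ⟨s, hs, hqs, v, hv1, hv2⟩ := h
  obtain ⟨t, ht, hrt, w, hw1, hw2⟩ := h'
  have hrw : r * (w * star w) = w * star w := by rw [hw2, hrt]
  have hpp : p * p = p := hp.isIdempotentElem
  have hss : s * s = s := hs.isIdempotentElem
  have e : w * v * star (w * v) = w * s * star w := by
    rw [star_mul, ← hv2]; simp only [mul_assoc]
  have hws : star (w * s) * (w * s) = s := by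
    rw [star_mul, hs.isSelfAdjoint.star_eq, mul_assoc, ← mul_assoc (star w), hw1, hqs, hss]
  have e' : w * v * star (w * v) = (w * s) * star (w * s) := by
    rw [e, star_mul, hs.isSelfAdjoint.star_eq, mul_assoc, mul_assoc, ← mul_assoc s s, hss]
  have hr1 : r * w = w := by
    have ht1 : t * t = t := ht.isIdempotentElem
    have hr2 : star r = r := hr.isSelfAdjoint
    have : (r * w - w) * star (r * w - w) = 0 := by
      have e3 : (r * w - w) * star (r * w - w) =
          (r * (w * star w) - w * star w) * r - (r * (w * star w) - w * star w) := by
        rw [star_sub, star_mul, hr2]; noncomm_ring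
      rw [e3, hrw, sub_self, zero_mul, sub_zero]
    exact sub_eq_zero.1 ((CStarRing.mul_star_self_eq_zero_iff _).1 this)
  refine ⟨w * v * star (w * v), ⟨?_, IsSelfAdjoint.mul_star_self _⟩, ?_, w * v, ?_, rfl⟩
  · rw [IsIdempotentElem, e', mul_assoc, ← mul_assoc (star (w * s)), hws, star_mul,
      hs.isSelfAdjoint.star_eq, ← mul_assoc s s, hss]
  · rw [← mul_assoc, ← mul_assoc, hr1]
  · calc star (w * v) * (w * v) = star v * (star w * w) * v := by
          rw [star_mul]; simp only [mul_assoc]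
      _ = (star v * v) * (star v * v) := by
        have hqv : q * (v * star v) = v * star v := by rw [hv2, hqs]
        have hqv' : q * v = v := by
          have hq2 : star q = q := by rw [← hw1, star_mul, star_star]
          have : (q * v - v) * star (q * v - v) = 0 := by
            have e3 : (q * v - v) * star (q * v - v) =
                (q * (v * star v) - v * star v) * q - (q * (v * star v) - v * star v) := by
              rw [star_sub, star_mul, hq2]; noncomm_ring
            rw [e3, hqv, sub_self, zero_mul, sub_zero]
          exact sub_eq_zero.1 ((CStarRing.mul_star_self_eq_zero_iff _).1 this)
        rw [hw1, mul_assoc, hqv', hv1, hpp]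
      _ = p := by rw [hv1, hpp]

theorem MvNEquiv.mvNLE {p q : A} (hq : IsStarProjection q) (h : MvNEquiv p q) : MvNLE p q :=
  ⟨q, hq, hq.isIdempotentElem, h⟩

/-- The class of a minimal projection is an atom of `V(A)`. The partial isometry `v` from `p ⊕ r` to
`m` moves `p` to a subprojection `E` of `m`. If `E = 0` then `p = 0`; if `E = m`, the image of `r`
is `0`, and so `r = 0`. -/
theorem IsMinimalProjection.eq_zero_or_eq_zero {m : A} (hm : IsMinimalProjection m)
    {y z : ProjClass A} (h : y + z = ProjClass.mk (MatProj.ofProj m hm.1)) : y = 0 ∨ z = 0 := by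
  obtain ⟨a, p, hp, rfl⟩ := y.exists_projClassOf
  obtain ⟨b, r, hr, rfl⟩ := z.exists_projClassOf
  rw [← projClassOf_fromBlocks, ← projClassOf_oneByOne, projClassOf_eq_iff] at h
  obtain ⟨v, hv1, hv2⟩ := h
  set P : Matrix (Fin a ⊕ Fin b) (Fin a ⊕ Fin b) A := Matrix.fromBlocks p 0 0 0 with hP
  set R : Matrix (Fin a ⊕ Fin b) (Fin a ⊕ Fin b) A := Matrix.fromBlocks 0 0 0 r with hR
  have hp1 : p * p = p := hp.isIdempotentElem
  have hr1 : r * r = r := hr.isIdempotentElem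
  have hPP : P * P = P := by rw [hP, Matrix.fromBlocks_multiply]; simp [hp1]
  have hPs : Pᴴ = P := by
    rw [hP, Matrix.fromBlocks_conjTranspose, show pᴴ = p from hp.isSelfAdjoint]; simp
  have hPR : P * R = 0 := by rw [hP, hR, Matrix.fromBlocks_multiply]; simp
  have hRP : R * P = 0 := by rw [hP, hR, Matrix.fromBlocks_multiply]; simp
  have hRR : R * R = R := by rw [hR, Matrix.fromBlocks_multiply]; simp [hr1]
  have hsum : Matrix.fromBlocks p 0 0 r = P + R := by
    rw [hP, hR, Matrix.fromBlocks_add]; simp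
  rw [hsum] at hv1
  set M := oneByOne m with hM
  have hMM : M * M = M := (isStarProjection_oneByOne.2 hm.1).isIdempotentElem
  have eP : vᴴ * (v * P * vᴴ) * v = P := by
    calc vᴴ * (v * P * vᴴ) * v = (vᴴ * v) * P * (vᴴ * v) := by simp only [Matrix.mul_assoc]
      _ = P := by
        rw [hv1, Matrix.add_mul, hPP, hRP, add_zero, Matrix.mul_add, hPP, hPR, add_zero]
  have eR : vᴴ * (v * R * vᴴ) * v = R := by
    calc vᴴ * (v * R * vᴴ) * v = (vᴴ * v) * R * (vᴴ * v) := by simp only [Matrix.mul_assoc]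
      _ = R := by
        rw [hv1, Matrix.add_mul, hPR, hRR, zero_add, Matrix.mul_add, hRP, hRR, zero_add]
  have eM : v * P * vᴴ + v * R * vᴴ = M := by
    rw [← Matrix.add_mul, ← Matrix.mul_add, ← hv1, ← hMM, ← hv2]
    simp only [Matrix.mul_assoc]
  set E := v * P * vᴴ with hE
  have hEE : E * E = E := by
    calc E * E = v * P * (vᴴ * v) * P * vᴴ := by rw [hE]; simp only [Matrix.mul_assoc]
      _ = v * (P * (P + R) * P) * vᴴ := by rw [hv1]; simp only [Matrix.mul_assoc]
      _ = E := by rw [Matrix.mul_add, hPR, hPP, add_zero, hPP]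
  have hEs : Eᴴ = E := by
    rw [hE, Matrix.conjTranspose_mul, Matrix.conjTranspose_mul, Matrix.conjTranspose_conjTranspose,
      hPs, Matrix.mul_assoc]
  have hEp : IsStarProjection E := ⟨hEE, hEs⟩
  have hRE : v * R * vᴴ * E = 0 := by
    calc v * R * vᴴ * E = v * (R * (vᴴ * v) * P) * vᴴ := by rw [hE]; simp only [Matrix.mul_assoc]
      _ = 0 := by rw [hv1, Matrix.mul_add, hRP, hRR, zero_add, hRP]; simp
  have hME : M * E = E := by rw [← eM, Matrix.add_mul, hEE, hRE, add_zero]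
  have hE0 : oneByOne (E 0 0) = E := oneByOne_apply_zero E
  have hzero : ∀ {n : ℕ} (q : Matrix (Fin n) (Fin n) A) (hq : IsStarProjection q), q = 0 →
      projClassOf q hq = 0 := fun q hq h => by
    rw [projClassOf_congr hq Matrix.isStarProjection_zero h, projClassOf_zero]
  rcases hm.2.2 (E 0 0) (isStarProjection_oneByOne.1 (by rw [hE0]; exact hEp))
    (oneByOne_injective (by rw [← oneByOne_mul, hE0]; exact hME)) with h | h
  · left
    have hEz : E = 0 := by rw [← hE0, h]; ext i j; rfl
    rw [hEz] at eP
    refine hzero p hp ?_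
    ext i j
    have := congrFun (congrFun eP (Sum.inl i)) (Sum.inl j)
    simpa [hP] using this.symm
  · right
    have hEz : E = M := by rw [← hE0, h]
    rw [hEz] at eM
    have h0 : v * R * vᴴ = 0 := by simpa using eM
    rw [h0] at eR
    refine hzero r hr ?_
    ext i j
    have := congrFun (congrFun eR (Sum.inr i)) (Sum.inr j)
    simpa [hR] using this.symm

theorem IsMinimalProjection.mk_ne_zero {m : A} (hm : IsMinimalProjection m) :
    ProjClass.mk (MatProj.ofProj m hm.1) ≠ 0 := by
  rw [← projClassOf_oneByOne]
  intro h
  exact hm.2.1 (congrFun (congrFun (projClassOf_eq_zero _ h) 0) 0)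

end ProjClassOf

/-! ### Cancellation and total order in `V(A)` -/

section Cancellation

attribute [local instance] CStarAlgebra.spectralOrder CStarAlgebra.spectralOrderedRing

variable {A : Type*} [CStarAlgebra A] {ι : Type*} [Fintype ι] [DecidableEq ι]

theorem IsStarProjection.of_star_mul_self {B : Type*} [CStarAlgebra B] {p v : B}
    (hp : IsStarProjection p) (h : star v * v = p) : IsStarProjection (v * star v) := by
  refine ⟨?_, IsSelfAdjoint.mul_star_self _⟩
  have h1 := hp.mul_of_star_mul_self h
  rw [IsIdempotentElem, mul_assoc, ← mul_assoc (star v), h, ← mul_assoc, h1]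

/-- Let `w` carry `P + R` to `Q + R`. Both `Q` and `w P w*` lie below `Q + R`, with remainders `R`
and `w R w*` that are equivalent. So their complements in `1` are equivalent, and finiteness gives
`Q ∼ w P w* ∼ P`. -/
theorem IsPseudomatricial.matrix_cancel (hA : IsPseudomatricial A) {P Q R : CStarMatrix ι ι A}
    (hP : IsStarProjection P) (hQ : IsStarProjection Q) (hR : IsStarProjection R)
    (hPR : P * R = 0) (hQR : Q * R = 0) (h : MvNEquiv (P + R) (Q + R)) : MvNEquiv P Q := by
  obtain ⟨w, hw1, hw2⟩ := h
  have hP1 : P * P = P := hP.isIdempotentElem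
  have hQ1 : Q * Q = Q := hQ.isIdempotentElem
  have hR1 : R * R = R := hR.isIdempotentElem
  have hP2 : star P = P := hP.isSelfAdjoint
  have hQ2 : star Q = Q := hQ.isSelfAdjoint
  have hR2 : star R = R := hR.isSelfAdjoint
  have hRP : R * P = 0 := by
    have := congrArg star hPR
    rwa [star_mul, hP2, hR2, star_zero] at this
  have hRQ : R * Q = 0 := by
    have := congrArg star hQR
    rwa [star_mul, hQ2, hR2, star_zero] at this
  have hPRp : IsStarProjection (P + R) := by
    refine ⟨?_, ?_⟩
    · rw [IsIdempotentElem, add_mul, mul_add, mul_add, hP1, hPR, hRP, hR1, add_zero, zero_add]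
    · rw [isSelfAdjoint_iff, star_add, hP2, hR2]
  have hww : w * (P + R) = w := hPRp.mul_of_star_mul_self hw1
  set f := Q + R with hf
  have hfs : star f = f := by rw [hf, star_add, hQ2, hR2]
  have hfw : f * w = w := by rw [← hw2, mul_assoc, hw1, hww]
  have hwf : star w * f = star w := by
    have := congrArg star hfw
    rwa [star_mul, hfs] at this
  have hff : f * f = f := by
    rw [hf, add_mul, mul_add, mul_add, hQ1, hQR, hRQ, hR1, add_zero, zero_add]
  have hRf : R * f = R := by rw [hf, mul_add, hRQ, hR1, zero_add]
  have hfR : f * R = R := by rw [hf, add_mul, hQR, hR1, zero_add]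
  have hwP : star (w * P) * (w * P) = P := by
    calc star (w * P) * (w * P) = P * (star w * w) * P := by
          rw [star_mul, hP2]; simp only [mul_assoc]
      _ = P := by rw [hw1, mul_add, hPR, hP1, add_zero, hP1]
  have hwR : star (w * R) * (w * R) = R := by
    calc star (w * R) * (w * R) = R * (star w * w) * R := by
          rw [star_mul, hR2]; simp only [mul_assoc]
      _ = R := by rw [hw1, mul_add, hRP, hR1, zero_add, hR1]
  have he2 : IsStarProjection (w * P * star (w * P)) := hP.of_star_mul_self hwP
  have hsum : w * P * star (w * P) + w * R * star (w * R) = f := by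
    calc w * P * star (w * P) + w * R * star (w * R)
        = w * (P * P) * star w + w * (R * R) * star w := by
          rw [star_mul, star_mul, hP2, hR2]; simp only [mul_assoc]
      _ = w * (P + R) * star w := by rw [hP1, hR1, mul_add, add_mul]
      _ = f := by rw [hww, hw2]
  -- `1 - Q = (1 - f) + R` and `1 - w P w* = (1 - f) + w R w*`; the partial isometry is the identity
  -- on `1 - f` and `w` on `R`.
  have key : MvNEquiv (1 - Q) (1 - w * P * star (w * P)) := by
    have z1 : (1 - f) * (w * R) = 0 := by
      rw [sub_mul, one_mul, ← mul_assoc, hfw, sub_self]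
    have z2 : star (w * R) * (1 - f) = 0 := by
      rw [mul_sub, mul_one, star_mul, mul_assoc, hwf, sub_self]
    have z3 : (1 - f) * star (w * R) = 0 := by
      rw [star_mul, hR2, ← mul_assoc, sub_mul, one_mul, hfR, sub_self, zero_mul]
    have z4 : w * R * (1 - f) = 0 := by
      rw [mul_assoc, mul_sub, mul_one, hRf, sub_self, mul_zero]
    have z5 : (1 - f) * (1 - f) = 1 - f := by
      rw [mul_sub, mul_one, sub_mul, one_mul, hff, sub_self, sub_zero]
    have z6 : star (1 - f) = 1 - f := by rw [star_sub, star_one, hfs]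
    refine ⟨(1 - f) + w * R, ?_, ?_⟩
    · rw [star_add, z6, add_mul, mul_add, mul_add, z1, z2, z5, hwR, hf]; abel
    · rw [star_add, z6, add_mul, mul_add, mul_add, z3, z4, z5]
      have : w * R * star (w * R) = f - w * P * star (w * P) := by rw [← hsum]; abel
      rw [this]; abel
  have h1 := hA.matrix_compl_equiv hQ.one_sub he2.one_sub key
  rw [sub_sub_cancel, sub_sub_cancel] at h1
  have h2 : MvNEquiv P (w * P * star (w * P)) := ⟨w * P, hwP, rfl⟩
  have h1' : MatMvNEquiv (A := A) Q (w * P * star (w * P)) := h1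
  have h2' : MatMvNEquiv (A := A) P (w * P * star (w * P)) := h2
  exact MatMvNEquiv.trans (A := A) hP hQ h2' h1'.symm

/-- Representatives of the three classes are placed in separate diagonal blocks of one matrix
algebra, which makes the orthogonality needed for `matrix_cancel` automatic. -/
theorem IsPseudomatricial.projClass_cancel (hA : IsPseudomatricial A) {x y z : ProjClass A}
    (h : x + z = y + z) : x = y := by
  obtain ⟨a, p, hp, rfl⟩ := x.exists_projClassOf
  obtain ⟨b, q, hq, rfl⟩ := y.exists_projClassOf
  obtain ⟨c, r, hr, rfl⟩ := z.exists_projClassOf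
  have hz : ∀ {ι : Type} [Fintype ι], IsStarProjection (0 : Matrix ι ι A) :=
    Matrix.isStarProjection_zero
  have hP0 := hp.fromBlocks (hz (ι := Fin b))
  have hQ0 := (hz (ι := Fin a)).fromBlocks hq
  have hP := hP0.fromBlocks (hz (ι := Fin c))
  have hQ := hQ0.fromBlocks (hz (ι := Fin c))
  have hR := (hz (ι := Fin a ⊕ Fin b)).fromBlocks hr
  have hPRp := hP0.fromBlocks hr
  have hQRp := hQ0.fromBlocks hr
  have h1 : MatMvNEquiv (Matrix.fromBlocks (Matrix.fromBlocks p 0 0 (0 : Matrix (Fin b) (Fin b) A))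
      0 0 r) (Matrix.fromBlocks (Matrix.fromBlocks (0 : Matrix (Fin a) (Fin a) A) 0 0 q) 0 0 r) := by
    rw [← projClassOf_eq_iff hPRp hQRp, projClassOf_fromBlocks hP0 hr,
      projClassOf_fromBlocks hQ0 hr, projClassOf_fromBlocks_zero hp, projClassOf_zero_fromBlocks hq,
      h]
  have ePR : Matrix.fromBlocks (Matrix.fromBlocks p 0 0 (0 : Matrix (Fin b) (Fin b) A)) 0 0 r =
      Matrix.fromBlocks (Matrix.fromBlocks p 0 0 (0 : Matrix (Fin b) (Fin b) A)) 0 0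
        (0 : Matrix (Fin c) (Fin c) A) + Matrix.fromBlocks 0 0 0 r := by
    rw [Matrix.fromBlocks_add]; simp
  have eQR : Matrix.fromBlocks (Matrix.fromBlocks (0 : Matrix (Fin a) (Fin a) A) 0 0 q) 0 0 r =
      Matrix.fromBlocks (Matrix.fromBlocks (0 : Matrix (Fin a) (Fin a) A) 0 0 q) 0 0
        (0 : Matrix (Fin c) (Fin c) A) + Matrix.fromBlocks 0 0 0 r := by
    rw [Matrix.fromBlocks_add]; simp
  rw [ePR, eQR] at h1
  have h2 := hA.matrix_cancel (ι := (Fin a ⊕ Fin b) ⊕ Fin c)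
    (P := CStarMatrix.ofMatrix (Matrix.fromBlocks (Matrix.fromBlocks p 0 0 0) 0 0 0))
    (Q := CStarMatrix.ofMatrix (Matrix.fromBlocks (Matrix.fromBlocks 0 0 0 q) 0 0 0))
    (R := CStarMatrix.ofMatrix (Matrix.fromBlocks 0 0 0 r)) hP hQ hR
    (by
      have : Matrix.fromBlocks (Matrix.fromBlocks p 0 0 (0 : Matrix (Fin b) (Fin b) A)) 0 0
        (0 : Matrix (Fin c) (Fin c) A) * Matrix.fromBlocks 0 0 0 r = 0 := by
        rw [Matrix.fromBlocks_multiply]; simp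
      exact this)
    (by
      have : Matrix.fromBlocks (Matrix.fromBlocks (0 : Matrix (Fin a) (Fin a) A) 0 0 q) 0 0
        (0 : Matrix (Fin c) (Fin c) A) * Matrix.fromBlocks 0 0 0 r = 0 := by
        rw [Matrix.fromBlocks_multiply]; simp
      exact this) h1
  have h3 := (projClassOf_eq_iff hP hQ).2 h2
  rwa [projClassOf_fromBlocks_zero hP0, projClassOf_fromBlocks_zero hQ0,
    projClassOf_fromBlocks_zero hp, projClassOf_zero_fromBlocks hq] at h3

theorem exists_projClassOf_add_of_mvN_le {P Q w : CStarMatrix ι ι A} (hP : IsStarProjection P)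
    (hQ : IsStarProjection Q) (hw : star w * w = P) (hQw : Q * w = w) :
    ∃ z, projClassOf (A := A) P hP + z = projClassOf (A := A) Q hQ := by
  have hr := hP.of_star_mul_self hw
  obtain ⟨hs, hrQ⟩ := hQ.sub_of_mul_eq hr (by rw [← mul_assoc, hQw])
  refine ⟨projClassOf (A := A) (Q - w * star w) hs, ?_⟩
  have h1 : projClassOf (A := A) P hP = projClassOf (A := A) (w * star w) hr :=
    (projClassOf_eq_iff (A := A) hP hr).2 ⟨w, hw, rfl⟩
  have e : w * star w + (Q - w * star w) = Q := by abel
  have hm : w * star w * (Q - w * star w) = 0 := by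
    rw [mul_sub, hrQ, hr.isIdempotentElem.eq, sub_self]
  have h2 := projClassOf_add (A := A) hr hs (by
    have : IsStarProjection (w * star w + (Q - w * star w)) := by rw [e]; exact hQ
    exact this) hm
  rw [h1, ← h2]
  exact projClassOf_congr (A := A) _ _ e

theorem IsPseudomatricial.projClass_total (hA : IsPseudomatricial A) (x y : ProjClass A) :
    ∃ z, x + z = y ∨ y + z = x := by
  obtain ⟨a, p, hp, rfl⟩ := x.exists_projClassOf
  obtain ⟨b, q, hq, rfl⟩ := y.exists_projClassOf
  have hP := hp.fromBlocks (Matrix.isStarProjection_zero (ι := Fin b) (A := A))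
  have hQ := (Matrix.isStarProjection_zero (ι := Fin a) (A := A)).fromBlocks hq
  rw [← projClassOf_fromBlocks_zero (κ := Fin b) hp, ← projClassOf_zero_fromBlocks (ι := Fin a) hq]
  rcases hA.matrix_comparison (ι := Fin a ⊕ Fin b)
    (p := CStarMatrix.ofMatrix (Matrix.fromBlocks p 0 0 0))
    (q := CStarMatrix.ofMatrix (Matrix.fromBlocks 0 0 0 q)) hP hQ with ⟨w, h1, h2⟩ | ⟨w, h1, h2⟩
  · obtain ⟨z, hz⟩ := exists_projClassOf_add_of_mvN_le _ _ h1 h2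
    exact ⟨z, Or.inl hz⟩
  · obtain ⟨z, hz⟩ := exists_projClassOf_add_of_mvN_le _ _ h1 h2
    exact ⟨z, Or.inr hz⟩

theorem IsPseudomatricial.mvNLE_total (hA : IsPseudomatricial A) {p q : A}
    (hp : IsStarProjection p) (hq : IsStarProjection q) : MvNLE p q ∨ MvNLE q p := by
  have aux : ∀ {p q : A}, IsStarProjection p → ∀ w : Matrix (Fin 1) (Fin 1) A,
      wᴴ * w = oneByOne p → oneByOne q * w = w → MvNLE p q := by
    intro p q hp w h1 h2
    rw [← oneByOne_apply_zero w, oneByOne_conjTranspose, oneByOne_mul] at h1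
    rw [← oneByOne_apply_zero w, oneByOne_mul] at h2
    have h1' := oneByOne_injective h1
    have h2' := oneByOne_injective h2
    exact ⟨w 0 0 * star (w 0 0), hp.of_star_mul_self h1', by rw [← mul_assoc, h2'], w 0 0, h1', rfl⟩
  rcases hA.matrix_comparison (ι := Fin 1) (p := CStarMatrix.ofMatrix (oneByOne p))
    (q := CStarMatrix.ofMatrix (oneByOne q)) (isStarProjection_oneByOne.2 hp)
    (isStarProjection_oneByOne.2 hq) with ⟨w, h1, h2⟩ | ⟨w, h1, h2⟩
  · exact Or.inl (aux hp w h1 h2)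
  · exact Or.inr (aux hq w h1 h2)

end Cancellation

/-! ### Countability in the separable case -/

section Countability

attribute [local instance] CStarAlgebra.spectralOrder CStarAlgebra.spectralOrderedRing

/-- A countable dense set of projections meets every class, because projections at distance less
than `1` are equivalent. -/
theorem countable_range_projClassOf {A : Type*} [CStarAlgebra A] [TopologicalSpace.SeparableSpace A]
    (n : ℕ) : (Set.range fun p : {p : Matrix (Fin n) (Fin n) A // IsStarProjection p} =>
      projClassOf p.1 p.2).Countable := by
  have : SecondCountableTopology A := UniformSpace.secondCountable_of_separable A
  have : SecondCountableTopology (CStarMatrix (Fin n) (Fin n) A) :=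
    inferInstanceAs (SecondCountableTopology (Fin n → Fin n → A))
  let X := {p : CStarMatrix (Fin n) (Fin n) A // IsStarProjection p}
  have hX : SecondCountableTopology X := inferInstance
  obtain ⟨D, hD, hdense⟩ := TopologicalSpace.exists_countable_dense X
  let f : X → ProjClass A := fun p => projClassOf (A := A) p.1 p.2
  have : Set.range f ⊆ f '' D := by
    rintro _ ⟨p, rfl⟩
    obtain ⟨d, hd, hdist⟩ := hdense.exists_dist_lt p one_pos
    refine ⟨d, hd, ?_⟩
    rw [Subtype.dist_eq, dist_eq_norm] at hdist
    have h := p.2.mvNEquiv_of_norm_sub_lt d.2 hdist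
    exact ((projClassOf_eq_iff (A := A) p.2 d.2).2 h).symm
  exact (hD.image f).mono this

theorem countable_projClass (A : Type*) [CStarAlgebra A] [TopologicalSpace.SeparableSpace A] :
    Countable (ProjClass A) := by
  refine Set.countable_univ_iff.1 ((Set.countable_iUnion
    (countable_range_projClassOf (A := A))).mono fun x _ => ?_)
  obtain ⟨n, p, hp, rfl⟩ := x.exists_projClassOf
  exact Set.mem_iUnion.2 ⟨n, ⟨p, hp⟩, rfl⟩

end Countability

/-! ### The order of `K₀(A)` -/

namespace KZero

variable {A : Type*}

section NonUnital

variable [NonUnitalCStarAlgebra A]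

/-- The canonical map `V(A) → K₀(A)`. -/
noncomputable def ofClass : ProjClass A →+ KZero A :=
  Algebra.GrothendieckAddGroup.of (M := ProjClass A)

theorem exists_ofClass_sub (g : KZero A) : ∃ x y : ProjClass A, g = ofClass x - ofClass y := by
  induction g using AddLocalization.ind with
  | H z =>
    obtain ⟨x, y⟩ := z
    refine ⟨x, y, ?_⟩
    have h := Algebra.GrothendieckAddGroup.mk_sub_mk x (y : ProjClass A) 0 0
    rw [show AddLocalization.mk x (0 : (⊤ : AddSubmonoid (ProjClass A))) = ofClass x from
        AddLocalization.mk_zero_eq_addMonoidOf_mk x,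
      show AddLocalization.mk (y : ProjClass A) (0 : (⊤ : AddSubmonoid (ProjClass A))) =
        ofClass (y : ProjClass A) from AddLocalization.mk_zero_eq_addMonoidOf_mk _] at h
    refine Eq.trans ?_ h.symm
    congr 1
    · simp
    · exact Subtype.ext (by simp)

theorem le_iff {g h : KZero A} : g ≤ h ↔ ∃ x : ProjClass A, h - g = ofClass x := by
  constructor
  · rintro ⟨p, hp⟩
    exact ⟨ProjClass.mk p, hp⟩
  · rintro ⟨x, hx⟩
    induction x using Quotient.inductionOn with
    | h p => exact ⟨p, hx⟩

theorem countable_of_projClass [Countable (ProjClass A)] : Countable (KZero A) := by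
  have : Function.Surjective fun z : ProjClass A × ProjClass A => ofClass z.1 - ofClass z.2 :=
    fun g => by
      obtain ⟨x, y, h⟩ := exists_ofClass_sub g
      exact ⟨(x, y), h.symm⟩
  exact this.countable

theorem add_le_add_right' {g h : KZero A} (k : KZero A) (hle : g ≤ h) : g + k ≤ h + k := by
  rw [le_iff] at hle ⊢
  obtain ⟨x, hx⟩ := hle
  exact ⟨x, by rw [← hx]; abel⟩

end NonUnital

variable [CStarAlgebra A]

theorem ofClass_injective (hA : IsPseudomatricial A) :
    Function.Injective (ofClass : ProjClass A → KZero A) := by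
  have : IsCancelAdd (ProjClass A) :=
    { add_right_cancel := fun _ _ _ h => hA.projClass_cancel h
      add_left_cancel := fun x y z h => hA.projClass_cancel (z := x) (by
        rw [add_comm y x, add_comm z x]; exact h) }
  exact Algebra.GrothendieckAddGroup.of_injective

theorem le_antisymm' (hA : IsPseudomatricial A) {g h : KZero A} (h1 : g ≤ h) (h2 : h ≤ g) :
    g = h := by
  rw [le_iff] at h1 h2
  obtain ⟨x, hx⟩ := h1
  obtain ⟨y, hy⟩ := h2
  have h3 : ofClass (x + y) = ofClass 0 := by
    rw [map_add, map_zero, ← hx, ← hy]; abel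
  have h4 := ProjClass.eq_zero_of_add_eq_zero (ofClass_injective hA h3)
  rw [h4, map_zero] at hx
  exact (sub_eq_zero.1 hx).symm

theorem le_total' (hA : IsPseudomatricial A) (g h : KZero A) : g ≤ h ∨ h ≤ g := by
  obtain ⟨x, y, hxy⟩ := exists_ofClass_sub (h - g)
  obtain ⟨z, hz | hz⟩ := hA.projClass_total x y
  · refine Or.inr (le_iff.2 ⟨z, ?_⟩)
    rw [← neg_sub, hxy, ← hz, map_add]; abel
  · refine Or.inl (le_iff.2 ⟨z, ?_⟩)
    rw [hxy, ← hz, map_add]; abel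

/-- By totality either `[m] ≤ x` or `x ≤ [m]`. In the second case `x` is `0` or `[m]`, because `[m]`
is an atom. -/
theorem mk_minimal_le (hA : IsPseudomatricial A) {m : A} (hm : IsMinimalProjection m)
    {x : ProjClass A} (hx : x ≠ 0) : ∃ z, ProjClass.mk (MatProj.ofProj m hm.1) + z = x := by
  obtain ⟨z, hz | hz⟩ := hA.projClass_total (ProjClass.mk (MatProj.ofProj m hm.1)) x
  · exact ⟨z, hz⟩
  · rcases hm.eq_zero_or_eq_zero hz with h | h
    · exact absurd h hx
    · exact ⟨0, by rw [← hz, h, add_zero, add_zero]⟩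

theorem add_minimal_le (hA : IsPseudomatricial A) {m : A} (hm : IsMinimalProjection m)
    {g h : KZero A} (hlt : g < h) : g + mk (MatProj.ofProj m hm.1) ≤ h := by
  obtain ⟨x, hx⟩ := le_iff.1 hlt.le
  have hx0 : x ≠ 0 := by
    rintro rfl
    rw [map_zero, sub_eq_zero] at hx
    exact hlt.ne hx.symm
  obtain ⟨z, hz⟩ := mk_minimal_le hA hm hx0
  refine le_iff.2 ⟨z, ?_⟩
  have h1 : mk (MatProj.ofProj m hm.1) + ofClass z = h - g := by
    rw [hx, ← hz, map_add]; rfl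
  rw [← sub_sub, ← h1]; abel

theorem lt_add_minimal (hA : IsPseudomatricial A) {m : A} (hm : IsMinimalProjection m)
    (g : KZero A) : g < g + mk (MatProj.ofProj m hm.1) := by
  refine lt_of_le_not_ge (le_iff.2 ⟨ProjClass.mk (MatProj.ofProj m hm.1), ?_⟩) fun h => ?_
  · rw [add_sub_cancel_left]; rfl
  · have h1 := le_antisymm' hA (le_iff.2 ⟨ProjClass.mk (MatProj.ofProj m hm.1), by
      rw [add_sub_cancel_left]; rfl⟩) h
    have h2 : ofClass (ProjClass.mk (MatProj.ofProj m hm.1)) = ofClass 0 := by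
      rw [map_zero]; exact left_eq_add.1 h1
    exact hm.mk_ne_zero (ofClass_injective hA h2)

theorem isLeast_add_minimal (hA : IsPseudomatricial A) {m : A} (hm : IsMinimalProjection m)
    (g : KZero A) : IsLeast {h : KZero A | g < h} (g + mk (MatProj.ofProj m hm.1)) :=
  ⟨lt_add_minimal hA hm g, fun _ h => add_minimal_le hA hm h⟩

theorem isGreatest_sub_minimal (hA : IsPseudomatricial A) {m : A} (hm : IsMinimalProjection m)
    (g : KZero A) : IsGreatest {h : KZero A | h < g} (g - mk (MatProj.ofProj m hm.1)) := by
  refine ⟨?_, fun h hlt => ?_⟩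
  · have := lt_add_minimal hA hm (g - mk (MatProj.ofProj m hm.1))
    rwa [sub_add_cancel] at this
  · have h1 := add_le_add_right' (-mk (MatProj.ofProj m hm.1)) (add_minimal_le hA hm hlt)
    rwa [add_neg_cancel_right, ← sub_eq_add_neg] at h1

end KZero

/-! ### Independent positive families in totally ordered groups -/

section TotallyOrderedGroups

variable {G : Type*} [AddCommGroup G]

theorem sum_smul_update_sub_update_add {ι : Type*} [Fintype ι] [DecidableEq ι] (x : ι → G)
    (c : ι → ℤ) {a b : ι} (hab : a ≠ b) :
    ∑ i, (Function.update c a (c a + c b)) i • (Function.update x b (x b - x a)) i =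
      ∑ i, c i • x i := by
  have hb : b ∈ Finset.univ.erase a := Finset.mem_erase.2 ⟨hab.symm, Finset.mem_univ b⟩
  rw [← Finset.add_sum_erase _ _ (Finset.mem_univ a), ← Finset.add_sum_erase _ _ hb,
    ← Finset.add_sum_erase _ (fun i => c i • x i) (Finset.mem_univ a), ← Finset.add_sum_erase _ _ hb]
  rw [← add_assoc, ← add_assoc]
  congr 1
  · rw [Function.update_self, Function.update_self, Function.update_of_ne hab,
      Function.update_of_ne hab.symm]
    module
  · refine Finset.sum_congr rfl fun i hi => ?_
    rw [Finset.mem_erase, Finset.mem_erase] at hi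
    rw [Function.update_of_ne hi.2.1, Function.update_of_ne hi.1]

theorem mem_closure_range_update_sub {ι : Type*} [DecidableEq ι] (x : ι → G) {a b : ι}
    (hab : a ≠ b) (i : ι) :
    x i ∈ AddSubmonoid.closure (Set.range (Function.update x b (x b - x a))) := by
  have h : ∀ j, Function.update x b (x b - x a) j ∈
      AddSubmonoid.closure (Set.range (Function.update x b (x b - x a))) := fun j =>
    AddSubmonoid.subset_closure ⟨j, rfl⟩
  by_cases hi : i = b
  · subst hi
    have h1 := add_mem (h i) (h a)
    rwa [Function.update_self, Function.update_of_ne hab, sub_add_cancel] at h1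
  · have h1 := h i
    rwa [Function.update_of_ne hi] at h1

variable [LinearOrder G] [IsOrderedAddMonoid G]

/-- A subtractive Euclidean algorithm on a relation `∑ c i • x i = 0`. Pick `c i₀ > 0` of maximal
absolute value and some `c j < 0`, and subtract the smaller of `x i₀`, `x j` from the larger. The
relation persists with one coefficient replaced by `c i₀ + c j`, and the old family lies in the
`ℕ`-span of the new one. The induction is lexicographic: on the bound `M` for the coefficients, the
number of coefficients attaining it, and the number of negative ones. With no negative coefficient
left, all terms vanish and `x i₀ = 0`. -/
theorem exists_nonneg_with_zero_of_bound {ι : Type*} [Fintype ι] [DecidableEq ι] (M : ℕ) :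
    ∀ (x : ι → G) (c : ι → ℤ), (∀ i, 0 ≤ x i) → c ≠ 0 → (∀ i, |c i| ≤ M) →
      ∑ i, c i • x i = 0 →
      ∃ y : ι → G, (∀ i, 0 ≤ y i) ∧ (∃ k, y k = 0) ∧
        ∀ i, x i ∈ AddSubmonoid.closure (Set.range y) := by
  induction M with
  | zero =>
    intro x c _ hc hM _
    exact absurd (funext fun i => abs_eq_zero.1 (le_antisymm (by simpa using hM i) (abs_nonneg _))) hc
  | succ M ihM =>
    suffices H : ∀ N : ℕ, ∀ (x : ι → G) (c : ι → ℤ), (∀ i, 0 ≤ x i) → c ≠ 0 →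
        (∀ i, |c i| ≤ (M + 1 : ℕ)) →
        (Finset.univ.filter fun i => |c i| = (M + 1 : ℕ)).card ≤ N → ∑ i, c i • x i = 0 →
        ∃ y : ι → G, (∀ i, 0 ≤ y i) ∧ (∃ k, y k = 0) ∧
          ∀ i, x i ∈ AddSubmonoid.closure (Set.range y) from
      fun x c hx hc hM hs => H _ x c hx hc hM le_rfl hs
    intro N
    induction N with
    | zero =>
      intro x c hx hc hM hN hs
      refine ihM x c hx hc (fun i => ?_) hs
      have h1 : i ∉ Finset.univ.filter fun i => |c i| = (M + 1 : ℕ) := by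
        rw [Finset.card_eq_zero.1 (Nat.le_zero.1 hN)]; simp
      have h2 : |c i| ≠ (M + 1 : ℕ) := by simpa using h1
      have h3 := hM i
      push_cast at h2 h3
      omega
    | succ N ihN =>
      suffices H : ∀ J : ℕ, ∀ (x : ι → G) (c : ι → ℤ) (i₀ : ι), (∀ i, 0 ≤ x i) →
          c i₀ = (M + 1 : ℕ) → (∀ i, |c i| ≤ (M + 1 : ℕ)) →
          (Finset.univ.filter fun i => |c i| = (M + 1 : ℕ)).card ≤ N + 1 →
          (Finset.univ.filter fun i => c i < 0).card ≤ J → ∑ i, c i • x i = 0 →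
          ∃ y : ι → G, (∀ i, 0 ≤ y i) ∧ (∃ k, y k = 0) ∧
            ∀ i, x i ∈ AddSubmonoid.closure (Set.range y) by
        intro x c hx hc hM hN hs
        by_cases h : ∃ i, |c i| = (M + 1 : ℕ)
        · obtain ⟨i, hi⟩ := h
          rcases abs_eq (by positivity) |>.1 hi with h1 | h1
          · exact H _ x c i hx h1 hM hN le_rfl hs
          -- Negating the relation makes the extremal coefficient positive.
          · refine H _ x (-c) i hx (by simp [h1]) (fun i => by simpa using hM i)
              (by simpa using hN) le_rfl ?_
            simp [Finset.sum_neg_distrib, hs]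
        · refine ihN x c hx hc hM ?_ hs
          rw [Finset.filter_eq_empty_iff.2 fun i _ hi => h ⟨i, hi⟩]
          simp
      intro J
      induction J with
      | zero =>
        intro x c i₀ hx hi₀ hM hN hJ hs
        have hnn : ∀ i, 0 ≤ c i := fun i => by
          have h1 : i ∉ Finset.univ.filter fun i => c i < 0 := by
            rw [Finset.card_eq_zero.1 (Nat.le_zero.1 hJ)]; simp
          simpa using h1
        have h0 := (Finset.sum_eq_zero_iff_of_nonneg fun i _ => zsmul_nonneg (hx i) (hnn i)).1 hs i₀
          (Finset.mem_univ _)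
        have hx0 : x i₀ = 0 := by
          rcases smul_eq_zero.1 h0 with h | h
          · rw [hi₀] at h; push_cast at h; omega
          · exact h
        exact ⟨x, hx, ⟨i₀, hx0⟩, fun i => AddSubmonoid.subset_closure ⟨i, rfl⟩⟩
      | succ J ihJ =>
        intro x c i₀ hx hi₀ hM hN hJ hs
        by_cases hneg : ∃ j, c j < 0
        swap
        · refine ihJ x c i₀ hx hi₀ hM hN ?_ hs
          rw [Finset.filter_eq_empty_iff.2 fun i _ hi => hneg ⟨i, hi⟩]
          simp
        obtain ⟨j, hj⟩ := hneg
        have hij : i₀ ≠ j := by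
          rintro rfl
          rw [hi₀] at hj; push_cast at hj; omega
        have hMj := abs_le.1 (hM j)
        push_cast at hMj hi₀
        have trans : ∀ x' : ι → G, (∀ i, x i ∈ AddSubmonoid.closure (Set.range x')) →
            (∃ y : ι → G, (∀ i, 0 ≤ y i) ∧ (∃ k, y k = 0) ∧
              ∀ i, x' i ∈ AddSubmonoid.closure (Set.range y)) →
            ∃ y : ι → G, (∀ i, 0 ≤ y i) ∧ (∃ k, y k = 0) ∧
              ∀ i, x i ∈ AddSubmonoid.closure (Set.range y) := by
          rintro x' hx' ⟨y, h1, h2, h3⟩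
          refine ⟨y, h1, h2, fun i => ?_⟩
          exact (AddSubmonoid.closure_le.2 (by rintro _ ⟨k, rfl⟩; exact h3 k)) (hx' i)
        rcases le_total (x i₀) (x j) with hle | hle
        -- `x j` becomes `x j - x i₀`, and the coefficient at `i₀` drops into `[0, M]`: one fewer
        -- extremal coefficient. The relation stays nontrivial because `c j` is unchanged.
        · refine trans _ (mem_closure_range_update_sub x hij) (ihN _
            (Function.update c i₀ (c i₀ + c j)) (fun i => ?_) (fun h => ?_) (fun i => ?_) ?_ ?_)
          · by_cases hi : i = j
            · subst hi; rw [Function.update_self]; exact sub_nonneg.2 hle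
            · rw [Function.update_of_ne hi]; exact hx i
          · have := congrFun h j
            rw [Function.update_of_ne hij.symm] at this
            exact hj.ne this
          · by_cases hi : i = i₀
            · subst hi
              rw [Function.update_self, abs_le]
              push_cast; constructor <;> omega
            · rw [Function.update_of_ne hi]; exact hM i
          · refine Nat.lt_succ_iff.1 (lt_of_lt_of_le (Finset.card_lt_card ?_) hN)
            refine Finset.ssubset_iff_of_subset (fun i hi => ?_) |>.2 ⟨i₀, ?_, ?_⟩
            · rw [Finset.mem_filter] at hi ⊢
              refine ⟨Finset.mem_univ _, ?_⟩
              by_cases hii : i = i₀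
              · subst hii
                have := hi.2
                rw [Function.update_self, abs_of_nonneg (by omega)] at this
                push_cast at this; omega
              · have := hi.2
                rwa [Function.update_of_ne hii] at this
            · rw [Finset.mem_filter, hi₀]
              exact ⟨Finset.mem_univ _, by push_cast; exact abs_of_nonneg (by positivity)⟩
            · rw [Finset.mem_filter, Function.update_self, abs_of_nonneg (by omega)]
              push_cast; omega
          · rw [sum_smul_update_sub_update_add x c hij, hs]
        -- `x i₀` becomes `x i₀ - x j`, and the coefficient at `j` becomes nonnegative and at most
        -- `M`: one fewer negative coefficient, and no new extremal one.
        · refine trans _ (mem_closure_range_update_sub x hij.symm) (ihJ _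
            (Function.update c j (c j + c i₀)) i₀ (fun i => ?_) ?_ (fun i => ?_) ?_ ?_ ?_)
          · by_cases hi : i = i₀
            · subst hi; rw [Function.update_self]; exact sub_nonneg.2 hle
            · rw [Function.update_of_ne hi]; exact hx i
          · rw [Function.update_of_ne hij]; push_cast; exact hi₀
          · by_cases hi : i = j
            · subst hi
              rw [Function.update_self, abs_le]
              push_cast; constructor <;> omega
            · rw [Function.update_of_ne hi]; exact hM i
          · refine (Finset.card_le_card fun i hi => ?_).trans hN
            rw [Finset.mem_filter] at hi ⊢
            refine ⟨Finset.mem_univ _, ?_⟩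
            by_cases hii : i = j
            · subst hii
              have := hi.2
              rw [Function.update_self, abs_of_nonneg (by omega)] at this
              push_cast at this; omega
            · have := hi.2
              rwa [Function.update_of_ne hii] at this
          · refine Nat.lt_succ_iff.1 (lt_of_lt_of_le (Finset.card_lt_card ?_) hJ)
            refine Finset.ssubset_iff_of_subset (fun i hi => ?_) |>.2 ⟨j, ?_, ?_⟩
            · rw [Finset.mem_filter] at hi ⊢
              refine ⟨Finset.mem_univ _, ?_⟩
              by_cases hii : i = j
              · rw [hii]; exact hj
              · have := hi.2
                rwa [Function.update_of_ne hii] at this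
            · rw [Finset.mem_filter]; exact ⟨Finset.mem_univ _, hj⟩
            · rw [Finset.mem_filter, Function.update_self]
              rintro ⟨-, h⟩; omega
          · rw [sum_smul_update_sub_update_add x c hij.symm, hs]

/-- A dependent family can be replaced by one with a zero member; dropping that member shortens the
family without changing its `ℕ`-span. -/
theorem exists_linearIndependent_nonneg (n : ℕ) (x : Fin n → G) (hx : ∀ i, 0 ≤ x i) :
    ∃ (m : ℕ) (y : Fin m → G), (∀ i, 0 ≤ y i) ∧ LinearIndependent ℤ y ∧
      ∀ i, x i ∈ AddSubmonoid.closure (Set.range y) := by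
  induction n with
  | zero => exact ⟨0, x, hx, linearIndependent_empty_type, fun i => i.elim0⟩
  | succ n ih =>
    by_cases hli : LinearIndependent ℤ x
    · exact ⟨n + 1, x, hx, hli, fun i => AddSubmonoid.subset_closure ⟨i, rfl⟩⟩
    · obtain ⟨c, hc, i, hi⟩ := Fintype.not_linearIndependent_iff.1 hli
      obtain ⟨B, hB⟩ : ∃ B : ℕ, ∀ i, |c i| ≤ B :=
        ⟨∑ i, (c i).natAbs, fun i => by
          rw [Int.abs_eq_natAbs]
          exact_mod_cast Finset.single_le_sum (f := fun i => (c i).natAbs)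
            (fun _ _ => Nat.zero_le _) (Finset.mem_univ i)⟩
      obtain ⟨y, hy, ⟨k, hk⟩, hxy⟩ := exists_nonneg_with_zero_of_bound B x c hx
        (fun h => hi (congrFun h i)) hB hc
      obtain ⟨m, z, hz, hzli, hyz⟩ := ih (fun i => y (k.succAbove i)) fun i => hy _
      refine ⟨m, z, hz, hzli, fun i => ?_⟩
      refine (AddSubmonoid.closure_le.2 ?_) (hxy i)
      rintro _ ⟨j, rfl⟩
      rcases eq_or_ne j k with rfl | hj
      · rw [hk]; exact zero_mem _
      · obtain ⟨j', rfl⟩ := Fin.exists_succAbove_eq hj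
        exact hyz j'

end TotallyOrderedGroups

/-! ### Countable totally ordered groups as limits of simplicial groups -/

section DimensionGroups

variable {G : Type*} [AddCommGroup G]

/-- The homomorphism `ℤᵐ → G` that sends the standard basis to a given family. -/
def intCombination {ι : Type*} [Fintype ι] (y : ι → G) : (ι → ℤ) →+ G :=
  (Fintype.linearCombination ℤ y).toAddMonoidHom

theorem intCombination_apply {ι : Type*} [Fintype ι] (y : ι → G) (x : ι → ℤ) :
    intCombination y x = ∑ i, x i • y i := rfl

theorem intCombination_injective {ι : Type*} [Fintype ι] {y : ι → G}
    (hy : LinearIndependent ℤ y) : Function.Injective (intCombination y) :=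
  hy.fintypeLinearCombination_injective

theorem exists_nonneg_intCombination {ι : Type*} [Fintype ι] {y : ι → G} {g : G}
    (hg : g ∈ AddSubmonoid.closure (Set.range y)) : ∃ x : ι → ℤ, 0 ≤ x ∧ intCombination y x = g := by
  obtain ⟨a, rfl⟩ := AddSubmonoid.mem_closure_range_iff_of_fintype.1 hg
  exact ⟨fun i => (a i : ℤ), fun i => Int.natCast_nonneg _, by
    simp [intCombination_apply, natCast_zsmul]⟩

theorem exists_nonneg_intCombination_comp {ι κ : Type*} [Fintype ι] [Fintype κ] {y : ι → G}
    {z : κ → G} (h : ∀ i, y i ∈ AddSubmonoid.closure (Set.range z)) :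
    ∃ f : (ι → ℤ) →+ (κ → ℤ), (∀ x, intCombination z (f x) = intCombination y x) ∧
      ∀ x, 0 ≤ x → 0 ≤ f x := by
  choose a ha hay using fun i => exists_nonneg_intCombination (h i)
  refine ⟨intCombination a, fun x => ?_, fun x hx => ?_⟩
  · rw [intCombination_apply a, map_sum, intCombination_apply]
    exact Finset.sum_congr rfl fun i _ => by rw [map_zsmul, hay]
  · rw [intCombination_apply]
    exact Finset.sum_nonneg fun i _ => smul_nonneg (hx i) (ha i)

variable [LinearOrder G] [IsOrderedAddMonoid G]

theorem intCombination_nonneg {ι : Type*} [Fintype ι] {y : ι → G} (hy : ∀ i, 0 ≤ y i)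
    {x : ι → ℤ} (hx : 0 ≤ x) : 0 ≤ intCombination y x :=
  Finset.sum_nonneg fun i _ => zsmul_nonneg (hy i) (hx i)

variable (G) in
/-- Finite families of positive elements that are independent over `ℤ`. -/
structure PositiveFamily where
  /-- the number of elements -/
  size : ℕ
  /-- the elements -/
  elem : Fin size → G
  nonneg : ∀ i, 0 ≤ elem i
  independent : LinearIndependent ℤ elem

theorem PositiveFamily.exists_refinement (b : PositiveFamily G) {g : G} (hg : 0 ≤ g) :
    ∃ c : PositiveFamily G, (∀ i, b.elem i ∈ AddSubmonoid.closure (Set.range c.elem)) ∧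
      g ∈ AddSubmonoid.closure (Set.range c.elem) := by
  obtain ⟨m, y, hy, hli, hmem⟩ := exists_linearIndependent_nonneg (b.size + 1)
    (Fin.cons g b.elem : Fin (b.size + 1) → G) (Fin.cases hg b.nonneg)
  exact ⟨⟨m, y, hy, hli⟩, fun i => hmem i.succ, hmem 0⟩

variable (G) in
theorem exists_positiveFamily_seq [Countable G] : ∃ b : ℕ → PositiveFamily G,
    (∀ k l, k ≤ l → ∀ i, (b k).elem i ∈ AddSubmonoid.closure (Set.range (b l).elem)) ∧
    ∀ g : G, 0 ≤ g → ∃ k, g ∈ AddSubmonoid.closure (Set.range (b k).elem) := by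
  have : Nonempty {g : G // 0 ≤ g} := ⟨⟨0, le_rfl⟩⟩
  obtain ⟨e, he⟩ := exists_surjective_nat {g : G // 0 ≤ g}
  choose next h1 h2 using fun (b : PositiveFamily G) (g : {g : G // 0 ≤ g}) =>
    b.exists_refinement g.2
  -- Starting from the empty family, stage `k + 1` refines stage `k` so as to absorb the `k`-th
  -- positive element.
  let b : ℕ → PositiveFamily G := fun k => Nat.rec
    ⟨0, Fin.elim0, fun i => i.elim0, linearIndependent_empty_type⟩ (fun k c => next c (e k)) k
  refine ⟨b, fun k l hkl => ?_, fun g hg => ?_⟩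
  · induction l, hkl using Nat.le_induction with
    | base => exact fun i => AddSubmonoid.subset_closure ⟨i, rfl⟩
    | succ l _ ih =>
      have hle : AddSubmonoid.closure (Set.range (b l).elem) ≤
          AddSubmonoid.closure (Set.range (b (l + 1)).elem) :=
        AddSubmonoid.closure_le.2 (Set.range_subset_iff.2 (h1 (b l) (e l)))
      exact fun i => hle (ih i)
  · obtain ⟨k, hk⟩ := he ⟨g, hg⟩
    have h : (e k : G) ∈ AddSubmonoid.closure (Set.range (b (k + 1)).elem) := h2 (b k) (e k)
    have hg' : (e k : G) = g := congrArg Subtype.val hk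
    exact ⟨k + 1, hg' ▸ h⟩

variable (G) in
/-- A countable totally ordered abelian group is a dimension group. -/
theorem isDimensionGroup_of_linearOrder [Countable G] : IsDimensionGroup G := by
  refine ⟨inferInstance, ?_⟩
  obtain ⟨b, hb, hsurj⟩ := exists_positiveFamily_seq G
  choose f hf hpos using fun k l (h : k ≤ l) => exists_nonneg_intCombination_comp (hb k l h)
  have hinj : ∀ k, Function.Injective (intCombination (b k).elem) := fun k =>
    intCombination_injective (b k).independent
  have hmem : ∀ g : G, 0 ≤ g → ∃ k x, 0 ≤ x ∧ intCombination (b k).elem x = g := fun g hg => by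
    obtain ⟨k, hk⟩ := hsurj g hg
    exact ⟨k, exists_nonneg_intCombination hk⟩
  let φ := AddCommGroup.DirectLimit.lift (fun k => Fin (b k).size → ℤ) f G
    (fun k => intCombination (b k).elem) hf
  have hφ : ∀ k x, φ (AddCommGroup.DirectLimit.of _ f k x) = intCombination (b k).elem x :=
    fun k x => AddCommGroup.DirectLimit.lift_of G _ hf k x
  have hbij : Function.Bijective φ := by
    refine ⟨AddCommGroup.DirectLimit.lift_injective G _ hf hinj, fun g => ?_⟩
    rcases le_total 0 g with hg | hg
    · obtain ⟨k, x, -, hx⟩ := hmem g hg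
      exact ⟨AddCommGroup.DirectLimit.of _ f k x, (hφ k x).trans hx⟩
    · obtain ⟨k, x, -, hx⟩ := hmem (-g) (neg_nonneg.2 hg)
      exact ⟨AddCommGroup.DirectLimit.of _ f k (-x), by rw [hφ, map_neg, hx, neg_neg]⟩
  -- The connecting maps were chosen separately for each pair of stages; they form a directed system
  -- because the maps to `G` are injective and compatible with them.
  refine ⟨fun k => (b k).size, f, ⟨fun k x => hinj k (hf k k _ x), fun m l k hkl hlm x =>
    hinj m ?_⟩, hpos, AddEquiv.ofBijective φ hbij, fun g => ⟨fun hg => ?_, ?_⟩⟩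
  · rw [hf, hf, hf]
  · obtain ⟨k, x, hx, h⟩ := hmem g hg
    exact ⟨k, x, hx, (hφ k x).trans h⟩
  · rintro ⟨k, x, hx, rfl⟩
    exact (intCombination_nonneg (b k).nonneg hx).trans_eq (hφ k x).symm

end DimensionGroups

/-! ### Assembling the statement -/

section Unital

variable {A : Type*} [CStarAlgebra A]

theorem MvNEquiv.symm {p q : A} (h : MvNEquiv p q) : MvNEquiv q p := by
  obtain ⟨v, h1, h2⟩ := h
  exact ⟨star v, by rw [star_star, h2], by rw [star_star, h1]⟩

theorem IsPseudomatricial.mvNLE_antisymm (hA : IsPseudomatricial A) {p q : A}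
    (hp : IsStarProjection p) (hq : IsStarProjection q) (h : MvNLE p q) (h' : MvNLE q p) :
    MvNEquiv p q := by
  obtain ⟨z, hz⟩ := h.exists_projClass_add hp hq
  obtain ⟨w, hw⟩ := h'.exists_projClass_add hq hp
  have hzw : z + w = 0 := by
    refine hA.projClass_cancel (z := ProjClass.mk (MatProj.ofProj p hp)) ?_
    rw [add_comm, ← add_assoc, hz, hw, zero_add]
  rw [ProjClass.eq_zero_of_add_eq_zero hzw, add_zero] at hz
  exact (mvNEquiv_iff_projClass hp hq).1 hz

theorem IsPseudomatricial.isDimensionGroup_kZero (hA : IsPseudomatricial A)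
    [Countable (KZero A)] : IsDimensionGroup (KZero A) := by
  classical
  -- The linear order extends the given preorder of `K₀(A)`, so the conclusion concerns the original
  -- positive cone.
  let _ : LinearOrder (KZero A) :=
    { KZero.preorder A with
      le_antisymm := fun _ _ => KZero.le_antisymm' hA
      le_total := KZero.le_total' hA
      toDecidableLE := Classical.decRel _ }
  have : IsOrderedAddMonoid (KZero A) := {
    add_le_add_left := fun _ _ h k => KZero.add_le_add_right' k h }
  exact isDimensionGroup_of_linearOrder (KZero A)

theorem IsPseudomatricial.unital_structure (hA : IsPseudomatricial A) :
    (∀ p q : A, IsStarProjection p → IsStarProjection q → MvNLE p q ∨ MvNLE q p) ∧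
    (∀ p q r : A, IsStarProjection p → IsStarProjection q → IsStarProjection r →
      MvNLE p q → MvNLE q r → MvNLE p r) ∧
    (∀ p q : A, IsStarProjection p → IsStarProjection q →
      (MvNLE p q ∧ MvNLE q p ↔ MvNEquiv p q)) ∧
    (∀ g h k : KZero A, g ≤ h → g + k ≤ h + k) ∧
    (∀ g h : KZero A, g ≤ h → h ≤ g → g = h) ∧
    (∀ g h : KZero A, g ≤ h ∨ h ≤ g) ∧
    (∃ m : A, IsMinimalProjection m) ∧
    (∀ (m : A) (hm : IsMinimalProjection m) (g : KZero A),
      IsLeast {h : KZero A | g < h} (g + KZero.mk (MatProj.ofProj m hm.1)) ∧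
      IsGreatest {h : KZero A | h < g} (g - KZero.mk (MatProj.ofProj m hm.1))) ∧
    (TopologicalSpace.SeparableSpace A →
      Countable (KZero A) ∧ IsDimensionGroup (KZero A)) :=
  ⟨fun _ _ hp hq => hA.mvNLE_total hp hq, fun _ _ _ hp _ hr h h' => h.trans hp hr h',
    fun _ _ hp hq => ⟨fun h => hA.mvNLE_antisymm hp hq h.1 h.2,
      fun h => ⟨h.mvNLE hq, h.symm.mvNLE hp⟩⟩,
    fun _ _ k h => KZero.add_le_add_right' k h, fun _ _ => KZero.le_antisymm' hA,
    KZero.le_total' hA, hA.exists_isMinimalProjection,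
    fun _ hm g => ⟨KZero.isLeast_add_minimal hA hm g, KZero.isGreatest_sub_minimal hA hm g⟩,
    fun _ => by
      have := countable_projClass A
      have := KZero.countable_of_projClass (A := A)
      exact ⟨this, hA.isDimensionGroup_kZero⟩⟩

end Unital

theorem corollary6p3 {A : Type*} [NonUnitalCStarAlgebra A] (hA : IsPseudomatricial A) :
    -- `A` has a unit
    (∃ e : A, ∀ x : A, e * x = x ∧ x * e = x) ∧
    -- subequivalence totally orders the projections of `A` up to equivalence
    (∀ p q : A, IsStarProjection p → IsStarProjection q → MvNLE p q ∨ MvNLE q p) ∧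
    (∀ p q r : A, IsStarProjection p → IsStarProjection q → IsStarProjection r →
      MvNLE p q → MvNLE q r → MvNLE p r) ∧
    (∀ p q : A, IsStarProjection p → IsStarProjection q →
      (MvNLE p q ∧ MvNLE q p ↔ MvNEquiv p q)) ∧
    -- `K₀(A)` is a totally ordered abelian group
    (∀ g h k : KZero A, g ≤ h → g + k ≤ h + k) ∧
    (∀ g h : KZero A, g ≤ h → h ≤ g → g = h) ∧
    (∀ g h : KZero A, g ≤ h ∨ h ≤ g) ∧
    -- successors and predecessors, given by the class of any minimal projection
    (∃ m : A, IsMinimalProjection m) ∧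
    (∀ (m : A) (hm : IsMinimalProjection m) (g : KZero A),
      IsLeast {h : KZero A | g < h} (g + KZero.mk (MatProj.ofProj m hm.1)) ∧
      IsGreatest {h : KZero A | h < g} (g - KZero.mk (MatProj.ofProj m hm.1))) ∧
    -- the separable case
    (TopologicalSpace.SeparableSpace A →
      Countable (KZero A) ∧ IsDimensionGroup (KZero A)) := by
  obtain ⟨e, he⟩ := hA.exists_unit
  let _ := CStarAlgebra.ofUnit e he
  -- The unital structure is built on top of the given one, so projections, `K₀(A)` and the
  -- hypothesis are unchanged by definition.
  exact ⟨⟨e, he⟩, IsPseudomatricial.unital_structure (A := A) hA⟩
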